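/- **Opening-conditional tag simulatability.** *Setting.* For each security parameter $\lambda$ let $\mathbb G$ be a group of prime order $p=p(\lambda)>3$ with generator $\mathcal G$, efficient group operations and $\lceil\log_2 p\rceil=\Theta(\lambda)$. Public parameters $\mathsf{pp}=(\mathbb G,p,\mathcal G,\mathcal H)$ come from a transparent setup, in which $\mathcal H\notin\{0,\mathcal G\}$ is a deterministic function of a public random source. All experiments sample $\mathsf{pp}$ from this setup. There is a global lazily sampled random oracle $H$ that takes a context and a string to $\{0,1\}^\lambda$; only simulators may program it, only in designated contexts, and only at points that are still undefined. $\mathrm{PPT}$ means strict probabilistic polynomial time in $\lambda$ and the input length; all PPT distinguishers below may query $H$ but not program it. *DDLEQ hardness.* No PPT adversary, given $\mathsf{pp}$ and $(A,B)$, guesses a uniform bit $b$ with probability non-negligibly far from $1/2$, where $r,s\leftarrow\mathbb Z_p^*$ are independent and uniform, $(A,B)=(r\mathcal G,r\mathcal H)$ if $b=1$, and $(A,B)=(r\mathcal G,s\mathcal H)$ if $b=0$. *Proof system.* $\Pi_{\mathsf{DLEQ}}=(\mathcal P,\mathcal V)$ is the Fischlin transform, in a programmable context, of the Chaum–Pedersen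 protocol for $\{((A,B),r): r\in\mathbb Z_p^*,\ A=r\mathcal G,\ B=r\mathcal H\}$, with statements $A,B\in\mathbb G\setminus\{0\}$ and parameters $t,b,r_0,S$ (challenge length, hash length, number of repetitions, slack) satisfying $t,b,r_0=O(\log\lambda)$, $b\le t$, $b\le\lambda$, $2^t<p$, $b\,r_0=\omega(\log\lambda)$, $2^{t-b}=\omega(\log\lambda)$, $S=\Theta(r_0)$. Explicitly, $\mathcal P$ computes $J_{1,i}=j_i\mathcal G$, $J_{2,i}=j_i\mathcal H$ with $j_i\leftarrow\mathbb Z_p$ for $i\le r_0$; for each $i$ it tries $e=0,1,\dots,2^t-1$ with $z=j_i+er$, stops at the first $e$ for which the last $b$ bits of $H(\langle (A,B),(J_{1,k},J_{2,k})_k,i,e,z\rangle)$ vanish, and otherwise takes the last $e$ for which this $b$-bit value is minimal. The proof is the list of $(J_{1,i},J_{2,i},e_i,z_i)$. $\mathcal V$ accepts iff $A,B\ne0$, there are $r_0$ repetitions, $0\le e_i<2^t$, $z_i\mathcal G=J_{1,i}+e_iA$ and $z_i\mathcal H=J_{2,i}+e_iB$ for all $i$, and the $b$-bit hash values sum to at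 most $S$. *Universal simulation interface.* A PPT machine $\mathsf{Sim}_{\mathsf{DLEQ}}(\mathsf{pp},(A,B))$ that may query and program $H$ has this property if (i) no PPT distinguisher, given $\mathsf{pp}$, $(A,B)=(r\mathcal G,r\mathcal H)$ with $r\leftarrow\mathbb Z_p^*$ uniform, and a proof, tells with non-negligible advantage whether the proof was produced by $\mathcal P$ or by $\mathsf{Sim}_{\mathsf{DLEQ}}$; and (ii) there is a negligible $\mu$ such that for all $\mathsf{pp}$ and all $A,B\in\mathbb G\setminus\{0\}$, whether the statement is true or false, the output of $\mathsf{Sim}_{\mathsf{DLEQ}}(\mathsf{pp},(A,B))$ is accepted by $\mathcal V$ with probability at least $1-\mu(\lambda)$. *USV certificates.* $\mathsf{Cert}(\mathsf{pp},m)$ samples $r\leftarrow\mathbb Z_p^*\setminus\{-m\}$, sets $M=m\mathcal G$, $C=M+r\mathcal H$, $\nu=mr^{-1}$, $\upsilon=(m+r)\mathcal G$, computes a proof $\pi\leftarrow\mathcal P(\mathsf{pp},(\upsilon-M,C-M),r)$ and outputs $(C,\zeta)$ with $\zeta=(\nu,\upsilon,\pi)$. $\mathsf{Derive}(\mathsf{pp},C,\zeta)$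 is $\perp$ if $\nu=-1$, and otherwise $(M,C-M)$ with $M=\frac{\nu}{\nu+1}\upsilon$. $\mathsf{Vcert}(\mathsf{pp},C,\zeta)=1$ iff $\mathsf{Derive}(\mathsf{pp},C,\zeta)=(M,R)\neq\perp$ and $\mathcal V(\mathsf{pp},(\upsilon-M,C-M),\pi)=1$. $\mathsf{Open}(\mathsf{pp},C,\zeta)$ is $\mathsf{Derive}(\mathsf{pp},C,\zeta)$ if $\mathsf{Vcert}(\mathsf{pp},C,\zeta)=1$, and $\perp$ otherwise. The tag simulator $\mathsf S_{\mathsf{cert}}(\mathsf{pp},C,(M,R))$ samples $\bar\nu\leftarrow\mathbb Z_p^*\setminus\{-1\}$, sets $\bar\upsilon=(1+\bar\nu^{-1})M$, runs $\bar\pi\leftarrow\mathsf{Sim}_{\mathsf{DLEQ}}(\mathsf{pp},(\bar\upsilon-M,C-M))$ and outputs $\tilde\zeta=(\bar\nu,\bar\upsilon,\bar\pi)$ (and a fixed trivial tag on input $\perp$ instead of $(M,R)$). **Lemma.** Assume DDLEQ hardness and that $\mathsf{Sim}_{\mathsf{DLEQ}}$ has the universal simulation interface for $\Pi_{\mathsf{DLEQ}}$.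 Then: 1. $\mathsf S_{\mathsf{cert}}$ is PPT. 2. There is a negligible $\mu$ such that for all $\lambda$, all $\mathsf{pp}$ and all $C=M+R$ with $M,R\in\mathbb G\setminus\{0\}$, a tag $\tilde\zeta\leftarrow\mathsf S_{\mathsf{cert}}(\mathsf{pp},C,(M,R))$ satisfies $\mathsf{Vcert}(\mathsf{pp},C,\tilde\zeta)=1$ and $\mathsf{Derive}(\mathsf{pp},C,\tilde\zeta)=(M,R)$ with probability at least $1-\mu(\lambda)$. 3. For $m\leftarrow\mathbb Z_p^*$ uniform, $(C,\zeta)\leftarrow\mathsf{Cert}(\mathsf{pp},m)$, $\Upsilon\leftarrow\mathsf{Open}(\mathsf{pp},C,\zeta)$ and $\tilde\zeta\leftarrow\mathsf S_{\mathsf{cert}}(\mathsf{pp},C,\Upsilon)$, the tuples $(\mathsf{pp},C,\Upsilon,\zeta)$ and $(\mathsf{pp},C,\Upsilon,\tilde\zeta)$ are computationally indistinguishable. -/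

import Mathlib

open Asymptotics Filter

noncomputable section

/-! ### The lazily sampled, restricted-programmable random oracle

Bit strings and contexts are written as natural numbers (in binary).  For security parameter `lam`
the oracle maps a context and a string to an element of `{0,1}^lam`, written as `Fin (2 ^ lam)`. -/

/-- The partial table of the points of the oracle that are already defined. -/
abbrev OTable (lam : ℕ) : Type := ℕ → ℕ → Option (Fin (2 ^ lam))

/-- The table before any query. -/
def emptyTable (lam : ℕ) : OTable lam := fun _ _ => none

/-- Randomized computations sharing one oracle table. -/
abbrev OracleComp (lam : ℕ) (α : Type) : Type := StateT (OTable lam) PMF α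

def OTable.define {lam : ℕ} (T : OTable lam) (ctx x : ℕ) (y : Fin (2 ^ lam)) : OTable lam :=
  Function.update T ctx (Function.update (T ctx) x (some y))

/-- `Query(ctx, x)`: a fresh point gets an independent uniform value. -/
def oracleQuery {lam : ℕ} (ctx x : ℕ) : OracleComp lam ℕ := fun T =>
  match T ctx x with
  | some y => pure (y.val, T)
  | none => do
      let y ← PMF.uniformOfFintype (Fin (2 ^ lam))
      pure (y.val, T.define ctx x y)

/-- `SimProgramRO(ctx, x, y)`: fails (value `false`) if the context is not programmable, if the
point is already defined, or if `y` is not in the range of the oracle. -/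
def oracleProgram {lam : ℕ} (U : Finset ℕ) (ctx x y : ℕ) : OracleComp lam Bool := fun T =>
  if h : y < 2 ^ lam then
    if ctx ∈ U ∧ T ctx x = none then pure (true, T.define ctx x ⟨y, h⟩) else pure (false, T)
  else pure (false, T)

/-- The probability that an experiment started with the empty oracle outputs `true`. -/
def OracleComp.prob {lam : ℕ} (c : OracleComp lam Bool) : ℝ :=
  ((c.run' (emptyTable lam)) true).toReal

/-! ### The machine model: a randomized oracle random access machine with logarithmic cost

A machine has finitely many named arrays of natural numbers, all cells being `0` at the start.
Every evaluated subexpression is charged one step plus the bit length of its value, every command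
at least one step.  Loops are executed a number of times that is computed on entry, and each
iteration is charged; a machine with a polynomial running time can always be written so, the bound
on its running time being the number of iterations. -/

inductive ArithOp where
  | add | sub | mul | div | mod

def ArithOp.eval : ArithOp → ℕ → ℕ → ℕ
  | .add, x, y => x + y
  | .sub, x, y => x - y
  | .mul, x, y => x * y
  | .div, x, y => x / y
  | .mod, x, y => x % y

/-- `m a i` is the content of cell `i` of the array named `a`. -/
abbrev Memory : Type := ℕ → ℕ → ℕ

def Memory.write (m : Memory) (a i v : ℕ) : Memory :=
  Function.update m a (Function.update (m a) i v)

inductive RExpr where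
  | const (n : ℕ)
  | read (a : ℕ) (i : RExpr)
  | op (o : ArithOp) (e f : RExpr)

def RExpr.eval (m : Memory) : RExpr → ℕ
  | .const n => n
  | .read a i => m a (i.eval m)
  | .op o e f => o.eval (e.eval m) (f.eval m)

def RExpr.cost (m : Memory) : RExpr → ℕ
  | .const n => 1 + n.size
  | .read a i => 1 + i.cost m + (m a (i.eval m)).size
  | .op o e f => 1 + e.cost m + f.cost m + (o.eval (e.eval m) (f.eval m)).size

inductive Prog where
  | skip
  /-- `a[i] := e` -/
  | assign (a : ℕ) (i e : RExpr)
  | seq (P Q : Prog)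
  /-- run `P` if the value of `c` is not `0`, and `Q` otherwise -/
  | ite (c : RExpr) (P Q : Prog)
  /-- evaluate `n` once, then run `P` that many times -/
  | loop (n : RExpr) (P : Prog)
  /-- `a[i] := ` a uniform element of `{0, ..., n - 1}` (and `0` if `n = 0`) -/
  | rand (a : ℕ) (i n : RExpr)
  /-- `a[i] := Query(ctx, x)` -/
  | query (a : ℕ) (i ctx x : RExpr)
  /-- `a[i] := 1` if `SimProgramRO(ctx, x, y)` succeeds, and `a[i] := 0` if it fails -/
  | program (a : ℕ) (i ctx x y : RExpr)

structure Config (lam : ℕ) where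
  mem : Memory
  table : OTable lam
  steps : ℕ

/-- Write to memory, install a new table and charge `k` steps. -/
def Config.update {lam : ℕ} (c : Config lam) (a i v : ℕ) (T : OTable lam) (k : ℕ) : Config lam :=
  ⟨c.mem.write a i v, T, c.steps + k⟩

def Config.charge {lam : ℕ} (c : Config lam) (k : ℕ) : Config lam := ⟨c.mem, c.table, c.steps + k⟩

def iterM {α : Type} (f : α → PMF α) : ℕ → α → PMF α
  | 0, x => pure x
  | n + 1, x => f x >>= iterM f n

/-- Execution with set `U` of programmable contexts. -/
def Prog.exec {lam : ℕ} (U : Finset ℕ) : Prog → Config lam → PMF (Config lam)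
  | .skip, c => pure (c.charge 1)
  | .assign a i e, c =>
      pure (c.update a (i.eval c.mem) (e.eval c.mem) c.table (1 + i.cost c.mem + e.cost c.mem))
  | .seq P Q, c => P.exec U c >>= Q.exec U
  | .ite e P Q, c =>
      if e.eval c.mem ≠ 0 then P.exec U (c.charge (1 + e.cost c.mem))
      else Q.exec U (c.charge (1 + e.cost c.mem))
  | .loop n P, c => iterM (P.exec U) (n.eval c.mem) (c.charge (1 + n.cost c.mem))
  | .rand a i n, c => do
      let v ← PMF.uniformOfFintype (Fin (n.eval c.mem - 1 + 1))
      pure (c.update a (i.eval c.mem) v.val c.table (1 + i.cost c.mem + n.cost c.mem))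
  | .query a i ctx x, c => do
      let v ← oracleQuery (ctx.eval c.mem) (x.eval c.mem) c.table
      pure (c.update a (i.eval c.mem) v.1 v.2
        (1 + lam + i.cost c.mem + ctx.cost c.mem + x.cost c.mem))
  | .program a i ctx x y, c => do
      let v ← oracleProgram U (ctx.eval c.mem) (x.eval c.mem) (y.eval c.mem) c.table
      pure (c.update a (i.eval c.mem) v.1.toNat v.2
        (1 + lam + i.cost c.mem + ctx.cost c.mem + x.cost c.mem + y.cost c.mem))

/-- No command of the program touches the oracle. -/
def Prog.OracleFree : Prog → Prop
  | .seq P Q => P.OracleFree ∧ Q.OracleFree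
  | .ite _ P Q => P.OracleFree ∧ Q.OracleFree
  | .loop _ P => P.OracleFree
  | .query .. => False
  | .program .. => False
  | _ => True

/-- The program may query the oracle but never programs it. -/
def Prog.ProgramFree : Prog → Prop
  | .seq P Q => P.ProgramFree ∧ Q.ProgramFree
  | .ite _ P Q => P.ProgramFree ∧ Q.ProgramFree
  | .loop _ P => P.ProgramFree
  | .program .. => False
  | _ => True

/-- Array `0` holds the security parameter followed by the input, and cell `0` of array `1` holds
the number of inputs. -/
def startConfig (lam : ℕ) (input : List ℕ) (T : OTable lam) : Config lam where
  mem := fun a i => match a, i with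
    | 0, i => (lam :: input).getD i 0
    | 1, 0 => input.length
    | _, _ => 0
  table := T
  steps := 0

/-- The output is the initial part of array `2` whose length stands in cell `0` of array `3`. -/
def Config.output {lam : ℕ} (c : Config lam) : List ℕ := (List.range (c.mem 3 0)).map (c.mem 2)

/-- Total bit length of a list of numbers, with one separator for each. -/
def listSize (l : List ℕ) : ℕ := (l.map fun v => v.size + 1).sum

/-- The function (with oracle and coins) that a program computes. -/
def Prog.run (U : Finset ℕ) (P : Prog) (lam : ℕ) (input : List ℕ) :
    OracleComp lam (List ℕ) := fun T => do
  let c ← P.exec U (startConfig lam input T)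
  pure (c.output, c.table)

/-- Strict polynomial time in the security parameter (in unary) and the length of the input,
for all coins and all oracle answers; writing the output is charged. -/
def Prog.PolyTime (U : Finset ℕ) (P : Prog) : Prop :=
  ∃ q : Polynomial ℕ, ∀ (lam : ℕ) (input : List ℕ) (T : OTable lam),
    ∀ c ∈ (P.exec U (startConfig lam input T)).support,
      c.steps + listSize c.output ≤ q.eval (lam + listSize input)

/-- Run a program as a distinguisher: `true` iff its output is `1`. -/
def Prog.accepts (U : Finset ℕ) (P : Prog) (lam : ℕ) (input : List ℕ) : OracleComp lam Bool := do
  let o ← P.run U lam input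
  pure (o == [1])

/-- Negligible functions of the security parameter. -/
def Negligible (f : ℕ → ℝ) : Prop := SuperpolynomialDecay atTop (fun n : ℕ => (n : ℝ)) f

/-! ### Prime-order groups, public parameters and the DDLEQ assumption -/

/-- A family of groups of prime order with a fixed generator and efficient group operations on
bit-string representations of the elements. -/
structure GroupFamily where
  p : ℕ → ℕ
  prime : ∀ lam, (p lam).Prime
  three_lt : ∀ lam, 3 < p lam
  /-- the bit length of the order is linear in the security parameter -/
  size_theta : (fun lam => (Nat.clog 2 (p lam) : ℝ)) =Θ[atTop] (fun lam : ℕ => (lam : ℝ))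
  G : ℕ → Type
  [grp : ∀ lam, AddCommGroup (G lam)]
  card : ∀ lam, Nat.card (G lam) = p lam
  gen : ∀ lam, G lam
  gen_ne_zero : ∀ lam, gen lam ≠ 0
  /-- the description of the group that is part of the public parameters -/
  desc : ℕ → ℕ
  enc : ∀ lam, G lam → ℕ
  enc_injective : ∀ lam, Function.Injective (enc lam)
  size_bound : ∃ q : Polynomial ℕ, ∀ lam, (desc lam).size ≤ q.eval lam ∧
    ∀ X : G lam, (enc lam X).size ≤ q.eval lam
  addProg : Prog
  addProg_free : addProg.OracleFree
  addProg_polyTime : addProg.PolyTime ∅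
  addProg_run : ∀ (lam : ℕ) (X Y : G lam),
    addProg.run ∅ lam [desc lam, p lam, enc lam X, enc lam Y] = pure [enc lam (X + Y)]
  smulProg : Prog
  smulProg_free : smulProg.OracleFree
  smulProg_polyTime : smulProg.PolyTime ∅
  smulProg_run : ∀ (lam : ℕ) (k : ℕ) (X : G lam),
    smulProg.run ∅ lam [desc lam, p lam, k, enc lam X] = pure [enc lam (k • X)]

attribute [instance] GroupFamily.grp

instance (F : GroupFamily) (lam : ℕ) : Fact (F.p lam).Prime := ⟨F.prime lam⟩

namespace GroupFamily

variable (F : GroupFamily)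

/-- The scalars modulo the group order. -/
abbrev Scalar (lam : ℕ) : Type := ZMod (F.p lam)

/-- Scalar multiplication. -/
def act {lam : ℕ} (k : F.Scalar lam) (X : F.G lam) : F.G lam := k.val • X

theorem exists_scalar {lam : ℕ} (a : F.Scalar lam) : Nonempty {k : F.Scalar lam // k ≠ 0 ∧ k ≠ a} := by
  by_contra hcon
  have hsub : (Finset.univ : Finset (F.Scalar lam)) ⊆ {0, a} := by
    intro k _
    by_contra hk
    exact hcon ⟨⟨k, by simpa [not_or] using hk⟩⟩
  have h1 := Finset.card_le_card hsub
  have h2 : ({0, a} : Finset (F.Scalar lam)).card ≤ 2 := Finset.card_le_two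
  have h3 : (Finset.univ : Finset (F.Scalar lam)).card = F.p lam := by
    rw [Finset.card_univ, ZMod.card]
  have h4 := F.three_lt lam
  omega

open Classical in
/-- A uniform nonzero scalar different from `a` (for `a = 0`, a uniform nonzero scalar). -/
def sampleAvoiding (lam : ℕ) (a : F.Scalar lam) : PMF (F.Scalar lam) :=
  haveI := F.exists_scalar a
  (PMF.uniformOfFintype {k : F.Scalar lam // k ≠ 0 ∧ k ≠ a}).map Subtype.val

/-- A uniform nonzero scalar. -/
def sampleUnit (lam : ℕ) : PMF (F.Scalar lam) := F.sampleAvoiding lam 0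

/-- The public parameters `(group, p, gen, h)` as a list of numbers. -/
def encPP {lam : ℕ} (h : F.G lam) : List ℕ :=
  [F.desc lam, F.p lam, F.enc lam (F.gen lam), F.enc lam h]

end GroupFamily

/-- Transparent setup: the second generator is a deterministic function of the value of a public
randomness source, and is neither `0` nor the first generator. -/
structure TransparentSetup (F : GroupFamily) where
  beacon : ℕ → PMF (List Bool)
  hashToGroup : ∀ lam, List Bool → F.G lam
  ne_zero : ∀ lam s, hashToGroup lam s ≠ 0
  ne_gen : ∀ lam s, hashToGroup lam s ≠ F.gen lam

/-- The distribution of the second generator `h`. -/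
def TransparentSetup.sample {F : GroupFamily} (St : TransparentSetup F) (lam : ℕ) : PMF (F.G lam) :=
  (St.beacon lam).map (St.hashToGroup lam)

/-- The DDLEQ game; the output tells whether the adversary guessed the bit. -/
def ddleqGame {F : GroupFamily} (St : TransparentSetup F) (Adv : Prog) (lam : ℕ) :
    OracleComp lam Bool := do
  let h ← St.sample lam
  let r ← F.sampleUnit lam
  let s ← F.sampleUnit lam
  let b ← PMF.uniformOfFintype Bool
  let A := F.act r (F.gen lam)
  let B := if b then F.act r h else F.act s h
  let guess ← Adv.accepts ∅ lam (F.encPP h ++ [F.enc lam A, F.enc lam B])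
  pure (guess == b)

/-- DDLEQ hardness, against all probabilistic polynomial-time adversaries (without oracle). -/
def DDLEQHard {F : GroupFamily} (St : TransparentSetup F) : Prop :=
  ∀ Adv : Prog, Adv.OracleFree → Adv.PolyTime ∅ →
    Negligible fun lam => |(ddleqGame St Adv lam).prob - 1 / 2|

/-! ### The Fischlin transform of the Chaum--Pedersen protocol -/

/-- Fischlin parameters, the contexts of the oracle, and the injective encoding of tuples. -/
structure FischlinSetup (F : GroupFamily) where
  t : ℕ → ℕ
  b : ℕ → ℕ
  r : ℕ → ℕ
  S : ℕ → ℕ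
  t_log : (fun lam => (t lam : ℝ)) =O[atTop] (fun lam : ℕ => Real.log lam)
  b_log : (fun lam => (b lam : ℝ)) =O[atTop] (fun lam : ℕ => Real.log lam)
  r_log : (fun lam => (r lam : ℝ)) =O[atTop] (fun lam : ℕ => Real.log lam)
  b_le_t : ∀ lam, b lam ≤ t lam
  b_le : ∀ lam, b lam ≤ lam
  br_large : (fun lam : ℕ => Real.log lam) =o[atTop] (fun lam => ((b lam * r lam : ℕ) : ℝ))
  slack_large : (fun lam : ℕ => Real.log lam) =o[atTop] (fun lam => ((2 ^ (t lam - b lam) : ℕ) : ℝ))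
  S_theta : (fun lam => (S lam : ℝ)) =Θ[atTop] (fun lam => (r lam : ℝ))
  t_lt : ∀ lam, 2 ^ t lam < F.p lam
  /-- the contexts in which a simulator may program the oracle -/
  programmable : Finset ℕ
  /-- the context of the DLEQ proofs -/
  ctx : ℕ
  ctx_mem : ctx ∈ programmable
  /-- the injective encoding of tuples as bit strings -/
  code : List ℕ ↪ ℕ

/-- One repetition `(J₁, J₂, e, z)` of the Chaum--Pedersen protocol. -/
abbrev Repetition (F : GroupFamily) (lam : ℕ) : Type := F.G lam × F.G lam × ℕ × F.Scalar lam

namespace FischlinSetup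

variable {F : GroupFamily} (Φ : FischlinSetup F)

/-- `H_b(ctx, ⟨x, a, i, e, z⟩)` for the statement `x = (A, B)` and the first messages `a`. -/
def hashB {lam : ℕ} (A B : F.G lam) (a : List (F.G lam × F.G lam)) (i e : ℕ) (z : F.Scalar lam) :
    OracleComp lam ℕ := do
  let y ← oracleQuery Φ.ctx (Φ.code
    ([F.enc lam A, F.enc lam B] ++ a.flatMap (fun J => [F.enc lam J.1, F.enc lam J.2]) ++
      [i, e, z.val]))
  pure (y % 2 ^ Φ.b lam)

/-- The rarity search over `n` successive challenges from `e` on, with early break; `best` is the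
latest challenge with the smallest value `least` seen so far. -/
def raritySearch {lam : ℕ} (hash : ℕ → OracleComp lam ℕ) :
    (n e least best : ℕ) → OracleComp lam ℕ
  | 0, _, _, best => pure best
  | n + 1, e, least, best => do
      let s ← hash e
      if s = 0 then pure e
      else if s ≤ least then raritySearch hash n (e + 1) s e
      else raritySearch hash n (e + 1) least best

/-- The prover on statement `(A, B)` and witness `w`. -/
def prove {lam : ℕ} (h A B : F.G lam) (w : F.Scalar lam) :
    OracleComp lam (List (Repetition F lam)) := do
  let j ← PMF.uniformOfFintype (Fin (Φ.r lam) → F.Scalar lam)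
  let a := List.ofFn fun i => (F.act (j i) (F.gen lam), F.act (j i) h)
  (List.finRange (Φ.r lam)).mapM fun i => do
    let e ← raritySearch (fun e => Φ.hashB A B a (i.val + 1) e (j i + e * w))
      (2 ^ Φ.t lam) 0 (2 ^ Φ.b lam - 1) 0
    pure (F.act (j i) (F.gen lam), F.act (j i) h, e, j i + e * w)

/-- The verifier of the Chaum--Pedersen protocol. -/
def sigmaAccepts {lam : ℕ} (h A B : F.G lam) (c : Repetition F lam) : Prop :=
  A ≠ 0 ∧ B ≠ 0 ∧ c.2.2.1 < 2 ^ Φ.t lam ∧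
    F.act c.2.2.2 (F.gen lam) = c.1 + c.2.2.1 • A ∧ F.act c.2.2.2 h = c.2.1 + c.2.2.1 • B

open Classical in
/-- The verifier on a parsed proof. -/
def verifyParsed {lam : ℕ} (h A B : F.G lam) (π : List (Repetition F lam)) :
    OracleComp lam Bool := do
  let s ← π.zipIdx.mapM fun c =>
    Φ.hashB A B (π.map fun c => (c.1, c.2.1)) (c.2 + 1) c.1.2.2.1 c.1.2.2.2
  pure (decide (π.length = Φ.r lam ∧ (∀ c ∈ π, Φ.sigmaAccepts h A B c) ∧ s.sum ≤ Φ.S lam))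

/-- A proof as a list of numbers. -/
def encProof {lam : ℕ} (π : List (Repetition F lam)) : List ℕ :=
  π.flatMap fun c => [F.enc lam c.1, F.enc lam c.2.1, c.2.2.1, c.2.2.2.val]

open Classical in
/-- The verifier on an arbitrary string; what is not the encoding of a proof is rejected. -/
def verify {lam : ℕ} (h A B : F.G lam) (π : List ℕ) : OracleComp lam Bool :=
  if hπ : ∃ τ : List (Repetition F lam), encProof τ = π then Φ.verifyParsed h A B hπ.choose
  else pure false

/-- The proof simulator that the program `Sim` computes. -/
def simProof {lam : ℕ} (Sim : Prog) (h A B : F.G lam) : OracleComp lam (List ℕ) :=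
  Sim.run Φ.programmable lam (F.encPP h ++ [F.enc lam A, F.enc lam B])

/-- A distinguisher on a real proof of a uniform true statement. -/
def zkReal (St : TransparentSetup F) (D : Prog) (lam : ℕ) : OracleComp lam Bool := do
  let h ← St.sample lam
  let w ← F.sampleUnit lam
  let A := F.act w (F.gen lam)
  let B := F.act w h
  let π ← Φ.prove h A B w
  D.accepts Φ.programmable lam (F.encPP h ++ [F.enc lam A, F.enc lam B] ++ encProof π)

/-- A distinguisher on a simulated proof of a uniform true statement. -/
def zkSim (St : TransparentSetup F) (Sim D : Prog) (lam : ℕ) : OracleComp lam Bool := do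
  let h ← St.sample lam
  let w ← F.sampleUnit lam
  let A := F.act w (F.gen lam)
  let B := F.act w h
  let π ← Φ.simProof Sim h A B
  D.accepts Φ.programmable lam (F.encPP h ++ [F.enc lam A, F.enc lam B] ++ π)

/-- `Sim` witnesses zero-knowledge with the universal simulation interface: it is a probabilistic
polynomial-time machine that may program the oracle, its proofs of true statements (drawn uniformly
from the relation) are indistinguishable from real ones, and its proofs of all statements, true or
false, are accepted with overwhelming probability. -/
structure IsUniversalSimulator (St : TransparentSetup F) (Sim : Prog) : Prop where
  polyTime : Sim.PolyTime Φ.programmable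
  zeroKnowledge : ∀ D : Prog, D.ProgramFree → D.PolyTime Φ.programmable →
    Negligible fun lam => |(Φ.zkReal St D lam).prob - (Φ.zkSim St Sim D lam).prob|
  universal : ∃ μ : ℕ → ℝ, Negligible μ ∧
    ∀ (lam : ℕ), ∀ h ∈ (St.sample lam).support, ∀ A B : F.G lam, A ≠ 0 → B ≠ 0 →
      1 - μ lam ≤ OracleComp.prob (do
        let π ← Φ.simProof Sim h A B
        Φ.verify h A B π)

end FischlinSetup

/-! ### USV certificates -/

/-- A tag `ζ = (ν, υ, π)`; the proof `π` is an arbitrary string. -/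
structure USVTag (F : GroupFamily) (lam : ℕ) where
  nu : F.Scalar lam
  upsilon : F.G lam
  proof : List ℕ

namespace USV

variable {F : GroupFamily} (Φ : FischlinSetup F)

def cert {lam : ℕ} (h : F.G lam) (m : F.Scalar lam) :
    OracleComp lam (F.G lam × USVTag F lam) := do
  let r ← F.sampleAvoiding lam (-m)
  let M := F.act m (F.gen lam)
  let C := M + F.act r h
  let u := F.act (m + r) (F.gen lam)
  let π ← Φ.prove h (u - M) (C - M) r
  pure (C, ⟨m * r⁻¹, u, FischlinSetup.encProof π⟩)

open Classical in
/-- The candidate opening `(M, R)`; `none` stands for failure. -/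
def derive {lam : ℕ} (C : F.G lam) (ζ : USVTag F lam) : Option (F.G lam × F.G lam) :=
  if ζ.nu = -1 then none
  else
    let M := F.act (ζ.nu * (ζ.nu + 1)⁻¹) ζ.upsilon
    some (M, C - M)

def vcert {lam : ℕ} (h C : F.G lam) (ζ : USVTag F lam) : OracleComp lam Bool :=
  match derive C ζ with
  | none => pure false
  | some (M, _) => Φ.verify h (ζ.upsilon - M) (C - M) ζ.proof

/-- The verified opening. -/
def openCert {lam : ℕ} (h C : F.G lam) (ζ : USVTag F lam) :
    OracleComp lam (Option (F.G lam × F.G lam)) := do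
  let v ← vcert Φ h C ζ
  pure (if v then derive C ζ else none)

/-- The tag simulator built from the proof simulator `Sim`; on a failed opening it returns a
trivial tag. -/
def simCert (Sim : Prog) {lam : ℕ} (h C : F.G lam) :
    Option (F.G lam × F.G lam) → OracleComp lam (USVTag F lam)
  | none => pure ⟨0, 0, []⟩
  | some (M, _) => do
      let nu ← F.sampleAvoiding lam (-1)
      let u := F.act (1 + nu⁻¹) M
      let π ← Φ.simProof Sim h (u - M) (C - M)
      pure ⟨nu, u, π⟩

def encOpening {lam : ℕ} : Option (F.G lam × F.G lam) → List ℕ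
  | none => [0, 0, 0]
  | some (M, R) => [1, F.enc lam M, F.enc lam R]

def encTag {lam : ℕ} (ζ : USVTag F lam) : List ℕ := [ζ.nu.val, F.enc lam ζ.upsilon] ++ ζ.proof

/-- The type of tag simulators, with inputs `h` (for the public parameters), `C` and an opening. -/
abbrev TagSimulator (F : GroupFamily) : Type :=
  ∀ lam : ℕ, F.G lam → F.G lam → Option (F.G lam × F.G lam) → OracleComp lam (USVTag F lam)

/-- A distinguisher on an honest commitment, its verified opening and the honest tag. -/
def realGame (St : TransparentSetup F) (D : Prog) (lam : ℕ) : OracleComp lam Bool := do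
  let h ← St.sample lam
  let m ← F.sampleUnit lam
  let (C, ζ) ← cert Φ h m
  let o ← openCert Φ h C ζ
  D.accepts Φ.programmable lam (F.encPP h ++ [F.enc lam C] ++ encOpening o ++ encTag ζ)

/-- A distinguisher on an honest commitment, its verified opening and a simulated tag. -/
def simGame (St : TransparentSetup F) (Scert : TagSimulator F) (D : Prog) (lam : ℕ) :
    OracleComp lam Bool := do
  let h ← St.sample lam
  let m ← F.sampleUnit lam
  let (C, ζ) ← cert Φ h m
  let o ← openCert Φ h C ζ
  let ζ' ← Scert lam h C o
  D.accepts Φ.programmable lam (F.encPP h ++ [F.enc lam C] ++ encOpening o ++ encTag ζ')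

open Classical in
/-- Opening-conditional tag simulatability with simulator `Scert`. -/
structure IsTagSimulator (St : TransparentSetup F) (Scert : TagSimulator F) : Prop where
  /-- the simulator is a probabilistic polynomial-time machine -/
  polyTime : ∃ P : Prog, P.PolyTime Φ.programmable ∧
    ∀ (lam : ℕ) (h C : F.G lam) (o : Option (F.G lam × F.G lam)),
      P.run Φ.programmable lam (F.encPP h ++ [F.enc lam C] ++ encOpening o) =
        encTag <$> Scert lam h C o
  /-- simulated tags verify and open to the given opening -/
  correct : ∃ μ : ℕ → ℝ, Negligible μ ∧
    ∀ (lam : ℕ), ∀ h ∈ (St.sample lam).support, ∀ C M R : F.G lam,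
      C = M + R → M ≠ 0 → R ≠ 0 →
      1 - μ lam ≤ OracleComp.prob (do
        let ζ ← Scert lam h C (some (M, R))
        let v ← vcert Φ h C ζ
        pure (v && decide (derive C ζ = some (M, R))))
  /-- simulated tags are indistinguishable from real ones, given the opening -/
  indistinguishable : ∀ D : Prog, D.ProgramFree → D.PolyTime Φ.programmable →
    Negligible fun lam => |(realGame Φ St D lam).prob - (simGame Φ St Scert D lam).prob|

end USV

end

/-!
The simulator is `USV.simCert`; its three properties are of very different depth.

*Polynomial time.*  The simulator is realised by an explicit machine, `GroupFamily.simCertProg`.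
Machines are built from a few combinators (composition, pairing, straight-line evaluation,
sampling) that come with their input-output function and a polynomial time bound.  The one
nontrivial scalar operation is `ν⁻¹`, computed as `ν ^ (p - 2)` by square-and-multiply; the number
of rounds is `K * (lam + 1)` for a constant `K` with `p ≤ 2 ^ (K * (lam + 1))`, which exists since
the bit length of `p` is linear in the security parameter.

*Correctness.*  A simulated tag `(ν, (1 + ν⁻¹) M, π)` always derives `(M, R)`
(`USV.derive_simulated`), and its proof is a simulated proof of the statement `(ν⁻¹ M, R)`, both
entries of which are nonzero.  Hence it verifies whenever the simulated proof does, and this is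
the universal property of the proof simulator (`USV.simCert_correct`).

*Indistinguishability.*  The opening of an honest commitment with message `m` and randomness `r` is
`(ν A, B)`, where `(A, B) = (r G, r H)` is the statement of its proof and `ν = m / r`; the pair
`(ν, r)` is uniform subject to `ν ∉ {0, -1}` and `r ≠ 0`.  So everything a distinguisher `D`
receives is a function of `(A, B)`, of an independent `ν` and of the proof
(`GroupFamily.tagInput`), and that function is computed by the machine `GroupFamily.tagTuple`.  The
two games are joined by the following chain of experiments.

* The real game is, up to the completeness error, the zero-knowledge experiment with real proofs
  for the distinguisher that draws `ν` and runs `D` on the resulting tuple (`USV.near_realGame`).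
* By zero knowledge, the real proof may be replaced by a simulated one.
* The result is the DDLEQ experiment on a true statement, for an adversary that draws `ν`, simulates
  a proof and runs `D`.  A DDLEQ adversary has no oracle, so this machine has to sample the oracle
  lazily in its own memory (`Prog.internalized`).  By DDLEQ hardness the statement may be replaced
  by `(r G, s H)` with independent `r` and `s`.
* There, `M = ν A = (ν r) G` and `R = s H` have independent uniform exponents, for every `ν`.  In
  the simulated game the exponents `m` and `r` of `M` and `R` are independent except that `r ≠ -m`,
  which costs `1 / (p - 1)` (`GroupFamily.near_sampleAvoiding`).
* The simulated game also differs in that the honest prover has queried the oracle before the tag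
  is simulated.  Every point that it queries contains its first messages, which the simulated tag is
  independent of; a run that defines at most `Q` points meets one of them with probability at most
  `Q / p` (`FischlinSetup.pr_prove_meets_le`), and otherwise proceeds as from the empty oracle
  (`Prog.exec_sameUpTo`, `USV.near_simulated_prove`).
* Finally the honest tag must be accepted for the simulator to be given the opening at all, which
  costs the completeness error once more (`USV.near_simGame`).

The completeness error is bounded directly (`FischlinSetup.pr_prove_not_verify_le`): the points
queried by one prover are distinct and fresh, so each of the `r` rarity searches over `2 ^ t`
challenges fails to find a vanishing `b`-bit hash with probability at most
`(1 - 2⁻ᵇ) ^ (2 ^ t) ≤ exp (-2 ^ (t - b))`, and a proof all of whose hashes vanish is accepted.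
A reduction to zero knowledge and universality is not available, as it would have to run the
verifier, and the encoding of tuples as oracle points need not be computable.
-/

noncomputable section

/-! ### Elementary facts on executions -/

theorem Memory.write_apply (m : Memory) (a i v b j : ℕ) :
    m.write a i v b j = if b = a ∧ j = i then v else m b j := by
  unfold Memory.write
  by_cases hb : b = a
  · subst hb
    by_cases hj : j = i
    · subst hj; simp
    · simp [hj]
  · simp [hb]

theorem PMF.mem_support_pure {α : Type} {a b : α} :
    a ∈ (pure b : PMF α).support ↔ a = b := PMF.mem_support_pure_iff b a

theorem PMF.mem_support_bind {α β : Type} {p : PMF α} {f : α → PMF β} {b : β} :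
    b ∈ (p >>= f).support ↔ ∃ a ∈ p.support, b ∈ (f a).support := PMF.mem_support_bind_iff p f b

theorem PMF.mem_support_fmap {α β : Type} {p : PMF α} {f : α → β} {b : β} :
    b ∈ (f <$> p).support ↔ ∃ a ∈ p.support, f a = b := PMF.mem_support_map_iff f p b

theorem PMF.bind_congr_support {α β : Type} {p : PMF α} {f g : α → PMF β}
    (h : ∀ a ∈ p.support, f a = g a) : p >>= f = p >>= g := by
  refine PMF.ext fun b => ?_
  show (p.bind f) b = (p.bind g) b
  rw [PMF.bind_apply, PMF.bind_apply]
  refine tsum_congr fun a => ?_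
  by_cases ha : a ∈ p.support
  · rw [h a ha]
  · rw [(PMF.apply_eq_zero_iff p a).2 ha]; simp

namespace Config

variable {lam : ℕ}

@[simp] theorem charge_mem (c : Config lam) (k : ℕ) : (c.charge k).mem = c.mem := rfl
@[simp] theorem charge_table (c : Config lam) (k : ℕ) : (c.charge k).table = c.table := rfl
@[simp] theorem charge_steps (c : Config lam) (k : ℕ) : (c.charge k).steps = c.steps + k := rfl
@[simp] theorem update_mem (c : Config lam) (a i v k : ℕ) (T : OTable lam) :
    (c.update a i v T k).mem = c.mem.write a i v := rfl
@[simp] theorem update_steps (c : Config lam) (a i v k : ℕ) (T : OTable lam) :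
    (c.update a i v T k).steps = c.steps + k := rfl

theorem charge_update (c : Config lam) (a i v k l : ℕ) (T : OTable lam) :
    (c.charge l).update a i v T k = (c.update a i v T k).charge l := by
  simp [charge, update, Nat.add_right_comm]

theorem charge_charge (c : Config lam) (k l : ℕ) :
    (c.charge l).charge k = (c.charge k).charge l := by
  simp [charge, Nat.add_right_comm]

end Config

/-- A uniform element of `{0, ..., n - 1}` as a natural number (and `0` if `n = 0`). -/
def uniformNat (n : ℕ) : PMF ℕ := Fin.val <$> PMF.uniformOfFintype (Fin (n - 1 + 1))

theorem Prog.exec_rand {lam : ℕ} (U : Finset ℕ) (a : ℕ) (i n : RExpr) (c : Config lam) :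
    (Prog.rand a i n).exec U c = uniformNat (n.eval c.mem) >>= fun v =>
      pure (c.update a (i.eval c.mem) v c.table (1 + i.cost c.mem + n.cost c.mem)) := by
  simp only [Prog.exec, uniformNat, bind_map_left]

theorem iterM_comm {α β : Type} (φ : α → β) (f : α → PMF α) (g : β → PMF β)
    (h : ∀ x, g (φ x) = φ <$> f x) (n : ℕ) (x : α) : iterM g n (φ x) = φ <$> iterM f n x := by
  induction n generalizing x with
  | zero => simp [iterM]
  | succ n ih => simp only [iterM, h, bind_map_left, _root_.map_bind, ih]

/-- The step counter does not influence an execution. -/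
theorem Prog.exec_charge {lam : ℕ} (U : Finset ℕ) (P : Prog) (c : Config lam) (k : ℕ) :
    P.exec U (c.charge k) = (fun c' => Config.charge c' k) <$> P.exec U c := by
  induction P generalizing c with
  | skip => simp [Prog.exec, Config.charge_charge c]
  | assign a i e => simp [Prog.exec, Config.charge_update]
  | seq P Q ihP ihQ => simp only [Prog.exec, ihP, bind_map_left, _root_.map_bind, ihQ]
  | ite e P Q ihP ihQ =>
    simp only [Prog.exec, Config.charge_mem]
    rw [Config.charge_charge, ihP, ihQ, apply_ite (fun p => (fun c' => Config.charge c' k) <$> p)]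
    rfl
  | loop n P ih =>
    simp only [Prog.exec, Config.charge_mem]
    rw [Config.charge_charge]
    exact iterM_comm (fun c' => Config.charge c' k) _ _ ih _ _
  | rand a i n => simp [Prog.exec, Config.charge_update]
  | query a i ctx x => simp [Prog.exec, Config.charge_update]
  | program a i ctx x y => simp [Prog.exec, Config.charge_update]

/-- Without oracle commands it does not matter which contexts are programmable. -/
theorem Prog.exec_oracleFree {lam : ℕ} (U V : Finset ℕ) (P : Prog) (hP : P.OracleFree)
    (c : Config lam) : P.exec U c = P.exec V c := by
  induction P generalizing c with
  | seq P Q ihP ihQ => simp only [Prog.exec, ihP hP.1, funext (ihQ hP.2)]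
  | ite e P Q ihP ihQ => simp only [Prog.exec, ihP hP.1, ihQ hP.2]
  | loop n P ih => simp only [Prog.exec, funext (ih hP)]
  | query => exact hP.elim
  | program => exact hP.elim
  | _ => rfl

theorem Prog.OracleFree.programFree {P : Prog} (hP : P.OracleFree) : P.ProgramFree := by
  induction P with
  | seq P Q ihP ihQ => exact ⟨ihP hP.1, ihQ hP.2⟩
  | ite e P Q ihP ihQ => exact ⟨ihP hP.1, ihQ hP.2⟩
  | loop n P ih => exact ih hP
  | query => exact hP.elim
  | program => exact hP.elim
  | _ => trivial

theorem Prog.run_oracleFree (U V : Finset ℕ) (P : Prog) (hP : P.OracleFree) (lam : ℕ)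
    (x : List ℕ) : P.run U lam x = P.run V lam x := by
  funext T; simp only [Prog.run, P.exec_oracleFree U V hP]

theorem Prog.PolyTime.of_oracleFree {U : Finset ℕ} (V : Finset ℕ) {P : Prog} (hP : P.OracleFree)
    (h : P.PolyTime U) : P.PolyTime V := by
  obtain ⟨q, hq⟩ := h
  exact ⟨q, fun lam x T c hc => hq lam x T c (by rwa [P.exec_oracleFree U V hP])⟩

/-! ### Renaming the arrays of a program -/

/-- Read array `ρ a` instead of array `a`. -/
def RExpr.rename (ρ : ℕ → ℕ) : RExpr → RExpr
  | .const n => .const n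
  | .read a i => .read (ρ a) (i.rename ρ)
  | .op o e f => .op o (e.rename ρ) (f.rename ρ)

/-- Use array `ρ a` in place of array `a`, so that the program can serve as a subroutine. -/
def Prog.rename (ρ : ℕ → ℕ) : Prog → Prog
  | .skip => .skip
  | .assign a i e => .assign (ρ a) (i.rename ρ) (e.rename ρ)
  | .seq P Q => .seq (P.rename ρ) (Q.rename ρ)
  | .ite e P Q => .ite (e.rename ρ) (P.rename ρ) (Q.rename ρ)
  | .loop n P => .loop (n.rename ρ) (P.rename ρ)
  | .rand a i n => .rand (ρ a) (i.rename ρ) (n.rename ρ)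
  | .query a i ctx x => .query (ρ a) (i.rename ρ) (ctx.rename ρ) (x.rename ρ)
  | .program a i ctx x y =>
      .program (ρ a) (i.rename ρ) (ctx.rename ρ) (x.rename ρ) (y.rename ρ)

theorem RExpr.eval_rename (ρ : ℕ → ℕ) (m : Memory) (e : RExpr) :
    (e.rename ρ).eval m = e.eval (fun a => m (ρ a)) := by
  induction e with
  | const n => rfl
  | read a i ih => simp [RExpr.rename, RExpr.eval, ih]
  | op o e f ihe ihf => simp [RExpr.rename, RExpr.eval, ihe, ihf]

theorem RExpr.cost_rename (ρ : ℕ → ℕ) (m : Memory) (e : RExpr) :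
    (e.rename ρ).cost m = e.cost (fun a => m (ρ a)) := by
  induction e with
  | const n => rfl
  | read a i ih => simp [RExpr.rename, RExpr.cost, ih, RExpr.eval_rename]
  | op o e f ihe ihf => simp [RExpr.rename, RExpr.cost, ihe, ihf, RExpr.eval_rename]

/-- What a program sees of a configuration when its array `a` is stored as array `ρ a`. -/
def Config.view {lam : ℕ} (ρ : ℕ → ℕ) (c : Config lam) : Config lam :=
  ⟨fun a => c.mem (ρ a), c.table, c.steps⟩

/-- The configuration `c` of a renamed program, put back into a larger memory `m`. -/
def Config.embed {lam : ℕ} (ρ : ℕ → ℕ) (m : Memory) (c : Config lam) : Config lam :=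
  ⟨Function.extend ρ c.mem m, c.table, c.steps⟩

namespace Config

variable {lam : ℕ} {ρ : ℕ → ℕ}

theorem view_embed (hρ : ρ.Injective) (m : Memory) (c : Config lam) :
    (c.embed ρ m).view ρ = c := by
  simp [view, embed, hρ.extend_apply]

theorem embed_view (hρ : ρ.Injective) (c : Config lam) : (c.view ρ).embed ρ c.mem = c := by
  cases c with | mk m T s =>
  simp only [view, embed, Config.mk.injEq, and_self, and_true]
  funext a
  by_cases h : ∃ b, ρ b = a
  · obtain ⟨b, rfl⟩ := h; rw [hρ.extend_apply]
  · rw [Function.extend_apply' _ _ _ h]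

theorem embed_embed (hρ : ρ.Injective) (m : Memory) (c d : Config lam) :
    c.embed ρ (d.embed ρ m).mem = c.embed ρ m := by
  simp only [embed, Config.mk.injEq, and_self, and_true]
  funext a
  by_cases h : ∃ b, ρ b = a
  · obtain ⟨b, rfl⟩ := h; rw [hρ.extend_apply, hρ.extend_apply]
  · simp only [Function.extend_apply' _ _ _ h]

theorem update_eq_embed (hρ : ρ.Injective) (c : Config lam) (a i v k : ℕ) (T : OTable lam) :
    c.update (ρ a) i v T k = ((c.view ρ).update a i v T k).embed ρ c.mem := by
  simp only [view, embed, update, Config.mk.injEq, and_true]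
  funext b
  by_cases h : ∃ b', ρ b' = b
  · obtain ⟨b', rfl⟩ := h
    rw [hρ.extend_apply]
    funext j
    simp [Memory.write_apply, hρ.eq_iff]
  · rw [Function.extend_apply' _ _ _ h]
    funext j
    rw [Memory.write_apply, if_neg]
    rintro ⟨rfl, _⟩; exact h ⟨a, rfl⟩

end Config

/-- A renamed program acts on its own arrays as the original one does, with the same cost, and
leaves all other arrays alone. -/
theorem Prog.exec_rename {lam : ℕ} {ρ : ℕ → ℕ} (hρ : ρ.Injective) (U : Finset ℕ) (P : Prog)
    (c : Config lam) :
    (P.rename ρ).exec U c = Config.embed ρ c.mem <$> P.exec U (c.view ρ) := by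
  induction P generalizing c with
  | skip =>
    simp only [Prog.rename, Prog.exec, LawfulApplicative.map_pure]
    exact congrArg pure (Config.embed_view hρ (c.charge 1)).symm
  | assign a i e =>
    simp only [Prog.rename, Prog.exec, LawfulApplicative.map_pure, RExpr.eval_rename,
      RExpr.cost_rename, Config.update_eq_embed hρ]
    rfl
  | seq P Q ihP ihQ =>
    simp only [Prog.rename, Prog.exec, ihP, bind_map_left, _root_.map_bind, ihQ,
      Config.view_embed hρ]
    refine bind_congr fun d => ?_
    congr 1
    funext e
    exact Config.embed_embed hρ _ _ _
  | ite e P Q ihP ihQ =>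
    simp only [Prog.rename, Prog.exec, RExpr.eval_rename, RExpr.cost_rename, ihP, ihQ]
    rw [apply_ite (fun p => Config.embed ρ c.mem <$> p)]
    rfl
  | loop n P ih =>
    simp only [Prog.rename, Prog.exec, RExpr.eval_rename, RExpr.cost_rename]
    have key : ∀ (k : ℕ) (d : Config lam), iterM ((P.rename ρ).exec U) k d =
        Config.embed ρ d.mem <$> iterM (P.exec U) k (d.view ρ) := by
      intro k
      induction k with
      | zero => intro d; simp [iterM, Config.embed_view hρ]
      | succ k ihk =>
        intro d
        simp only [iterM, ih, bind_map_left, _root_.map_bind, ihk, Config.view_embed hρ]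
        refine bind_congr fun d => ?_
        congr 1
        funext e
        exact Config.embed_embed hρ _ _ _
    rw [key]; rfl
  | rand a i n =>
    simp only [Prog.rename, Prog.exec_rand, RExpr.eval_rename, RExpr.cost_rename,
      Config.update_eq_embed hρ, _root_.map_bind, LawfulApplicative.map_pure]
    rfl
  | query a i ctx x =>
    simp only [Prog.rename, Prog.exec, RExpr.eval_rename, RExpr.cost_rename,
      Config.update_eq_embed hρ, _root_.map_bind, LawfulApplicative.map_pure]
    rfl
  | program a i ctx x y =>
    simp only [Prog.rename, Prog.exec, RExpr.eval_rename, RExpr.cost_rename,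
      Config.update_eq_embed hρ, _root_.map_bind, LawfulApplicative.map_pure]
    rfl

theorem Prog.ProgramFree.rename {P : Prog} (h : P.ProgramFree) (ρ : ℕ → ℕ) :
    (P.rename ρ).ProgramFree := by
  induction P with
  | seq P Q ihP ihQ => exact ⟨ihP h.1, ihQ h.2⟩
  | ite e P Q ihP ihQ => exact ⟨ihP h.1, ihQ h.2⟩
  | loop n P ih => exact ih h
  | program => exact h.elim
  | _ => trivial

/-! ### Sizes of numbers and lists, and polynomial bounds -/

theorem Nat.size_le_self (n : ℕ) : n.size ≤ n := Nat.size_le.2 Nat.lt_two_pow_self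

theorem Nat.size_add_le (a b : ℕ) : (a + b).size ≤ a.size + b.size + 1 := by
  rw [Nat.size_le]
  have h1 := Nat.lt_size_self a
  have h2 := Nat.lt_size_self b
  have h3 : 2 ^ a.size ≤ 2 ^ (a.size + b.size) := Nat.pow_le_pow_right (by norm_num) (by omega)
  have h4 : 2 ^ b.size ≤ 2 ^ (a.size + b.size) := Nat.pow_le_pow_right (by norm_num) (by omega)
  rw [pow_succ]; omega

theorem Nat.size_mul_le (a b : ℕ) : (a * b).size ≤ a.size + b.size := by
  rw [Nat.size_le, pow_add]
  exact Nat.mul_lt_mul'' (Nat.lt_size_self a) (Nat.lt_size_self b)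

theorem ArithOp.size_eval_le (o : ArithOp) (x y : ℕ) :
    (o.eval x y).size ≤ x.size + y.size + 1 := by
  cases o with
  | add => exact Nat.size_add_le x y
  | sub => exact (Nat.size_le_size (Nat.sub_le x y)).trans (by omega)
  | mul => exact (Nat.size_mul_le x y).trans (by omega)
  | div => exact (Nat.size_le_size (Nat.div_le_self x y)).trans (by omega)
  | mod => exact (Nat.size_le_size (Nat.mod_le x y)).trans (by omega)

theorem listSize_nil : listSize [] = 0 := rfl

theorem listSize_cons (a : ℕ) (l : List ℕ) : listSize (a :: l) = a.size + 1 + listSize l := by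
  simp [listSize]

theorem listSize_append (l l' : List ℕ) : listSize (l ++ l') = listSize l + listSize l' := by
  simp [listSize]

theorem length_le_listSize (l : List ℕ) : l.length ≤ listSize l := by
  induction l with
  | nil => simp
  | cons a l ih => rw [listSize_cons, List.length_cons]; omega

theorem size_le_listSize {l : List ℕ} {a : ℕ} (h : a ∈ l) : a.size ≤ listSize l := by
  induction l with
  | nil => simp at h
  | cons b l ih =>
    rw [listSize_cons]
    rcases List.mem_cons.1 h with rfl | h
    · omega
    · have := ih h; omega

theorem size_getD_le (l : List ℕ) (i : ℕ) : (l.getD i 0).size ≤ listSize l := by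
  by_cases h : i < l.length
  · rw [List.getD_eq_getElem _ _ h]; exact size_le_listSize (List.getElem_mem h)
  · rw [List.getD_eq_default _ _ (by omega)]; simp

theorem listSize_drop_le (l : List ℕ) (k : ℕ) : listSize (l.drop k) ≤ listSize l := by
  conv_rhs => rw [← List.take_append_drop k l, listSize_append]
  omega

theorem Polynomial.eval_mono_nat (q : Polynomial ℕ) {a b : ℕ} (h : a ≤ b) :
    q.eval a ≤ q.eval b := by
  rw [Polynomial.eval_eq_sum, Polynomial.eval_eq_sum]
  exact Finset.sum_le_sum fun i _ => Nat.mul_le_mul_left _ (Nat.pow_le_pow_left h i)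

/-! ### Deterministic blocks: copying between arrays -/

/-- From memory `m` the program deterministically reaches memory `m'` within `K` steps, without
touching the oracle. -/
def Prog.Det (P : Prog) (m m' : Memory) (K : ℕ) : Prop :=
  ∃ k ≤ K, ∀ (lam : ℕ) (U : Finset ℕ) (T : OTable lam) (s : ℕ),
    P.exec U ⟨m, T, s⟩ = pure ⟨m', T, s + k⟩

theorem Prog.exec_seq_of_pure {lam : ℕ} {U : Finset ℕ} {P Q : Prog} {c d : Config lam}
    (h : P.exec U c = pure d) : (Prog.seq P Q).exec U c = Q.exec U d := by
  rw [Prog.exec, h, LawfulMonad.pure_bind]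

namespace Prog.Det

theorem assign (a : ℕ) (i e : RExpr) (m : Memory) :
    (Prog.assign a i e).Det m (m.write a (i.eval m) (e.eval m)) (1 + i.cost m + e.cost m) :=
  ⟨_, le_rfl, fun _ _ _ _ => rfl⟩

theorem seq {P Q : Prog} {m m' m'' : Memory} {K L : ℕ} (hP : P.Det m m' K) (hQ : Q.Det m' m'' L) :
    (Prog.seq P Q).Det m m'' (K + L) := by
  obtain ⟨k, hk, hP⟩ := hP
  obtain ⟨l, hl, hQ⟩ := hQ
  refine ⟨k + l, by omega, fun lam U T s => ?_⟩
  simp only [Prog.exec, hP, LawfulMonad.pure_bind, hQ, Nat.add_assoc]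

theorem mono {P : Prog} {m m' : Memory} {K L : ℕ} (hP : P.Det m m' K) (h : K ≤ L) :
    P.Det m m' L := by
  obtain ⟨k, hk, hP⟩ := hP
  exact ⟨k, hk.trans h, hP⟩

theorem ite {P Q : Prog} {e : RExpr} {m m' : Memory} {K : ℕ}
    (hP : e.eval m ≠ 0 → P.Det m m' K) (hQ : e.eval m = 0 → Q.Det m m' K) :
    (Prog.ite e P Q).Det m m' (1 + e.cost m + K) := by
  by_cases h : e.eval m = 0
  · obtain ⟨k, hk, hQ⟩ := hQ h
    refine ⟨1 + e.cost m + k, by omega, fun lam U T s => ?_⟩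
    simp only [Prog.exec, Config.charge, h, ne_eq, not_true_eq_false, if_false, hQ, Nat.add_assoc]
  · obtain ⟨k, hk, hP⟩ := hP h
    refine ⟨1 + e.cost m + k, by omega, fun lam U T s => ?_⟩
    simp only [Prog.exec, Config.charge, ne_eq, h, not_false_eq_true, if_true, hP, Nat.add_assoc]

/-- A loop, with the memory after each iteration given in advance. -/
theorem loop {n : RExpr} {P : Prog} {m : Memory} (M : ℕ → Memory) {K : ℕ} (h0 : M 0 = m)
    (hP : ∀ k < n.eval m, P.Det (M k) (M (k + 1)) K) :
    (Prog.loop n P).Det m (M (n.eval m)) (1 + n.cost m + n.eval m * K) := by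
  have key : ∀ N k, k + N = n.eval m → ∃ l ≤ N * K,
      ∀ (lam : ℕ) (U : Finset ℕ) (T : OTable lam) (s : ℕ),
        iterM (P.exec U) N ⟨M k, T, s⟩ = pure ⟨M (k + N), T, s + l⟩ := by
    intro N
    induction N with
    | zero => exact fun k _ => ⟨0, by simp, fun _ _ _ _ => rfl⟩
    | succ N ih =>
      intro k hk
      obtain ⟨l, hl, h⟩ := hP k (by omega)
      obtain ⟨l', hl', h'⟩ := ih (k + 1) (by omega)
      refine ⟨l + l', by rw [Nat.succ_mul]; omega, fun lam U T s => ?_⟩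
      simp only [iterM, h, LawfulMonad.pure_bind, h']
      rw [show k + 1 + N = k + (N + 1) by omega, Nat.add_assoc]
  obtain ⟨l, hl, h⟩ := key (n.eval m) 0 (by omega)
  refine ⟨1 + n.cost m + l, by omega, fun lam U T s => ?_⟩
  have := h lam U T (s + (1 + n.cost m))
  rw [h0, Nat.zero_add] at this
  simp only [Prog.exec, Config.charge, this, Nat.add_assoc]

end Prog.Det

/-- Copy `n` cells of array `s` from cell `i` on to array `d` from cell `j` on; cells `0` and `1`
of array `4` serve as pointers. -/
def Prog.copy (d : ℕ) (j : RExpr) (s i : ℕ) (n : RExpr) : Prog :=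
  .seq (.assign 4 (.const 0) j) (.seq (.assign 4 (.const 1) (.const i)) (.loop n
    (.seq (.assign d (.read 4 (.const 0)) (.read s (.read 4 (.const 1))))
      (.seq (.assign 4 (.const 0) (.op .add (.read 4 (.const 0)) (.const 1)))
        (.assign 4 (.const 1) (.op .add (.read 4 (.const 1)) (.const 1)))))))

/-- The memory after copying `k` cells. -/
def Memory.copied (m : Memory) (d j s i k : ℕ) : Memory := fun a x =>
  if a = 4 then (if x = 0 then j + k else if x = 1 then i + k else m 4 x)
  else if a = d ∧ j ≤ x ∧ x < j + k then m s (i + (x - j)) else m a x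

theorem Memory.copied_of_ne {m : Memory} {d j s i k a : ℕ} (h4 : a ≠ 4) (hd : a ≠ d) :
    m.copied d j s i k a = m a := by
  funext x; simp [Memory.copied, h4, hd]

theorem Memory.copied_dst {m : Memory} {d j s i k x : ℕ} (h4 : d ≠ 4) :
    m.copied d j s i k d x = if j ≤ x ∧ x < j + k then m s (i + (x - j)) else m d x := by
  simp [Memory.copied, h4]

/-- The count `n` is evaluated after the pointers have been set, so its value is required for all
memories that agree with `m` outside of array `4`. -/
theorem Prog.copy_det {m : Memory} {d s i N L B v : ℕ} {j n : RExpr} (hd : d ≠ 4) (hs : s ≠ 4)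
    (hsd : s ≠ d) (hj : j.eval m = v) (hjc : j.cost m ≤ B)
    (hn : ∀ m' : Memory, (∀ a, a ≠ 4 → m' a = m a) → n.eval m' = N ∧ n.cost m' ≤ B)
    (hjL : v + N ≤ L) (hiL : i + N ≤ L) (hL : ∀ t < N, (m s (i + t)).size ≤ L) :
    (Prog.copy d j s i n).Det m (m.copied d v s i N) (2 * B + 60 * (L + 1) ^ 2) := by
  set m1 := m.write 4 0 v with hm1
  set m2 := m1.write 4 1 i with hm2
  have h2 : ∀ a, a ≠ 4 → m2 a = m a := by
    intro a ha; funext x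
    simp [hm2, hm1, Memory.write_apply, ha]
  obtain ⟨hnv, hnc⟩ := hn m2 h2
  have A1 : (Prog.assign 4 (.const 0) j).Det m m1 (2 + B) := by
    have := Prog.Det.assign 4 (.const 0) j m
    rw [hj] at this
    refine this.mono ?_
    simp [RExpr.cost]; omega
  have A2 : (Prog.assign 4 (.const 1) (.const i)).Det m1 m2 (5 + L) := by
    refine (Prog.Det.assign 4 (.const 1) (.const i) m1).mono ?_
    have := Nat.size_le_self i
    simp [RExpr.cost]; omega
  have A3 : (Prog.loop n
    (.seq (.assign d (.read 4 (.const 0)) (.read s (.read 4 (.const 1))))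
      (.seq (.assign 4 (.const 0) (.op .add (.read 4 (.const 0)) (.const 1)))
        (.assign 4 (.const 1) (.op .add (.read 4 (.const 1)) (.const 1)))))).Det m2
      (m.copied d v s i N) (1 + B + N * (40 * (L + 1))) := by
    have := Prog.Det.loop (n := n) (m := m2) (K := 40 * (L + 1)) (P :=
      (.seq (.assign d (.read 4 (.const 0)) (.read s (.read 4 (.const 1))))
      (.seq (.assign 4 (.const 0) (.op .add (.read 4 (.const 0)) (.const 1)))
        (.assign 4 (.const 1) (.op .add (.read 4 (.const 1)) (.const 1))))))
      (fun k => m.copied d v s i k) ?_ ?_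
    · rw [hnv] at this
      refine this.mono ?_
      omega
    · funext a x
      simp only [Memory.copied, hm2, hm1, Memory.write_apply]
      split_ifs <;> first | omega | simp_all
    · intro k hk
      rw [hnv] at hk
      set m3 := m.copied d v s i k with hm3
      have e0 : m3 4 0 = v + k := by simp [hm3, Memory.copied]
      have e1 : m3 4 1 = i + k := by simp [hm3, Memory.copied]
      have es : m3 s (i + k) = m s (i + k) := by rw [hm3, Memory.copied_of_ne hs hsd]
      have s1 := hL k hk
      have s2 := Nat.size_le_self (v + k)
      have s3 := Nat.size_le_self (i + k)
      have s4 := Nat.size_le_self (v + k + 1)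
      have s5 := Nat.size_le_self (i + k + 1)
      set m4 := m3.write d (v + k) (m s (i + k)) with hm4
      set m5 := m4.write 4 0 (v + k + 1) with hm5
      have f0 : m4 4 0 = v + k := by simp [hm4, Memory.write_apply, hd.symm, e0]
      have f1 : m5 4 1 = i + k := by simp [hm4, hm5, Memory.write_apply, hd.symm, e1]
      have B1 : (Prog.assign d (.read 4 (.const 0)) (.read s (.read 4 (.const 1)))).Det m3 m4
          (10 + 3 * L) := by
        have := Prog.Det.assign d (.read 4 (.const 0)) (.read s (.read 4 (.const 1))) m3
        simp only [RExpr.eval, RExpr.cost, e0, e1, es] at this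
        refine this.mono ?_
        simp; omega
      have B2 : (Prog.assign 4 (.const 0) (.op .add (.read 4 (.const 0)) (.const 1))).Det m4 m5
          (12 + 2 * L) := by
        have := Prog.Det.assign 4 (.const 0) (.op .add (.read 4 (.const 0)) (.const 1)) m4
        simp only [RExpr.eval, RExpr.cost, f0, ArithOp.eval] at this
        refine this.mono ?_
        simp; omega
      have B3 : (Prog.assign 4 (.const 1) (.op .add (.read 4 (.const 1)) (.const 1))).Det m5
          (m.copied d v s i (k + 1)) (14 + 2 * L) := by
        have := Prog.Det.assign 4 (.const 1) (.op .add (.read 4 (.const 1)) (.const 1)) m5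
        simp only [RExpr.eval, RExpr.cost, f1, ArithOp.eval] at this
        have hmem : m5.write 4 1 (i + k + 1) = m.copied d v s i (k + 1) := by
          funext a x
          simp only [hm5, hm4, hm3, Memory.copied, Memory.write_apply]
          by_cases ha : a = 4
          · subst ha
            by_cases hx0 : x = 0
            · simp [hx0]; omega
            · by_cases hx1 : x = 1
              · simp [hx1]; omega
              · simp [hx0, hx1, hd.symm]
          · by_cases had : a = d
            · subst had
              by_cases hx : x = v + k
              · subst hx; simp [ha]
              · simp only [ha, hx, false_and, and_false, if_false, true_and]
                congr 1
                simp only [eq_iff_iff]; omega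
            · simp [ha, had]
        rw [hmem] at this
        refine this.mono ?_
        simp; omega
      refine (B1.seq (B2.seq B3)).mono ?_
      omega
  refine (A1.seq (A2.seq A3)).mono ?_
  have : N * (40 * (L + 1)) ≤ L * (40 * (L + 1)) := Nat.mul_le_mul_right _ (by omega)
  nlinarith

/-! ### Subroutine calls -/

/-- Call `P`, living in the arrays `ρ a`, on the list that starts in cell `i` of array `s` and whose
length stands in cell `0` of array `l`. -/
def Prog.call (ρ : ℕ → ℕ) (P : Prog) (s i l : ℕ) : Prog :=
  .seq (.assign (ρ 0) (.const 0) (.read 0 (.const 0)))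
    (.seq (.assign (ρ 1) (.const 0) (.read l (.const 0)))
      (.seq (.copy (ρ 0) (.const 1) s i (.read l (.const 0))) (P.rename ρ)))

/-- If the arrays `ρ a` are still blank, a call of `P` acts on them like `P` from its start
configuration on the list `y`, up to the cost of setting up the input. -/
theorem Prog.call_exec {ρ : ℕ → ℕ} (hρ : ρ.Injective) (P : Prog) {s i l lam : ℕ} {y : List ℕ}
    {m : Memory} (h0 : ∀ a, m (ρ a) = fun _ => 0) (hlam : m 0 0 = lam) (hl : m l 0 = y.length)
    (hy : ∀ t < y.length, m s (i + t) = y.getD t 0) (hρ4 : 4 ∉ Set.range ρ)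
    (hρ0 : 0 ∉ Set.range ρ) (hρs : s ∉ Set.range ρ) (hρl : l ∉ Set.range ρ) (hs : s ≠ 4)
    (hl4 : l ≠ 4) {L : ℕ} (hL : lam + listSize y + i + 1 ≤ L) :
    ∃ m' : Memory, ∃ k ≤ 100 * (L + 1) ^ 2,
      (∀ a, a ≠ 4 → a ∉ Set.range ρ → m' a = m a) ∧
      ∀ (U : Finset ℕ) (T : OTable lam) (s₀ : ℕ), (P.call ρ s i l).exec U ⟨m, T, s₀⟩ =
        (fun c => (Config.embed ρ m' c).charge (s₀ + k)) <$> P.exec U (startConfig lam y T) := by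
  have n4 : ∀ a, ρ a ≠ 4 := fun a h => hρ4 ⟨a, h⟩
  have n0 : ∀ a, ρ a ≠ 0 := fun a h => hρ0 ⟨a, h⟩
  have ns : ∀ a, ρ a ≠ s := fun a h => hρs ⟨a, h⟩
  have nl : ∀ a, ρ a ≠ l := fun a h => hρl ⟨a, h⟩
  have hlen := length_le_listSize y
  have z1 := Nat.size_le_self lam
  have z2 := Nat.size_le_self y.length
  set m1 := m.write (ρ 0) 0 lam with hm1
  set m2 := m1.write (ρ 1) 0 y.length with hm2
  have A1 : (Prog.assign (ρ 0) (.const 0) (.read 0 (.const 0))).Det m m1 (4 + L) := by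
    have := Prog.Det.assign (ρ 0) (.const 0) (.read 0 (.const 0)) m
    simp only [RExpr.eval, RExpr.cost, hlam] at this
    refine this.mono ?_
    simp; omega
  have e1 : m1 l 0 = y.length := by simp [hm1, Memory.write_apply, (nl 0).symm, hl]
  have A2 : (Prog.assign (ρ 1) (.const 0) (.read l (.const 0))).Det m1 m2 (4 + L) := by
    have := Prog.Det.assign (ρ 1) (.const 0) (.read l (.const 0)) m1
    simp only [RExpr.eval, RExpr.cost, e1] at this
    refine this.mono ?_
    simp; omega
  have e2 : m2 l 0 = y.length := by simp [hm2, Memory.write_apply, (nl 1).symm, e1]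
  have e3 : ∀ t < y.length, m2 s (i + t) = y.getD t 0 := fun t ht => by
    simp [hm2, hm1, Memory.write_apply, (ns 1).symm, (ns 0).symm, hy t ht]
  have A3 := Prog.copy_det (m := m2) (d := ρ 0) (s := s) (i := i) (N := y.length) (L := L)
    (B := 4 + L) (v := 1) (j := .const 1) (n := .read l (.const 0)) (n4 0) hs (ns 0).symm rfl
    (by simp [RExpr.cost]; omega)
    (fun m' hm' => by
      simp only [RExpr.eval, RExpr.cost, hm' l hl4, e2]
      exact ⟨trivial, by simp; omega⟩)
    (by omega) (by omega)
    (fun t ht => by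
      rw [e3 t ht]
      have := size_getD_le y t
      omega)
  set m3 := m2.copied (ρ 0) 1 s i y.length with hm3
  obtain ⟨k1, hk1, A1⟩ := A1
  obtain ⟨k2, hk2, A2⟩ := A2
  obtain ⟨k3, hk3, A3⟩ := A3
  refine ⟨m3, k1 + k2 + k3, by nlinarith, ?_, ?_⟩
  · intro a ha4 ha
    have a0 : a ≠ ρ 0 := fun h => ha ⟨0, h.symm⟩
    have a1 : a ≠ ρ 1 := fun h => ha ⟨1, h.symm⟩
    rw [hm3, Memory.copied_of_ne ha4 a0]
    funext x
    simp [hm2, hm1, Memory.write_apply, a0, a1]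
  · intro U T s₀
    rw [Prog.call, Prog.exec_seq_of_pure (A1 lam U T s₀), Prog.exec_seq_of_pure (A2 lam U T _),
      Prog.exec_seq_of_pure (A3 lam U T _), Prog.exec_rename hρ]
    -- Seen through the renaming, the prepared memory is the start configuration on `y`.
    have hview : Config.view ρ ⟨m3, T, s₀ + k1 + k2 + k3⟩ =
        (startConfig lam y T).charge (s₀ + (k1 + k2 + k3)) := by
      simp only [Config.view, startConfig, Config.charge, Config.mk.injEq, true_and]
      refine ⟨?_, by omega⟩
      funext a x
      by_cases ha0 : a = 0
      · subst ha0
        rw [hm3, Memory.copied_dst (n4 0)]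
        have h10 : ρ 0 ≠ ρ 1 := fun h => by simpa using hρ h
        rcases Nat.eq_zero_or_pos x with rfl | hx
        · simp [hm2, hm1, Memory.write_apply, h10]
        · obtain ⟨t, rfl⟩ : ∃ t, x = t + 1 := ⟨x - 1, by omega⟩
          by_cases ht : t < y.length
          · rw [if_pos (by omega), show i + (t + 1 - 1) = i + t by omega, e3 t ht]
            rfl
          · rw [if_neg (by omega)]
            simp [hm2, hm1, Memory.write_apply, h10, h0, not_lt.1 ht]
      · have h0a : ρ a ≠ ρ 0 := fun h => ha0 (hρ h)
        rw [hm3, Memory.copied_of_ne (n4 a) h0a]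
        by_cases ha1 : a = 1
        · subst ha1
          rcases x with _ | x
          · simp [hm2, Memory.write_apply]
          · simp [hm2, hm1, Memory.write_apply, h0, h0a]
        · have h1a : ρ a ≠ ρ 1 := fun h => ha1 (hρ h)
          obtain ⟨b, rfl⟩ : ∃ b, a = b + 2 := ⟨a - 2, by omega⟩
          simp [hm2, hm1, Memory.write_apply, h0, h0a, h1a]
    rw [hview, Prog.exec_charge, Functor.map_map]
    congr 1

/-! ### Composition and pairing of programs -/

theorem Config.embed_mem_apply {lam : ℕ} {ρ : ℕ → ℕ} (hρ : ρ.Injective) (m : Memory)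
    (c : Config lam) (a : ℕ) : (c.embed ρ m).mem (ρ a) = c.mem a := hρ.extend_apply _ _ _

theorem Config.embed_mem_of_notMem {lam : ℕ} {ρ : ℕ → ℕ} (m : Memory) (c : Config lam) {a : ℕ}
    (ha : a ∉ Set.range ρ) : (c.embed ρ m).mem a = m a := Function.extend_apply' _ _ _ ha

/-- The arrays of the `i`-th subroutine (`i < 2`) of a compound program.  Arrays below `10` are left
to the compound program itself. -/
def slot (i a : ℕ) : ℕ := 10 + 2 * a + i

theorem slot_injective (i : ℕ) : (slot i).Injective := fun a b h => by
  unfold slot at h; omega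

theorem notMem_range_slot_of_lt {i a : ℕ} (h : a < 10) : a ∉ Set.range (slot i) := by
  rintro ⟨b, rfl⟩; unfold slot at h; omega

theorem slot_zero_notMem_range (a : ℕ) : slot 0 a ∉ Set.range (slot 1) := by
  rintro ⟨b, h⟩; unfold slot at h; omega

theorem slot_one_notMem_range (a : ℕ) : slot 1 a ∉ Set.range (slot 0) := by
  rintro ⟨b, h⟩; unfold slot at h; omega

theorem slot_ne_of_lt {i a b : ℕ} (h : b < 10) : slot i a ≠ b := by
  unfold slot; omega

theorem Config.output_length {lam : ℕ} (c : Config lam) : c.output.length = c.mem 3 0 := by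
  simp [Config.output]

theorem Config.output_getD {lam : ℕ} (c : Config lam) {t : ℕ} (ht : t < c.mem 3 0) :
    c.output.getD t 0 = c.mem 2 t := by
  simp [Config.output, ht]

theorem Config.size_mem_le_of_output {lam : ℕ} (c : Config lam) {t : ℕ} (ht : t < c.mem 3 0) :
    (c.mem 2 t).size ≤ listSize c.output := by
  rw [← c.output_getD ht]; exact size_getD_le _ _

/-- Feed the output of `P` to `Q`. -/
def Prog.comp (P Q : Prog) : Prog :=
  .seq (.call (slot 0) P 0 1 1) (.seq (.call (slot 1) Q (slot 0 2) 0 (slot 0 3))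
    (.seq (.copy 2 (.const 0) (slot 1 2) 0 (.read (slot 1 3) (.const 0)))
      (.assign 3 (.const 0) (.read (slot 1 3) (.const 0)))))

/-- Run `P` and `Q` on the same input and concatenate the outputs. -/
def Prog.pair (P Q : Prog) : Prog :=
  .seq (.call (slot 0) P 0 1 1) (.seq (.call (slot 1) Q 0 1 1)
    (.seq (.copy 2 (.const 0) (slot 0 2) 0 (.read (slot 0 3) (.const 0)))
      (.seq (.copy 2 (.read (slot 0 3) (.const 0)) (slot 1 2) 0 (.read (slot 1 3) (.const 0)))
        (.assign 3 (.const 0)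
          (.op .add (.read (slot 0 3) (.const 0)) (.read (slot 1 3) (.const 0)))))))

theorem startConfig_mem_slot (lam : ℕ) (x : List ℕ) (T : OTable lam) (i a : ℕ) :
    (startConfig lam x T).mem (slot i a) = fun _ => 0 := by
  funext j
  obtain ⟨b, hb⟩ : ∃ b, slot i a = b + 2 := ⟨slot i a - 2, by unfold slot; omega⟩
  rw [hb]; rfl

/-- An execution of `P.comp Q` is one of `P` followed by one of `Q` on the output of `P`. The
function `fin` makes the final configuration out of the final configurations of the two. -/
theorem Prog.comp_exec (P Q : Prog) (lam : ℕ) (x : List ℕ) :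
    ∃ fin : Config lam → Config lam → Config lam,
      (∀ c₁ c₂, (fin c₁ c₂).output = c₂.output ∧ (fin c₁ c₂).table = c₂.table ∧
        (fin c₁ c₂).steps ≤ c₁.steps + c₂.steps +
          300 * (lam + listSize x + listSize c₁.output + listSize c₂.output + 5) ^ 2) ∧
      ∀ (U : Finset ℕ) (T : OTable lam), (P.comp Q).exec U (startConfig lam x T) =
        P.exec U (startConfig lam x T) >>= fun c₁ =>
          Q.exec U (startConfig lam c₁.output c₁.table) >>= fun c₂ => pure (fin c₁ c₂) := by
  set m0 : Memory := (startConfig lam x (emptyTable lam)).mem with hm0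
  obtain ⟨m1, k1, hk1, hm1, hP⟩ := Prog.call_exec (slot_injective 0) P (s := 0) (i := 1) (l := 1)
    (lam := lam) (y := x) (m := m0) (startConfig_mem_slot lam x _ 0) rfl rfl
    (fun t _ => by rw [Nat.add_comm]; rfl)
    (notMem_range_slot_of_lt (by norm_num)) (notMem_range_slot_of_lt (by norm_num))
    (notMem_range_slot_of_lt (by norm_num)) (notMem_range_slot_of_lt (by norm_num))
    (by norm_num) (by norm_num) (L := lam + listSize x + 2) (by omega)
  -- The arrays of `Q` are disjoint from those of `P`, hence still blank after the call of `P`.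
  have second : ∀ c₁ : Config lam, _ := fun c₁ =>
    Prog.call_exec (slot_injective 1) Q (s := slot 0 2) (i := 0) (l := slot 0 3)
      (lam := lam) (y := c₁.output) (m := (Config.embed (slot 0) m1 c₁).mem)
      (fun a => by
        rw [Config.embed_mem_of_notMem _ _ (slot_one_notMem_range a),
          hm1 _ (slot_ne_of_lt (by norm_num)) (slot_one_notMem_range a)]
        exact startConfig_mem_slot lam x _ 1 a)
      (by
        rw [Config.embed_mem_of_notMem _ _ (notMem_range_slot_of_lt (by norm_num)),
          hm1 _ (by norm_num) (notMem_range_slot_of_lt (by norm_num))]; rfl)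
      (by rw [Config.embed_mem_apply (slot_injective 0), Config.output_length])
      (fun t ht => by
        rw [Config.output_length] at ht
        rw [Config.embed_mem_apply (slot_injective 0), Config.output_getD _ ht, Nat.zero_add])
      (notMem_range_slot_of_lt (by norm_num)) (notMem_range_slot_of_lt (by norm_num))
      (slot_zero_notMem_range 2) (slot_zero_notMem_range 3) (slot_ne_of_lt (by norm_num))
      (slot_ne_of_lt (by norm_num)) (L := lam + listSize c₁.output + 1) (by omega)
  choose m2 k2 hk2 hm2 hQ using second
  -- The output is copied to the arrays `2` and `3` of the compound program.
  have third : ∀ c₁ c₂ : Config lam, ∃ m' : Memory, m' 3 0 = c₂.mem 3 0 ∧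
      (∀ t < c₂.mem 3 0, m' 2 t = c₂.mem 2 t) ∧
      (Prog.seq (.copy 2 (.const 0) (slot 1 2) 0 (.read (slot 1 3) (.const 0)))
        (.assign 3 (.const 0) (.read (slot 1 3) (.const 0)))).Det
          (Config.embed (slot 1) (m2 c₁) c₂).mem m'
          (100 * (listSize c₂.output + 5) ^ 2) := by
    intro c₁ c₂
    set m := (Config.embed (slot 1) (m2 c₁) c₂).mem with hm
    have r2 : m (slot 1 2) = c₂.mem 2 := Config.embed_mem_apply (slot_injective 1) _ _ _
    have r3 : m (slot 1 3) = c₂.mem 3 := Config.embed_mem_apply (slot_injective 1) _ _ _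
    have hlen := length_le_listSize c₂.output
    rw [Config.output_length] at hlen
    have hsz := Nat.size_le_self (c₂.mem 3 0)
    have A := Prog.copy_det (m := m) (d := 2) (s := slot 1 2) (i := 0) (N := c₂.mem 3 0)
      (L := listSize c₂.output) (B := listSize c₂.output + 3) (v := 0) (j := .const 0)
      (n := .read (slot 1 3) (.const 0)) (by norm_num) (slot_ne_of_lt (by norm_num))
      (slot_ne_of_lt (by norm_num)) rfl (by simp [RExpr.cost])
      (fun m' hm' => by
        simp only [RExpr.eval, RExpr.cost, hm' _ (slot_ne_of_lt (i := 1) (a := 3) (b := 4)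
          (by norm_num)), r3]
        exact ⟨trivial, by simp; omega⟩)
      (by omega) (by omega)
      (fun t ht => by rw [r2, Nat.zero_add]; exact c₂.size_mem_le_of_output ht)
    set m' := m.copied 2 0 (slot 1 2) 0 (c₂.mem 3 0) with hm'
    have e3 : m' (slot 1 3) = c₂.mem 3 := by
      rw [hm', Memory.copied_of_ne (slot_ne_of_lt (by norm_num)) (slot_ne_of_lt (by norm_num)), r3]
    have B := Prog.Det.assign 3 (.const 0) (.read (slot 1 3) (.const 0)) m'
    simp only [RExpr.eval, RExpr.cost, e3] at B
    refine ⟨_, ?_, ?_, (A.seq B).mono ?_⟩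
    · simp [Memory.write_apply]
    · intro t ht
      rw [Memory.write_apply, if_neg (by simp), hm', Memory.copied_dst (by norm_num),
        if_pos (by omega), r2]
      simp
    · simp only [Nat.size_zero]; nlinarith
  choose m3 h3 h2 hdet using third
  choose k3 hk3 hC using hdet
  refine ⟨fun c₁ c₂ => ⟨m3 c₁ c₂, c₂.table, c₂.steps + (c₁.steps + k1 + k2 c₁) + k3 c₁ c₂⟩,
    fun c₁ c₂ => ⟨?_, rfl, ?_⟩, fun U T => ?_⟩
  · simp only [Config.output, h3]
    exact List.map_congr_left fun t ht => h2 c₁ c₂ t (List.mem_range.1 ht)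
  · have a1 := hk2 c₁
    have a2 := hk3 c₁ c₂
    simp only
    set X := lam + listSize x + listSize c₁.output + listSize c₂.output + 5 with hX
    have b1 : (lam + listSize x + 2 + 1) ^ 2 ≤ X ^ 2 := Nat.pow_le_pow_left (by omega) 2
    have b2 : (lam + listSize c₁.output + 1 + 1) ^ 2 ≤ X ^ 2 := Nat.pow_le_pow_left (by omega) 2
    have b3 : (listSize c₂.output + 5) ^ 2 ≤ X ^ 2 := Nat.pow_le_pow_left (by omega) 2
    omega
  · have h1 : (Prog.call (slot 0) P 0 1 1).exec U (startConfig lam x T) =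
        (fun c => (Config.embed (slot 0) m1 c).charge (0 + k1)) <$>
          P.exec U (startConfig lam x T) := hP U T 0
    rw [Prog.comp, Prog.exec, h1, bind_map_left]
    refine bind_congr fun c₁ => ?_
    have h4 : (Prog.call (slot 1) Q (slot 0 2) 0 (slot 0 3)).exec U
        ((Config.embed (slot 0) m1 c₁).charge (0 + k1)) =
        (fun c => (Config.embed (slot 1) (m2 c₁) c).charge (c₁.steps + (0 + k1) + k2 c₁)) <$>
          Q.exec U (startConfig lam c₁.output c₁.table) := hQ c₁ U _ _
    rw [Prog.exec, h4, bind_map_left]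
    refine bind_congr fun c₂ => ?_
    have := hC c₁ c₂ lam U c₂.table (c₂.steps + (c₁.steps + (0 + k1) + k2 c₁))
    rw [Nat.zero_add] at this ⊢
    exact this

/-- An execution of `P.pair Q` is one of `P` followed by one of `Q` on the same input. The function
`fin` makes the final configuration out of the final configurations of the two. -/
theorem Prog.pair_exec (P Q : Prog) (lam : ℕ) (x : List ℕ) :
    ∃ fin : Config lam → Config lam → Config lam,
      (∀ c₁ c₂, (fin c₁ c₂).output = c₁.output ++ c₂.output ∧ (fin c₁ c₂).table = c₂.table ∧
        (fin c₁ c₂).steps ≤ c₁.steps + c₂.steps +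
          600 * (lam + listSize x + listSize c₁.output + listSize c₂.output + 5) ^ 2) ∧
      ∀ (U : Finset ℕ) (T : OTable lam), (P.pair Q).exec U (startConfig lam x T) =
        P.exec U (startConfig lam x T) >>= fun c₁ =>
          Q.exec U (startConfig lam x c₁.table) >>= fun c₂ => pure (fin c₁ c₂) := by
  set m0 : Memory := (startConfig lam x (emptyTable lam)).mem with hm0
  obtain ⟨m1, k1, hk1, hm1, hP⟩ := Prog.call_exec (slot_injective 0) P (s := 0) (i := 1) (l := 1)
    (lam := lam) (y := x) (m := m0) (startConfig_mem_slot lam x _ 0) rfl rfl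
    (fun t _ => by rw [Nat.add_comm]; rfl)
    (notMem_range_slot_of_lt (by norm_num)) (notMem_range_slot_of_lt (by norm_num))
    (notMem_range_slot_of_lt (by norm_num)) (notMem_range_slot_of_lt (by norm_num))
    (by norm_num) (by norm_num) (L := lam + listSize x + 2) (by omega)
  have low : ∀ (c₁ : Config lam) (a : ℕ), a < 10 → a ≠ 4 →
      (Config.embed (slot 0) m1 c₁).mem a = m0 a := fun c₁ a ha ha4 => by
    rw [Config.embed_mem_of_notMem _ _ (notMem_range_slot_of_lt ha),
      hm1 _ ha4 (notMem_range_slot_of_lt ha)]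
  -- The arrays of `Q` are disjoint from those of `P`, hence still blank after the call of `P`.
  have second : ∀ c₁ : Config lam, _ := fun c₁ =>
    Prog.call_exec (slot_injective 1) Q (s := 0) (i := 1) (l := 1)
      (lam := lam) (y := x) (m := (Config.embed (slot 0) m1 c₁).mem)
      (fun a => by
        rw [Config.embed_mem_of_notMem _ _ (slot_one_notMem_range a),
          hm1 _ (slot_ne_of_lt (by norm_num)) (slot_one_notMem_range a)]
        exact startConfig_mem_slot lam x _ 1 a)
      (by rw [low c₁ 0 (by norm_num) (by norm_num)]; rfl)
      (by rw [low c₁ 1 (by norm_num) (by norm_num)]; rfl)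
      (fun t ht => by rw [low c₁ 0 (by norm_num) (by norm_num), Nat.add_comm]; rfl)
      (notMem_range_slot_of_lt (by norm_num)) (notMem_range_slot_of_lt (by norm_num))
      (notMem_range_slot_of_lt (by norm_num)) (notMem_range_slot_of_lt (by norm_num))
      (by norm_num) (by norm_num) (L := lam + listSize x + 2) (by omega)
  choose m2 k2 hk2 hm2 hQ using second
  -- The output is copied to the arrays `2` and `3` of the compound program.
  have third : ∀ c₁ c₂ : Config lam, ∃ m' : Memory, m' 3 0 = c₁.mem 3 0 + c₂.mem 3 0 ∧
      (∀ t < c₁.mem 3 0, m' 2 t = c₁.mem 2 t) ∧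
      (∀ t < c₂.mem 3 0, m' 2 (c₁.mem 3 0 + t) = c₂.mem 2 t) ∧
      (Prog.seq (.copy 2 (.const 0) (slot 0 2) 0 (.read (slot 0 3) (.const 0)))
      (.seq (.copy 2 (.read (slot 0 3) (.const 0)) (slot 1 2) 0 (.read (slot 1 3) (.const 0)))
        (.assign 3 (.const 0)
          (.op .add (.read (slot 0 3) (.const 0)) (.read (slot 1 3) (.const 0)))))).Det
          (Config.embed (slot 1) (m2 c₁) c₂).mem m'
          (200 * (listSize c₁.output + listSize c₂.output + 5) ^ 2) := by
    intro c₁ c₂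
    set m := (Config.embed (slot 1) (m2 c₁) c₂).mem with hm
    have r2 : m (slot 1 2) = c₂.mem 2 := Config.embed_mem_apply (slot_injective 1) _ _ _
    have r3 : m (slot 1 3) = c₂.mem 3 := Config.embed_mem_apply (slot_injective 1) _ _ _
    have q : ∀ a, m (slot 0 a) = c₁.mem a := fun a => by
      rw [hm, Config.embed_mem_of_notMem _ _ (slot_zero_notMem_range a),
        hm2 _ _ (slot_ne_of_lt (by norm_num)) (slot_zero_notMem_range a),
        Config.embed_mem_apply (slot_injective 0)]
    have hlen₁ := length_le_listSize c₁.output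
    rw [Config.output_length] at hlen₁
    have hsz₁ := Nat.size_le_self (c₁.mem 3 0)
    have hlen := length_le_listSize c₂.output
    rw [Config.output_length] at hlen
    have hsz := Nat.size_le_self (c₂.mem 3 0)
    set L := listSize c₁.output + listSize c₂.output with hL
    have A := Prog.copy_det (m := m) (d := 2) (s := slot 0 2) (i := 0) (N := c₁.mem 3 0)
      (L := L) (B := L + 3) (v := 0) (j := .const 0)
      (n := .read (slot 0 3) (.const 0)) (by norm_num) (slot_ne_of_lt (by norm_num))
      (slot_ne_of_lt (by norm_num)) rfl (by simp [RExpr.cost])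
      (fun m' hm' => by
        simp only [RExpr.eval, RExpr.cost, hm' _ (slot_ne_of_lt (i := 0) (a := 3) (b := 4)
          (by norm_num)), q]
        exact ⟨trivial, by simp; omega⟩)
      (by omega) (by omega)
      (fun t ht => by
        rw [q, Nat.zero_add]; exact (c₁.size_mem_le_of_output ht).trans (by omega))
    set m' := m.copied 2 0 (slot 0 2) 0 (c₁.mem 3 0) with hm'
    have e : ∀ i a, m' (slot i a) = m (slot i a) := fun i a => by
      rw [hm', Memory.copied_of_ne (slot_ne_of_lt (by norm_num)) (slot_ne_of_lt (by norm_num))]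
    have A' := Prog.copy_det (m := m') (d := 2) (s := slot 1 2) (i := 0) (N := c₂.mem 3 0)
      (L := L) (B := L + 3) (v := c₁.mem 3 0) (j := .read (slot 0 3) (.const 0))
      (n := .read (slot 1 3) (.const 0)) (by norm_num) (slot_ne_of_lt (by norm_num))
      (slot_ne_of_lt (by norm_num)) (by simp [RExpr.eval, e, q])
      (by simp [RExpr.cost, RExpr.eval, e, q]; omega)
      (fun m'' hm'' => by
        simp only [RExpr.eval, RExpr.cost, hm'' _ (slot_ne_of_lt (i := 1) (a := 3) (b := 4)
          (by norm_num)), e, r3]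
        exact ⟨trivial, by simp; omega⟩)
      (by omega) (by omega)
      (fun t ht => by
        rw [e, r2, Nat.zero_add]; exact (c₂.size_mem_le_of_output ht).trans (by omega))
    set m'' := m'.copied 2 (c₁.mem 3 0) (slot 1 2) 0 (c₂.mem 3 0) with hm''
    have e' : ∀ i a, m'' (slot i a) = m (slot i a) := fun i a => by
      rw [hm'', Memory.copied_of_ne (slot_ne_of_lt (by norm_num)) (slot_ne_of_lt (by norm_num)), e]
    have B := Prog.Det.assign 3 (.const 0)
      (.op .add (.read (slot 0 3) (.const 0)) (.read (slot 1 3) (.const 0))) m''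
    simp only [RExpr.eval, RExpr.cost, e', r3, q, ArithOp.eval] at B
    refine ⟨_, ?_, ?_, ?_, (A.seq (A'.seq B)).mono ?_⟩
    · simp [Memory.write_apply]
    · intro t ht
      rw [Memory.write_apply, if_neg (by simp), hm'', Memory.copied_dst (by norm_num),
        if_neg (by omega), hm', Memory.copied_dst (by norm_num), if_pos (by omega), q]
      simp
    · intro t ht
      rw [Memory.write_apply, if_neg (by simp), hm'', Memory.copied_dst (by norm_num),
        if_pos (by omega), e, r2]
      simp
    · have := Nat.size_le_self (c₁.mem 3 0 + c₂.mem 3 0)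
      simp only [Nat.size_zero]; nlinarith
  choose m3 h3 h2 h2' hdet using third
  choose k3 hk3 hC using hdet
  refine ⟨fun c₁ c₂ => ⟨m3 c₁ c₂, c₂.table, c₂.steps + (c₁.steps + k1 + k2 c₁) + k3 c₁ c₂⟩,
    fun c₁ c₂ => ⟨?_, rfl, ?_⟩, fun U T => ?_⟩
  · simp only [Config.output, h3, List.range_add, List.map_append, List.map_map]
    congr 1
    · exact List.map_congr_left fun t ht => h2 c₁ c₂ t (List.mem_range.1 ht)
    · exact List.map_congr_left fun t ht => h2' c₁ c₂ t (List.mem_range.1 ht)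
  · have a1 := hk2 c₁
    have a2 := hk3 c₁ c₂
    simp only
    set X := lam + listSize x + listSize c₁.output + listSize c₂.output + 5 with hX
    have b1 : (lam + listSize x + 2 + 1) ^ 2 ≤ X ^ 2 := Nat.pow_le_pow_left (by omega) 2
    have b3 : (listSize c₁.output + listSize c₂.output + 5) ^ 2 ≤ X ^ 2 :=
      Nat.pow_le_pow_left (by omega) 2
    omega
  · have h1 : (Prog.call (slot 0) P 0 1 1).exec U (startConfig lam x T) =
        (fun c => (Config.embed (slot 0) m1 c).charge (0 + k1)) <$>
          P.exec U (startConfig lam x T) := hP U T 0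
    rw [Prog.pair, Prog.exec, h1, bind_map_left]
    refine bind_congr fun c₁ => ?_
    have h4 : (Prog.call (slot 1) Q 0 1 1).exec U
        ((Config.embed (slot 0) m1 c₁).charge (0 + k1)) =
        (fun c => (Config.embed (slot 1) (m2 c₁) c).charge (c₁.steps + (0 + k1) + k2 c₁)) <$>
          Q.exec U (startConfig lam x c₁.table) := hQ c₁ U _ _
    rw [Prog.exec, h4, bind_map_left]
    refine bind_congr fun c₂ => ?_
    have := hC c₁ c₂ lam U c₂.table (c₂.steps + (c₁.steps + (0 + k1) + k2 c₁))
    rw [Nat.zero_add] at this ⊢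
    exact this

/-- Composition of programs is composition of the computed functions. -/
theorem Prog.comp_run (U : Finset ℕ) (P Q : Prog) (lam : ℕ) (x : List ℕ) :
    (P.comp Q).run U lam x = P.run U lam x >>= Q.run U lam := by
  funext T
  obtain ⟨fin, hfin, h⟩ := P.comp_exec Q lam x
  show _ = StateT.bind _ _ T
  simp only [Prog.run, h, StateT.bind, bind_assoc, LawfulMonad.pure_bind, (hfin _ _).1,
    (hfin _ _).2.1]

/-- The oracle table is passed on from `P` to `Q`. -/
theorem Prog.pair_run (U : Finset ℕ) (P Q : Prog) (lam : ℕ) (x : List ℕ) :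
    (P.pair Q).run U lam x =
      P.run U lam x >>= fun y => Q.run U lam x >>= fun z => pure (y ++ z) := by
  funext T
  obtain ⟨fin, hfin, h⟩ := P.pair_exec Q lam x
  show _ = StateT.bind _ (fun y => StateT.bind _ fun z => StateT.pure _) T
  simp only [Prog.run, h, StateT.bind, StateT.pure, bind_assoc, LawfulMonad.pure_bind,
    (hfin _ _).1, (hfin _ _).2.1]

theorem Prog.PolyTime.comp {U : Finset ℕ} {P Q : Prog} (hP : P.PolyTime U) (hQ : Q.PolyTime U) :
    (P.comp Q).PolyTime U := by
  obtain ⟨p, hp⟩ := hP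
  obtain ⟨q, hq⟩ := hQ
  -- The output of `P` has size at most `p n`, so `Q` runs for at most `q (n + p n)` steps.
  refine ⟨p + q.comp (Polynomial.X + p) +
    300 * (Polynomial.X + p + q.comp (Polynomial.X + p) + 5) ^ 2, fun lam x T c hc => ?_⟩
  obtain ⟨fin, hfin, h⟩ := P.comp_exec Q lam x
  rw [h] at hc
  obtain ⟨c₁, h₁, hc⟩ := PMF.mem_support_bind.1 hc
  obtain ⟨c₂, h₂, hc⟩ := PMF.mem_support_bind.1 hc
  obtain rfl := PMF.mem_support_pure.1 hc
  obtain ⟨ho, -, hs⟩ := hfin c₁ c₂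
  have a1 := hp _ _ _ _ h₁
  have a2 := hq _ _ _ _ h₂
  set n := lam + listSize x with hn
  have a3 : q.eval (lam + listSize c₁.output) ≤ q.eval (n + p.eval n) :=
    q.eval_mono_nat (by omega)
  rw [ho]
  simp only [Polynomial.eval_add, Polynomial.eval_comp, Polynomial.eval_X, Polynomial.eval_mul,
    Polynomial.eval_pow, Polynomial.eval_ofNat]
  have a4 : (n + listSize c₁.output + listSize c₂.output + 5) ^ 2 ≤
    (n + p.eval n + q.eval (n + p.eval n) + 5) ^ 2 := Nat.pow_le_pow_left (by omega) 2
  omega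

theorem Prog.PolyTime.pair {U : Finset ℕ} {P Q : Prog} (hP : P.PolyTime U) (hQ : Q.PolyTime U) :
    (P.pair Q).PolyTime U := by
  obtain ⟨p, hp⟩ := hP
  obtain ⟨q, hq⟩ := hQ
  refine ⟨p + q + 600 * (Polynomial.X + p + q + 5) ^ 2, fun lam x T c hc => ?_⟩
  obtain ⟨fin, hfin, h⟩ := P.pair_exec Q lam x
  rw [h] at hc
  obtain ⟨c₁, h₁, hc⟩ := PMF.mem_support_bind.1 hc
  obtain ⟨c₂, h₂, hc⟩ := PMF.mem_support_bind.1 hc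
  obtain rfl := PMF.mem_support_pure.1 hc
  obtain ⟨ho, -, hs⟩ := hfin c₁ c₂
  have a1 := hp _ _ _ _ h₁
  have a2 := hq _ _ _ _ h₂
  set n := lam + listSize x with hn
  rw [ho, listSize_append]
  simp only [Polynomial.eval_add, Polynomial.eval_X, Polynomial.eval_mul,
    Polynomial.eval_pow, Polynomial.eval_ofNat]
  have a4 : (n + listSize c₁.output + listSize c₂.output + 5) ^ 2 ≤
    (n + p.eval n + q.eval n + 5) ^ 2 := Nat.pow_le_pow_left (by omega) 2
  omega

theorem Prog.ProgramFree.comp {P Q : Prog} (hP : P.ProgramFree) (hQ : Q.ProgramFree) :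
    (P.comp Q).ProgramFree :=
  ⟨⟨trivial, trivial, ⟨trivial, trivial, trivial, trivial, trivial⟩, hP.rename _⟩,
    ⟨trivial, trivial, ⟨trivial, trivial, trivial, trivial, trivial⟩, hQ.rename _⟩,
    ⟨trivial, trivial, trivial, trivial, trivial⟩, trivial⟩

theorem Prog.ProgramFree.pair {P Q : Prog} (hP : P.ProgramFree) (hQ : Q.ProgramFree) :
    (P.pair Q).ProgramFree :=
  ⟨⟨trivial, trivial, ⟨trivial, trivial, trivial, trivial, trivial⟩, hP.rename _⟩,
    ⟨trivial, trivial, ⟨trivial, trivial, trivial, trivial, trivial⟩, hQ.rename _⟩,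
    ⟨trivial, trivial, trivial, trivial, trivial⟩,
    ⟨trivial, trivial, trivial, trivial, trivial⟩, trivial⟩

/-! ### Elementary programs -/

/-- A factor bounding the cost of an expression in terms of the size of the memory cells. -/
def RExpr.weight : RExpr → ℕ
  | .const n => 1 + n
  | .read _ i => i.weight + 1
  | .op _ e f => 2 * (e.weight + f.weight) + 2

theorem RExpr.size_eval_le_cost (m : Memory) (e : RExpr) : (e.eval m).size ≤ e.cost m := by
  cases e <;> simp only [RExpr.eval, RExpr.cost] <;> omega

theorem RExpr.cost_le {m : Memory} {L : ℕ} (h : ∀ a i, (m a i).size ≤ L) (e : RExpr) :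
    e.cost m ≤ e.weight * (L + 1) := by
  induction e with
  | const n => have := Nat.size_le_self n; simp only [RExpr.cost, RExpr.weight]; nlinarith
  | read a i ih =>
    have := h a (i.eval m)
    simp only [RExpr.cost, RExpr.weight]; nlinarith
  | op o e f ihe ihf =>
    have h1 := o.size_eval_le (e.eval m) (f.eval m)
    have h2 := e.size_eval_le_cost m
    have h3 := f.size_eval_le_cost m
    simp only [RExpr.cost, RExpr.weight]; nlinarith

theorem startConfig_size_le (lam : ℕ) (x : List ℕ) (T : OTable lam) (a i : ℕ) :
    ((startConfig lam x T).mem a i).size ≤ lam + listSize x := by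
  rcases a with _ | _ | a
  · rcases i with _ | i
    · exact (Nat.size_le_self lam).trans (by omega)
    · exact (size_getD_le x i).trans (by omega)
  · rcases i with _ | i
    · have := length_le_listSize x
      exact (Nat.size_le_self _).trans (by simp [startConfig]; omega)
    · simp [startConfig]
  · simp [startConfig]

/-- The memory at the start of a run. -/
def startMem (lam : ℕ) (x : List ℕ) : Memory := (startConfig lam x (emptyTable lam)).mem

theorem startMem_size_le (lam : ℕ) (x : List ℕ) (a i : ℕ) :
    (startMem lam x a i).size ≤ lam + listSize x := startConfig_size_le lam x _ a i

/-- The value of an expression at the start of a run. -/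
def RExpr.onInput (lam : ℕ) (x : List ℕ) (e : RExpr) : ℕ := e.eval (startMem lam x)

/-- The `j`-th input. -/
def RExpr.inp (j : ℕ) : RExpr := .read 0 (.const (j + 1))

@[simp] theorem RExpr.onInput_inp (lam : ℕ) (x : List ℕ) (j : ℕ) :
    (RExpr.inp j).onInput lam x = x.getD j 0 := rfl
@[simp] theorem RExpr.onInput_const (lam : ℕ) (x : List ℕ) (n : ℕ) :
    (RExpr.const n).onInput lam x = n := rfl

/-- The expression reads the input array only. -/
def RExpr.InputOnly : RExpr → Prop
  | .const _ => True
  | .read a i => a = 0 ∧ i.InputOnly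
  | .op _ e f => e.InputOnly ∧ f.InputOnly

theorem RExpr.InputOnly.congr {m m' : Memory} (hm : m 0 = m' 0) {e : RExpr} (he : e.InputOnly) :
    e.eval m = e.eval m' ∧ e.cost m = e.cost m' := by
  induction e with
  | const n => exact ⟨rfl, rfl⟩
  | read a i ih =>
    obtain ⟨rfl, hi⟩ := he
    obtain ⟨h1, h2⟩ := ih hi
    simp only [RExpr.eval, RExpr.cost, h1, h2, hm, and_self]
  | op o e f ihe ihf =>
    obtain ⟨h1, h2⟩ := ihe he.1
    obtain ⟨h3, h4⟩ := ihf he.2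
    simp only [RExpr.eval, RExpr.cost, h1, h2, h3, h4, and_self]

/-- The output of a deterministic program, read off from its final memory. -/
theorem Prog.run_of_det {P : Prog} {lam K : ℕ} {x y : List ℕ} {m' : Memory}
    (h : P.Det (startMem lam x) m' K) (hy : (List.range (m' 3 0)).map (m' 2) = y) (U : Finset ℕ) :
    P.run U lam x = pure y := by
  obtain ⟨k, -, h⟩ := h
  funext T
  have := h lam U T 0
  show _ = StateT.pure y T
  simp only [Prog.run, StateT.pure]
  change P.exec U (startConfig lam x T) = _ at this
  rw [this, LawfulMonad.pure_bind]
  simp only [Config.output, hy]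

theorem Prog.polyTime_of_det {P : Prog} (q : Polynomial ℕ)
    (h : ∀ (lam : ℕ) (x : List ℕ), ∃ m', P.Det (startMem lam x) m' (q.eval (lam + listSize x)) ∧
      listSize ((List.range (m' 3 0)).map (m' 2)) ≤ q.eval (lam + listSize x)) (U : Finset ℕ) :
    P.PolyTime U := by
  refine ⟨q + q, fun lam x T c hc => ?_⟩
  obtain ⟨m', ⟨k, hk, hd⟩, ho⟩ := h lam x
  have := hd lam U T 0
  change P.exec U (startConfig lam x T) = _ at this
  rw [this] at hc
  obtain rfl := PMF.mem_support_pure.1 hc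
  rw [Polynomial.eval_add]
  simp only [Config.output]
  omega

/-- Write the values of the expressions to the output, from cell `k` on. -/
def Prog.exprsFrom : ℕ → List RExpr → Prog
  | k, [] => .assign 3 (.const 0) (.const k)
  | k, e :: es => .seq (.assign 2 (.const k) e) (Prog.exprsFrom (k + 1) es)

/-- Output the values of the expressions. -/
def Prog.exprs (es : List RExpr) : Prog := Prog.exprsFrom 0 es

/-- The input array is never written to, so each expression keeps the value that it has on the
input. -/
theorem Prog.exprsFrom_det {lam : ℕ} {x : List ℕ} (es : List RExpr)
    (hes : ∀ e ∈ es, e.InputOnly) (k : ℕ) (m : Memory) (hm : m 0 = startMem lam x 0) :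
    ∃ m', (Prog.exprsFrom k es).Det m m'
        ((k + es.length + 3) * (es.length + 1) +
          (es.map RExpr.weight).sum * (lam + listSize x + 1)) ∧
      m' 3 0 = k + es.length ∧ (∀ j < k, m' 2 j = m 2 j) ∧
      ∀ j < es.length, m' 2 (k + j) = (es.map (RExpr.onInput lam x)).getD j 0 := by
  induction es generalizing k m with
  | nil =>
    have := Nat.size_le_self k
    refine ⟨_, (Prog.Det.assign 3 (.const 0) (.const k) m).mono ?_, ?_, ?_, ?_⟩
    · simp [RExpr.cost]; omega
    · simp [Memory.write_apply, RExpr.eval]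
    · intro j _; simp [Memory.write_apply]
    · simp
  | cons e es ih =>
    have he := hes e (by simp)
    obtain ⟨h1, h2⟩ := he.congr hm
    have A := Prog.Det.assign 2 (.const k) e m
    rw [h1, h2] at A
    obtain ⟨m', hd, h3, hlt, hge⟩ := ih (fun f hf => hes f (by simp [hf])) (k + 1)
      (m.write 2 k (e.eval (startMem lam x))) (by funext j; simp [Memory.write_apply, hm])
    have hc := RExpr.cost_le (startMem_size_le lam x) e
    have hk := Nat.size_le_self k
    refine ⟨m', (A.seq hd).mono ?_, ?_, ?_, ?_⟩
    · simp only [RExpr.cost, List.length_cons, List.map_cons, List.sum_cons]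
      nlinarith
    · rw [h3, List.length_cons]; omega
    · intro j hj
      rw [hlt j (by omega)]
      simp [Memory.write_apply]; omega
    · intro j hj
      rcases j with _ | j
      · rw [Nat.add_zero, hlt k (by omega)]
        simp [Memory.write_apply, RExpr.onInput]
      · have := hge j (by simpa using hj)
        rw [show k + (j + 1) = k + 1 + j by omega, this]
        simp

theorem Prog.exprs_det (es : List RExpr) (hes : ∀ e ∈ es, e.InputOnly) (lam : ℕ) (x : List ℕ) :
    ∃ m', (Prog.exprs es).Det (startMem lam x) m'
        ((es.length + 3) * (es.length + 1) +
          (es.map RExpr.weight).sum * (lam + listSize x + 1)) ∧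
      (List.range (m' 3 0)).map (m' 2) = es.map (RExpr.onInput lam x) := by
  obtain ⟨m', hd, h3, -, hge⟩ := Prog.exprsFrom_det es hes 0 (startMem lam x) rfl
  simp only [Nat.zero_add] at hd
  refine ⟨m', hd, ?_⟩
  refine List.ext_getElem (by simp [h3]) fun j hj hj' => ?_
  have := hge j (by simpa using hj')
  rw [List.getD_eq_getElem _ _ hj', Nat.zero_add] at this
  simp [this]

theorem Prog.exprs_run {es : List RExpr} (hes : ∀ e ∈ es, e.InputOnly) (U : Finset ℕ) (lam : ℕ)
    (x : List ℕ) : (Prog.exprs es).run U lam x = pure (es.map (RExpr.onInput lam x)) := by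
  obtain ⟨m', hd, ho⟩ := Prog.exprs_det es hes lam x
  exact Prog.run_of_det hd ho U

theorem listSize_map_onInput_le (lam : ℕ) (x : List ℕ) (es : List RExpr) :
    listSize (es.map (RExpr.onInput lam x)) ≤
      es.length + (es.map RExpr.weight).sum * (lam + listSize x + 1) := by
  induction es with
  | nil => simp [listSize_nil]
  | cons e es ih =>
    have h1 := RExpr.cost_le (startMem_size_le lam x) e
    have h2 : (e.onInput lam x).size ≤ _ := e.size_eval_le_cost (startMem lam x)
    simp only [List.map_cons, listSize_cons, List.length_cons, List.sum_cons]
    nlinarith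

theorem Prog.exprs_polyTime {es : List RExpr} (hes : ∀ e ∈ es, e.InputOnly) (U : Finset ℕ) :
    (Prog.exprs es).PolyTime U := by
  refine Prog.polyTime_of_det (Polynomial.C ((es.length + 3) * (es.length + 1)) +
    Polynomial.C (es.map RExpr.weight).sum * (Polynomial.X + 1)) (fun lam x => ?_) U
  obtain ⟨m', hd, ho⟩ := Prog.exprs_det es hes lam x
  simp only [Polynomial.eval_add, Polynomial.eval_mul, Polynomial.eval_C, Polynomial.eval_X,
    Polynomial.eval_one]
  refine ⟨m', hd, ?_⟩
  rw [ho]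
  refine (listSize_map_onInput_le lam x es).trans ?_
  nlinarith

theorem Prog.exprs_programFree (es : List RExpr) : (Prog.exprs es).ProgramFree := by
  have : ∀ k, (Prog.exprsFrom k es).ProgramFree := by
    induction es with
    | nil => exact fun _ => trivial
    | cons e es ih => exact fun k => ⟨trivial, ih _⟩
  exact this 0

/-- Output the input without its first `k` entries. -/
def Prog.tail (k : ℕ) : Prog :=
  .seq (.copy 2 (.const 0) 0 (k + 1) (.op .sub (.read 1 (.const 0)) (.const k)))
    (.assign 3 (.const 0) (.op .sub (.read 1 (.const 0)) (.const k)))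

theorem Prog.tail_det (k lam : ℕ) (x : List ℕ) :
    ∃ m', (Prog.tail k).Det (startMem lam x) m' (100 * (lam + listSize x + k + 3) ^ 2) ∧
      (List.range (m' 3 0)).map (m' 2) = x.drop k := by
  set m := startMem lam x with hm
  have hlen := length_le_listSize x
  have z1 := Nat.size_le_self x.length
  have z2 := Nat.size_le_self k
  have z3 := Nat.size_le_self (x.length - k)
  set L := lam + listSize x + k + 1 with hL
  have A := Prog.copy_det (m := m) (d := 2) (s := 0) (i := k + 1) (N := x.length - k) (L := L)
    (B := 4 + 2 * L) (v := 0) (j := .const 0) (n := .op .sub (.read 1 (.const 0)) (.const k))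
    (by norm_num) (by norm_num) (by norm_num) rfl (by simp [RExpr.cost]; omega)
    (fun m' hm' => by
      simp only [RExpr.eval, RExpr.cost, hm' 1 (by norm_num), ArithOp.eval]
      have : m 1 0 = x.length := rfl
      rw [this]
      exact ⟨rfl, by simp; omega⟩)
    (by omega) (by omega)
    (fun t _ => by
      have := startMem_size_le lam x 0 (k + 1 + t)
      rw [← hm] at this
      omega)
  set m' := m.copied 2 0 0 (k + 1) (x.length - k) with hm'
  have B := Prog.Det.assign 3 (.const 0) (.op .sub (.read 1 (.const 0)) (.const k)) m'
  have e : m' 1 0 = x.length := by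
    rw [hm', Memory.copied_of_ne (by norm_num) (by norm_num)]; rfl
  simp only [RExpr.eval, RExpr.cost, e, ArithOp.eval] at B
  refine ⟨_, (A.seq B).mono ?_, ?_⟩
  · rw [show lam + listSize x + k + 3 = L + 2 by omega]
    have hsq : (L + 2) ^ 2 = (L + 1) ^ 2 + 2 * L + 3 := by ring
    simp only [Nat.size_zero]; omega
  · refine List.ext_getElem (by simp [Memory.write_apply]) fun j hj hj' => ?_
    have hj2 : j < x.length - k := by simpa using hj'
    simp only [List.getElem_map, List.getElem_range, List.getElem_drop]
    rw [Memory.write_apply, if_neg (by simp), hm', Memory.copied_dst (by norm_num),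
      if_pos (by omega), show k + 1 + (j - 0) = (k + j) + 1 by omega]
    show x.getD (k + j) 0 = _
    rw [List.getD_eq_getElem _ _ (by omega)]

theorem Prog.tail_run (k : ℕ) (U : Finset ℕ) (lam : ℕ) (x : List ℕ) :
    (Prog.tail k).run U lam x = pure (x.drop k) := by
  obtain ⟨m', hd, ho⟩ := Prog.tail_det k lam x
  exact Prog.run_of_det hd ho U

theorem Prog.tail_polyTime (k : ℕ) (U : Finset ℕ) : (Prog.tail k).PolyTime U := by
  refine Prog.polyTime_of_det (100 * (Polynomial.X + Polynomial.C k + 3) ^ 2) (fun lam x => ?_) U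
  obtain ⟨m', hd, ho⟩ := Prog.tail_det k lam x
  refine ⟨m', by simpa using hd, ?_⟩
  rw [ho]
  refine (listSize_drop_le x k).trans ?_
  simp only [Polynomial.eval_add, Polynomial.eval_mul, Polynomial.eval_C, Polynomial.eval_X,
    Polynomial.eval_pow, Polynomial.eval_ofNat]
  have := Nat.le_self_pow two_ne_zero (lam + listSize x + k + 3)
  omega

theorem Prog.tail_programFree (k : ℕ) : (Prog.tail k).ProgramFree :=
  ⟨⟨trivial, trivial, trivial, trivial, trivial⟩, trivial⟩

/-- A computation that leaves the oracle alone. -/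
def OracleComp.lift {lam : ℕ} {α : Type} (p : PMF α) : OracleComp lam α := StateT.lift p

/-- Output one uniform number below the value of `n`. -/
def Prog.sample (n : RExpr) : Prog := .seq (.rand 2 (.const 0) n) (.assign 3 (.const 0) (.const 1))

theorem Prog.sample_run (n : RExpr) (U : Finset ℕ) (lam : ℕ) (x : List ℕ) :
    (Prog.sample n).run U lam x =
      OracleComp.lift (uniformNat (n.onInput lam x)) >>= fun v => pure [v] := by
  funext T
  show _ = StateT.bind (StateT.lift _) (fun v => StateT.pure [v]) T
  simp only [Prog.run, Prog.sample, Prog.exec, StateT.bind, StateT.pure, StateT.lift, bind_assoc,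
    LawfulMonad.pure_bind, uniformNat, bind_map_left]
  rfl

theorem Prog.sample_polyTime (n : RExpr) (U : Finset ℕ) : (Prog.sample n).PolyTime U := by
  refine ⟨Polynomial.C (2 * n.weight + 20) * (Polynomial.X + 1), fun lam x T c hc => ?_⟩
  simp only [Prog.sample, Prog.exec, bind_assoc, LawfulMonad.pure_bind] at hc
  obtain ⟨v, -, hc⟩ := PMF.mem_support_bind.1 hc
  obtain rfl := PMF.mem_support_pure.1 hc
  have hcost := RExpr.cost_le (startConfig_size_le lam x T) n
  have hn := n.size_eval_le_cost (startConfig lam x T).mem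
  -- The summand `1` covers a count of `0`, for which the sampled number is `0`.
  have hv : v.val.size ≤ (RExpr.eval (startConfig lam x T).mem n).size + 1 := by
    by_cases h0 : RExpr.eval (startConfig lam x T).mem n = 0
    · have h1 := v.2
      have h2 : v.val = 0 := by omega
      simp [h2]
    · exact (Nat.size_le_size (by have := v.2; omega)).trans (Nat.le_succ _)
  have hs : (startConfig lam x T).steps = 0 := rfl
  simp only [Config.output, Config.update_mem, Config.update_steps, Memory.write_apply,
    RExpr.eval, RExpr.cost, hs]
  simp only [and_self, if_true, List.range_one, List.map_cons, List.map_nil, listSize_cons,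
    listSize_nil]
  simp only [Polynomial.eval_mul, Polynomial.eval_C, Polynomial.eval_add, Polynomial.eval_X,
    Polynomial.eval_one]
  simp only [Nat.size_zero, Nat.size_one, Memory.write_apply]
  norm_num
  nlinarith

theorem Prog.sample_programFree (n : RExpr) : (Prog.sample n).ProgramFree := ⟨trivial, trivial⟩

theorem Prog.exec_ite_startConfig (e : RExpr) (P Q : Prog) (U : Finset ℕ) (lam : ℕ) (x : List ℕ)
    (T : OTable lam) : (Prog.ite e P Q).exec U (startConfig lam x T) =
      (fun c => Config.charge c (1 + e.cost (startMem lam x))) <$>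
        (if e.onInput lam x ≠ 0 then P else Q).exec U (startConfig lam x T) := by
  rw [← Prog.exec_charge, Prog.exec]
  have h1 : e.eval (startConfig lam x T).mem = e.onInput lam x := rfl
  rw [h1]
  split_ifs <;> rfl

theorem Prog.ite_run (e : RExpr) (P Q : Prog) (U : Finset ℕ) (lam : ℕ) (x : List ℕ) :
    (Prog.ite e P Q).run U lam x =
      if e.onInput lam x ≠ 0 then P.run U lam x else Q.run U lam x := by
  rw [← apply_ite (fun R : Prog => R.run U lam x)]
  funext T
  simp only [Prog.run, Prog.exec_ite_startConfig, bind_map_left]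
  rfl

theorem Prog.PolyTime.ite {U : Finset ℕ} (e : RExpr) {P Q : Prog} (hP : P.PolyTime U)
    (hQ : Q.PolyTime U) : (Prog.ite e P Q).PolyTime U := by
  obtain ⟨p, hp⟩ := hP
  obtain ⟨q, hq⟩ := hQ
  refine ⟨p + q + 1 + Polynomial.C e.weight * (Polynomial.X + 1), fun lam x T c hc => ?_⟩
  rw [Prog.exec_ite_startConfig] at hc
  obtain ⟨c', hc', rfl⟩ := PMF.mem_support_fmap.1 hc
  have hcost := RExpr.cost_le (startMem_size_le lam x) e
  simp only [Polynomial.eval_mul, Polynomial.eval_C, Polynomial.eval_add, Polynomial.eval_X,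
    Polynomial.eval_one, Config.charge_steps]
  change c'.steps + _ + listSize c'.output ≤ _
  split_ifs at hc'
  · have := hp _ _ _ _ hc'
    omega
  · have := hq _ _ _ _ hc'
    omega

/-! ### Modular inverses -/

/-- One step of square-and-multiply, on the accumulator, the base and the exponent. -/
def powStep (p : ℕ) (s : ℕ × ℕ × ℕ) : ℕ × ℕ × ℕ :=
  (if s.2.2 % 2 = 0 then s.1 else s.1 * s.2.1 % p, s.2.1 * s.2.1 % p, s.2.2 / 2)

/-- A step of square-and-multiply, on the accumulator, base and exponent in array `5`, modulo the
first input. -/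
def Prog.powStep : Prog :=
  .seq (.ite (.op .mod (.read 5 (.const 2)) (.const 2))
      (.assign 5 (.const 0)
        (.op .mod (.op .mul (.read 5 (.const 0)) (.read 5 (.const 1))) (.inp 0))) .skip)
    (.seq (.assign 5 (.const 1)
        (.op .mod (.op .mul (.read 5 (.const 1)) (.read 5 (.const 1))) (.inp 0)))
      (.assign 5 (.const 2) (.op .div (.read 5 (.const 2)) (.const 2))))

/-- On input `[p, a]` compute `a ^ (p - 2)` modulo `p` by `K * (lam + 1)` steps of
square-and-multiply.  Nothing is done for `p = 0`: there, reduction modulo `p` is void, and repeated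
squaring would take exponential time. -/
def Prog.modInv (K : ℕ) : Prog :=
  .ite (.inp 0)
    (.seq (.assign 5 (.const 0) (.const 1))
    (.seq (.assign 5 (.const 1) (.op .mod (.inp 1) (.inp 0)))
    (.seq (.assign 5 (.const 2) (.op .sub (.inp 0) (.const 2)))
    (.seq (.loop (.op .mul (.const K) (.op .add (.read 0 (.const 0)) (.const 1))) .powStep)
    (.seq (.assign 2 (.const 0) (.read 5 (.const 0))) (.assign 3 (.const 0) (.const 1)))))))
    .skip

/-- The memory `m` with the state of square-and-multiply written to array `5`. -/
def Memory.withPow (m : Memory) (s : ℕ × ℕ × ℕ) : Memory :=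
  ((m.write 5 0 s.1).write 5 1 s.2.1).write 5 2 s.2.2

theorem Memory.withPow_apply (m : Memory) (s : ℕ × ℕ × ℕ) (a i : ℕ) : m.withPow s a i =
    if a = 5 ∧ i = 2 then s.2.2 else if a = 5 ∧ i = 1 then s.2.1 else
      if a = 5 ∧ i = 0 then s.1 else m a i := by
  simp only [Memory.withPow, Memory.write_apply]

theorem Memory.withPow_size_le {m : Memory} {n : ℕ} (hm : ∀ a i, (m a i).size ≤ n)
    {s : ℕ × ℕ × ℕ} (h0 : s.1.size ≤ n) (h1 : s.2.1.size ≤ n) (h2 : s.2.2.size ≤ n) (a i : ℕ) :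
    (m.withPow s a i).size ≤ n := by
  rw [Memory.withPow_apply]
  split_ifs
  · exact h2
  · exact h1
  · exact h0
  · exact hm a i

theorem Prog.Det.skip (m : Memory) : Prog.skip.Det m m 1 := ⟨1, le_rfl, fun _ _ _ _ => rfl⟩

/-- All numbers involved have size at most `n`, as they are bounded by the modulus. -/
theorem Prog.powStep_det {m : Memory} {n p : ℕ} {s : ℕ × ℕ × ℕ} (hp0 : 0 < p) (hpn : p.size ≤ n)
    (hm : ∀ a i, (m a i).size ≤ n) (hp : m 0 1 = p) (h0 : s.1 ≤ p) (h1 : s.2.1 ≤ p)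
    (h2 : s.2.2 ≤ p) :
    Prog.powStep.Det (m.withPow s) (m.withPow (_root_.powStep p s)) (200 * (n + 1)) := by
  obtain ⟨u, v, w⟩ := s
  simp only at h0 h1 h2
  have hmod : ∀ k, (k % p).size ≤ n := fun k => (Nat.size_le_size (Nat.mod_lt _ hp0).le).trans hpn
  have su := (Nat.size_le_size h0).trans hpn
  have sv := (Nat.size_le_size h1).trans hpn
  have sw := (Nat.size_le_size h2).trans hpn
  set u' := if w % 2 = 0 then u else u * v % p with hu'
  have su' : u'.size ≤ n := by rw [hu']; split_ifs; exacts [su, hmod _]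
  have r : ∀ s : ℕ × ℕ × ℕ, m.withPow s 5 0 = s.1 ∧ m.withPow s 5 1 = s.2.1 ∧
      m.withPow s 5 2 = s.2.2 ∧ m.withPow s 0 1 = p := fun s => by
    simp [Memory.withPow_apply, hp]
  have hs0 := Memory.withPow_size_le hm (s := (u, v, w)) su sv sw
  have hs1 := Memory.withPow_size_le hm (s := (u', v, w)) su' sv sw
  have hs2 := Memory.withPow_size_le hm (s := (u', v * v % p, w)) su' (hmod _) sw
  have h2s : (2 : ℕ).size = 2 := by decide
  have B1 : (Prog.ite (.op .mod (.read 5 (.const 2)) (.const 2))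
      (.assign 5 (.const 0)
        (.op .mod (.op .mul (.read 5 (.const 0)) (.read 5 (.const 1))) (.inp 0))) .skip).Det
      (m.withPow (u, v, w)) (m.withPow (u', v, w)) (80 * (n + 1)) := by
    have hc := RExpr.cost_le hs0
      (.op .mod (.op .mul (.read 5 (.const 0)) (.read 5 (.const 1))) (.inp 0))
    have hc' := RExpr.cost_le hs0 (.op .mod (.read 5 (.const 2)) (.const 2))
    refine (Prog.Det.ite (K := 40 * (n + 1)) (fun h => ?_) (fun h => ?_)).mono ?_
    · simp only [RExpr.eval, ArithOp.eval, (r _).2.2.1] at h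
      have := Prog.Det.assign 5 (.const 0)
        (.op .mod (.op .mul (.read 5 (.const 0)) (.read 5 (.const 1))) (.inp 0))
        (m.withPow (u, v, w))
      simp only [RExpr.inp, RExpr.eval, ArithOp.eval, (r _).1, (r _).2.1, (r _).2.2.2] at this
      have hmem : (m.withPow (u, v, w)).write 5 0 (u * v % p) = m.withPow (u', v, w) := by
        funext b i
        rw [Memory.write_apply, Memory.withPow_apply, Memory.withPow_apply, hu', if_neg h]
        by_cases hb : b = 5
        · rcases i with _ | _ | _ | i <;> simp [hb]
        · simp [hb]
      rw [hmem] at this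
      refine this.mono ?_
      simp only [RExpr.weight, RExpr.inp] at hc
      simp only [RExpr.cost, Nat.size_zero] at hc ⊢
      omega
    · simp only [RExpr.eval, ArithOp.eval, (r _).2.2.1] at h
      rw [hu', if_pos h]
      exact (Prog.Det.skip _).mono (by omega)
    · simp only [RExpr.weight] at hc'
      omega
  have B2 : (Prog.assign 5 (.const 1)
      (.op .mod (.op .mul (.read 5 (.const 1)) (.read 5 (.const 1))) (.inp 0))).Det
      (m.withPow (u', v, w)) (m.withPow (u', v * v % p, w)) (60 * (n + 1)) := by
    have this := Prog.Det.assign 5 (.const 1)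
      (.op .mod (.op .mul (.read 5 (.const 1)) (.read 5 (.const 1))) (.inp 0))
      (m.withPow (u', v, w))
    have hc := RExpr.cost_le hs1
      (.op .mod (.op .mul (.read 5 (.const 1)) (.read 5 (.const 1))) (.inp 0))
    simp only [RExpr.inp, RExpr.eval, ArithOp.eval, (r _).2.1, (r _).2.2.2] at this
    have hmem : (m.withPow (u', v, w)).write 5 1 (v * v % p) = m.withPow (u', v * v % p, w) := by
      funext b i
      rw [Memory.write_apply, Memory.withPow_apply, Memory.withPow_apply]
      by_cases hb : b = 5
      · rcases i with _ | _ | _ | i <;> simp [hb]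
      · simp [hb]
    rw [hmem] at this
    refine this.mono ?_
    simp only [RExpr.weight, RExpr.inp] at hc
    simp only [RExpr.cost, Nat.size_one] at hc ⊢
    omega
  have B3 : (Prog.assign 5 (.const 2) (.op .div (.read 5 (.const 2)) (.const 2))).Det
      (m.withPow (u', v * v % p, w)) (m.withPow (_root_.powStep p (u, v, w))) (60 * (n + 1)) := by
    have this := Prog.Det.assign 5 (.const 2) (.op .div (.read 5 (.const 2)) (.const 2))
      (m.withPow (u', v * v % p, w))
    have hc := RExpr.cost_le hs2 (.op .div (.read 5 (.const 2)) (.const 2))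
    simp only [RExpr.eval, ArithOp.eval, (r _).2.2.1] at this
    have hmem : (m.withPow (u', v * v % p, w)).write 5 2 (w / 2) =
        m.withPow (_root_.powStep p (u, v, w)) := by
      funext b i
      rw [Memory.write_apply, Memory.withPow_apply, Memory.withPow_apply]
      by_cases hb : b = 5
      · rcases i with _ | _ | _ | i <;> simp [hb, _root_.powStep, hu']
      · simp [hb]
    rw [hmem] at this
    refine this.mono ?_
    simp only [RExpr.weight] at hc
    simp only [RExpr.cost, h2s] at hc ⊢
    omega
  exact (B1.seq (B2.seq B3)).mono (by omega)

/-- The states of square-and-multiply stay below the modulus. -/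
theorem powStep_iterate_le {p : ℕ} (hp : 0 < p) (a k : ℕ) :
    let s := (powStep p)^[k] (1, a % p, p - 2)
    s.1 ≤ p ∧ s.2.1 ≤ p ∧ s.2.2 ≤ p := by
  induction k with
  | zero => exact ⟨hp, (Nat.mod_lt _ hp).le, Nat.sub_le _ _⟩
  | succ k ih =>
    rw [Function.iterate_succ_apply']
    obtain ⟨h1, h2, h3⟩ := ih
    refine ⟨?_, (Nat.mod_lt _ hp).le, (Nat.div_le_self _ _).trans h3⟩
    simp only [powStep]
    split_ifs
    · exact h1
    · exact (Nat.mod_lt _ hp).le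

/-- The run on an arbitrary input: its cost, and its result as an iterate of `powStep`. -/
theorem Prog.modInv_det (K lam : ℕ) (x : List ℕ) :
    ∃ m', (Prog.modInv K).Det (startMem lam x) m'
        ((1000 + 300 * K) * (lam + listSize x + 2) ^ 2) ∧
      (List.range (m' 3 0)).map (m' 2) = if x.getD 0 0 = 0 then [] else
        [((_root_.powStep (x.getD 0 0))^[K * (lam + 1)]
          (1, x.getD 1 0 % x.getD 0 0, x.getD 0 0 - 2)).1] := by
  set m := startMem lam x with hm
  set p := x.getD 0 0 with hp
  set a := x.getD 1 0 with ha
  set n := lam + listSize x with hn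
  have hlam : lam ≤ n := Nat.le_add_right _ _
  have hmsz : ∀ a i, (m a i).size ≤ n := startMem_size_le lam x
  have hm01 : m 0 1 = p := rfl
  have hm02 : m 0 2 = a := rfl
  have hm00 : m 0 0 = lam := rfl
  clear_value m p a n
  by_cases h0 : p = 0
  · refine ⟨m, (Prog.Det.ite (e := .inp 0) (K := 1) (fun h => (h (hm01.trans h0)).elim)
      (fun _ => Prog.Det.skip m)).mono ?_, ?_⟩
    · have := RExpr.cost_le hmsz (.inp 0)
      simp only [RExpr.inp, RExpr.weight] at this ⊢
      nlinarith
    · rw [if_pos h0, hm]; rfl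
  have hp0 : 0 < p := Nat.pos_of_ne_zero h0
  have hpn : p.size ≤ n := hm01 ▸ hmsz 0 1
  have h2s : (2 : ℕ).size = 2 := by decide
  set st : ℕ → ℕ × ℕ × ℕ := fun k => (_root_.powStep p)^[k] (1, a % p, p - 2) with hst
  have hle := powStep_iterate_le hp0 a
  have hMsz : ∀ k b i, (m.withPow (st k) b i).size ≤ n := fun k =>
    Memory.withPow_size_le hmsz ((Nat.size_le_size (hle k).1).trans hpn)
      ((Nat.size_le_size (hle k).2.1).trans hpn) ((Nat.size_le_size (hle k).2.2).trans hpn)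
  have hn1 : (1 : ℕ).size ≤ n + 1 := by simp
  set m1 := m.write 5 0 1 with hm1
  set m2 := m1.write 5 1 (a % p) with hm2
  have z1 : ∀ b i, (m1 b i).size ≤ n + 1 := by
    intro b i
    rw [hm1, Memory.write_apply]
    split_ifs
    · exact hn1
    · exact (hmsz b i).trans (by omega)
  have z2 : ∀ b i, (m2 b i).size ≤ n + 1 := by
    intro b i
    rw [hm2, Memory.write_apply]
    split_ifs
    · exact ((Nat.size_le_size (Nat.mod_lt _ hp0).le).trans hpn).trans (by omega)
    · exact z1 b i
  have e11 : m1 0 1 = p := by simp [hm1, Memory.write_apply, hm01]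
  have e12 : m1 0 2 = a := by simp [hm1, Memory.write_apply, hm02]
  have e21 : m2 0 1 = p := by simp [hm2, Memory.write_apply, e11]
  have A1 : (Prog.assign 5 (.const 0) (.const 1)).Det m m1 (20 * (n + 2)) := by
    refine (Prog.Det.assign 5 (.const 0) (.const 1) m).mono ?_
    simp [RExpr.cost]; omega
  have A2 : (Prog.assign 5 (.const 1) (.op .mod (.inp 1) (.inp 0))).Det m1 m2 (20 * (n + 2)) := by
    have this := Prog.Det.assign 5 (.const 1) (.op .mod (.inp 1) (.inp 0)) m1
    have hc := RExpr.cost_le z1 (.op .mod (.inp 1) (.inp 0))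
    simp only [RExpr.inp, RExpr.eval, e11, e12, ArithOp.eval] at this
    refine this.mono ?_
    simp only [RExpr.weight, RExpr.inp] at hc
    simp only [RExpr.cost, Nat.size_one] at hc ⊢
    omega
  have A3 : (Prog.assign 5 (.const 2) (.op .sub (.inp 0) (.const 2))).Det m2
      (m.withPow (st 0)) (20 * (n + 2)) := by
    have this := Prog.Det.assign 5 (.const 2) (.op .sub (.inp 0) (.const 2)) m2
    have hc := RExpr.cost_le z2 (.op .sub (.inp 0) (.const 2))
    simp only [RExpr.inp, RExpr.eval, e21, ArithOp.eval] at this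
    refine this.mono ?_
    simp only [RExpr.weight, RExpr.inp] at hc
    simp only [RExpr.cost, h2s] at hc ⊢
    omega
  have A4 := Prog.Det.loop (n := .op .mul (.const K) (.op .add (.read 0 (.const 0)) (.const 1)))
    (P := .powStep) (m := m.withPow (st 0)) (fun k => m.withPow (st k)) (K := 200 * (n + 1)) rfl
    (fun k _ => by
      have := Prog.powStep_det (m := m) (s := st k) hp0 hpn hmsz hm01 (hle k).1 (hle k).2.1
        (hle k).2.2
      have hs : st (k + 1) = _root_.powStep p (st k) := Function.iterate_succ_apply' _ _ _
      simpa only [hs] using this)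
  have hN : (RExpr.op .mul (.const K) (.op .add (.read 0 (.const 0)) (.const 1))).eval
      (m.withPow (st 0)) = K * (lam + 1) := by
    simp [RExpr.eval, ArithOp.eval, Memory.withPow_apply, hm00]
  rw [hN] at A4
  have r0 : ∀ k, m.withPow (st k) 5 0 = (st k).1 := fun k => by simp [Memory.withPow_apply]
  set N := K * (lam + 1) with hNdef
  have B1 := Prog.Det.assign 2 (.const 0) (.read 5 (.const 0)) (m.withPow (st N))
  have B2 := Prog.Det.assign 3 (.const 0) (.const 1)
    ((m.withPow (st N)).write 2 0 (st N).1)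
  simp only [RExpr.eval, r0] at B1 B2
  refine ⟨_, (Prog.Det.ite (e := .inp 0) (fun _ => A1.seq (A2.seq (A3.seq (A4.seq (B1.seq B2)))))
    (fun h => (h0 (hm01.symm.trans h)).elim)).mono ?_, ?_⟩
  · have c1 := RExpr.cost_le hmsz (.inp 0)
    have c2 := RExpr.cost_le (hMsz 0)
      (.op .mul (.const K) (.op .add (.read 0 (.const 0)) (.const 1)))
    have c3 := RExpr.cost_le (hMsz N) (.read 5 (.const 0))
    have c4 : N * (200 * (n + 1)) ≤ K * (n + 1) * (200 * (n + 1)) :=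
      Nat.mul_le_mul_right _ (Nat.mul_le_mul_left _ (by omega))
    generalize RExpr.cost (m.withPow (st 0)) _ = C2 at *
    generalize RExpr.cost (m.withPow (st N)) (.read 5 (.const 0)) = C3 at *
    generalize RExpr.cost m (.inp 0) = C1 at *
    simp only [RExpr.weight, RExpr.inp] at c1 c2 c3
    simp only [RExpr.cost, Nat.size_zero, Nat.size_one]
    generalize N * (200 * (n + 1)) = C4 at *
    nlinarith
  · rw [if_neg h0]
    simp [Memory.write_apply, List.range_one]
    rfl

theorem Prog.modInv_polyTime (K : ℕ) (U : Finset ℕ) : (Prog.modInv K).PolyTime U := by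
  refine Prog.polyTime_of_det (Polynomial.C (1000 + 300 * K) * (Polynomial.X + 2) ^ 2)
    (fun lam x => ?_) U
  obtain ⟨m', hd, ho⟩ := Prog.modInv_det K lam x
  refine ⟨m', by simpa only [Polynomial.eval_mul, Polynomial.eval_C, Polynomial.eval_pow,
    Polynomial.eval_add, Polynomial.eval_X, Polynomial.eval_ofNat] using hd, ?_⟩
  rw [ho]
  simp only [Polynomial.eval_mul, Polynomial.eval_C, Polynomial.eval_pow,
    Polynomial.eval_add, Polynomial.eval_X, Polynomial.eval_ofNat]
  split_ifs with h0
  · simp [listSize_nil]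
  · rw [listSize_cons, listSize_nil]
    have h1 := Nat.size_le_size
      (powStep_iterate_le (Nat.pos_of_ne_zero h0) (x.getD 1 0) (K * (lam + 1))).1
    have h2 := size_getD_le x 0
    have h3 := Nat.le_self_pow two_ne_zero (lam + listSize x + 2)
    have h4 := Nat.mul_le_mul_right ((lam + listSize x + 2) ^ 2)
      (show 1 ≤ 1000 + 300 * K by omega)
    omega

/-- The invariant of square-and-multiply. -/
theorem powStep_cast {p : ℕ} (s : ℕ × ℕ × ℕ) :
    ((powStep p s).1 : ZMod p) * ((powStep p s).2.1 : ZMod p) ^ (powStep p s).2.2 =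
      (s.1 : ZMod p) * (s.2.1 : ZMod p) ^ s.2.2 := by
  obtain ⟨u, v, w⟩ := s
  have hw := Nat.div_add_mod w 2
  have h2 : w % 2 < 2 := Nat.mod_lt _ (by norm_num)
  simp only [powStep]
  rw [ZMod.natCast_mod, Nat.cast_mul, ← pow_two, ← pow_mul]
  split_ifs with h
  · rw [show 2 * (w / 2) = w by omega]
  · rw [ZMod.natCast_mod, Nat.cast_mul, mul_assoc, ← pow_succ',
      show 2 * (w / 2) + 1 = w by omega]

/-- By Fermat, `a⁻¹ = a ^ (p - 2)`; the `K * (lam + 1)` halvings bring the exponent to zero, as it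
is less than `2 ^ (K * (lam + 1))`. -/
theorem Prog.modInv_run {K lam p : ℕ} [Fact p.Prime] (hp : 3 < p) (hK : p ≤ 2 ^ (K * (lam + 1)))
    (a : ZMod p) (ha : a ≠ 0) (U : Finset ℕ) :
    (Prog.modInv K).run U lam [p, a.val] = pure [a⁻¹.val] := by
  obtain ⟨m', hd, ho⟩ := Prog.modInv_det K lam [p, a.val]
  refine Prog.run_of_det hd (ho.trans ?_) U
  simp only [List.getD_cons_zero, List.getD_cons_succ]
  rw [if_neg (by omega)]
  set N := K * (lam + 1) with hN
  have hmod : a.val % p = a.val := Nat.mod_eq_of_lt (ZMod.val_lt a)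
  rw [hmod]
  set st : ℕ → ℕ × ℕ × ℕ := fun k => (_root_.powStep p)^[k] (1, a.val, p - 2) with hst
  have hsucc : ∀ k, st (k + 1) = _root_.powStep p (st k) := fun k =>
    Function.iterate_succ_apply' _ _ _
  have hinv : ∀ k, ((st k).1 : ZMod p) * ((st k).2.1 : ZMod p) ^ (st k).2.2 = a⁻¹ := by
    intro k
    induction k with
    | zero =>
      show ((1 : ℕ) : ZMod p) * ((a.val : ℕ) : ZMod p) ^ (p - 2) = _
      rw [Nat.cast_one, one_mul, ZMod.natCast_zmod_val]
      refine eq_inv_of_mul_eq_one_left ?_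
      rw [← pow_succ, show p - 2 + 1 = p - 1 by omega]
      exact ZMod.pow_card_sub_one_eq_one ha
    | succ k ih => rw [hsucc, powStep_cast, ih]
  have hexp : ∀ k, (st k).2.2 = (p - 2) / 2 ^ k := by
    intro k
    induction k with
    | zero => simp [hst]
    | succ k ih =>
      rw [hsucc, _root_.powStep, ih, pow_succ, ← Nat.div_div_eq_div_mul]
  have hlt : ∀ k, (st k).1 < p := by
    intro k
    induction k with
    | zero => show 1 < p; omega
    | succ k ih =>
      rw [hsucc, _root_.powStep]
      simp only
      split_ifs
      · exact ih
      · exact Nat.mod_lt _ (by omega)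
  have hz : (st N).2.2 = 0 := by
    rw [hexp]; exact Nat.div_eq_of_lt (by omega)
  have := hinv N
  rw [hz, pow_zero, mul_one] at this
  rw [← this, ZMod.val_natCast, Nat.mod_eq_of_lt (hlt N)]

/-! ### Straight-line programs with group operations -/

/-- Feed the values of expressions to `P`. -/
def Prog.callOn (es : List RExpr) (P : Prog) : Prog := (Prog.exprs es).comp P

/-- Run `P` and put its output in front of the input for `Q`. -/
def Prog.letIn (P Q : Prog) : Prog := (P.pair (Prog.tail 0)).comp Q

theorem OracleComp.lift_map_bind {lam : ℕ} {α β γ : Type} (p : PMF α) (f : α → β)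
    (g : β → OracleComp lam γ) :
    OracleComp.lift (f <$> p) >>= g = OracleComp.lift p >>= fun a => g (f a) := by
  funext T
  show (f <$> p >>= fun a => pure (a, T)) >>= _ = (p >>= fun a => pure (a, T)) >>= _
  simp only [bind_map_left, bind_assoc, LawfulMonad.pure_bind]

theorem OracleComp.lift_bind_congr {lam : ℕ} {α γ : Type} {p : PMF α} {f g : α → OracleComp lam γ}
    (h : ∀ a ∈ p.support, f a = g a) : OracleComp.lift p >>= f = OracleComp.lift p >>= g := by
  funext T
  show (p >>= fun a => pure (a, T)) >>= (fun q => f q.1 q.2) =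
    (p >>= fun a => pure (a, T)) >>= (fun q => g q.1 q.2)
  simp only [bind_assoc, LawfulMonad.pure_bind]
  exact PMF.bind_congr_support fun a ha => by rw [h a ha]

theorem Prog.callOn_run {es : List RExpr} (hes : ∀ e ∈ es, e.InputOnly) (P : Prog) (U : Finset ℕ)
    (lam : ℕ) (x : List ℕ) :
    (Prog.callOn es P).run U lam x = P.run U lam (es.map (RExpr.onInput lam x)) := by
  rw [Prog.callOn, Prog.comp_run, Prog.exprs_run hes, LawfulMonad.pure_bind]

theorem Prog.PolyTime.callOn {es : List RExpr} (hes : ∀ e ∈ es, e.InputOnly) {P : Prog}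
    {U : Finset ℕ} (hP : P.PolyTime U) : (Prog.callOn es P).PolyTime U :=
  (Prog.exprs_polyTime hes U).comp hP

theorem Prog.ProgramFree.callOn (es : List RExpr) {P : Prog} (hP : P.ProgramFree) :
    (Prog.callOn es P).ProgramFree := (Prog.exprs_programFree es).comp hP

theorem Prog.letIn_run (P Q : Prog) (U : Finset ℕ) (lam : ℕ) (x : List ℕ) :
    (P.letIn Q).run U lam x = P.run U lam x >>= fun y => Q.run U lam (y ++ x) := by
  simp only [Prog.letIn, Prog.comp_run, Prog.pair_run, Prog.tail_run, LawfulMonad.pure_bind,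
    bind_assoc, List.drop_zero]

theorem Prog.letIn_run_of_pure {P : Prog} {U : Finset ℕ} {lam : ℕ} {x y : List ℕ}
    (h : P.run U lam x = pure y) (Q : Prog) :
    (P.letIn Q).run U lam x = Q.run U lam (y ++ x) := by
  rw [Prog.letIn_run, h, LawfulMonad.pure_bind]

theorem Prog.PolyTime.letIn {U : Finset ℕ} {P Q : Prog} (hP : P.PolyTime U) (hQ : Q.PolyTime U) :
    (P.letIn Q).PolyTime U := (hP.pair (Prog.tail_polyTime 0 U)).comp hQ

theorem Prog.ProgramFree.letIn {P Q : Prog} (hP : P.ProgramFree) (hQ : Q.ProgramFree) :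
    (P.letIn Q).ProgramFree := (hP.pair (Prog.tail_programFree 0)).comp hQ

theorem inputOnly_inp (j : ℕ) : (RExpr.inp j).InputOnly := ⟨rfl, trivial⟩

theorem inputOnly_const (n : ℕ) : (RExpr.const n).InputOnly := trivial

theorem inputOnly_op {o : ArithOp} {e f : RExpr} (he : e.InputOnly) (hf : f.InputOnly) :
    (RExpr.op o e f).InputOnly := ⟨he, hf⟩

namespace GroupFamily

variable (F : GroupFamily)

/-- Scalar multiplication `k • X`. -/
def smulOn (d p k X : RExpr) : Prog := Prog.callOn [d, p, k, X] F.smulProg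

/-- Addition `X + Y`. -/
def addOn (d p X Y : RExpr) : Prog := Prog.callOn [d, p, X, Y] F.addProg

variable {F}

theorem smulOn_run {d p k X : RExpr} (hd : d.InputOnly) (hp : p.InputOnly) (hk : k.InputOnly)
    (hX : X.InputOnly) {lam : ℕ} {x : List ℕ} {n : ℕ} {Z : F.G lam}
    (vd : d.onInput lam x = F.desc lam) (vp : p.onInput lam x = F.p lam)
    (vk : k.onInput lam x = n) (vX : X.onInput lam x = F.enc lam Z) (U : Finset ℕ) :
    (F.smulOn d p k X).run U lam x = pure [F.enc lam (n • Z)] := by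
  rw [smulOn, Prog.callOn_run (by simp [hd, hp, hk, hX]),
    F.smulProg.run_oracleFree U ∅ F.smulProg_free]
  simp only [List.map_cons, List.map_nil, vd, vp, vk, vX]
  exact F.smulProg_run lam n Z

theorem addOn_run {d p X Y : RExpr} (hd : d.InputOnly) (hp : p.InputOnly) (hX : X.InputOnly)
    (hY : Y.InputOnly) {lam : ℕ} {x : List ℕ} {V W : F.G lam}
    (vd : d.onInput lam x = F.desc lam) (vp : p.onInput lam x = F.p lam)
    (vX : X.onInput lam x = F.enc lam V) (vY : Y.onInput lam x = F.enc lam W) (U : Finset ℕ) :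
    (F.addOn d p X Y).run U lam x = pure [F.enc lam (V + W)] := by
  rw [addOn, Prog.callOn_run (by simp [hd, hp, hX, hY]),
    F.addProg.run_oracleFree U ∅ F.addProg_free]
  simp only [List.map_cons, List.map_nil, vd, vp, vX, vY]
  exact F.addProg_run lam V W

variable (F)

theorem smulOn_polyTime {d p k X : RExpr} (hd : d.InputOnly) (hp : p.InputOnly)
    (hk : k.InputOnly) (hX : X.InputOnly) (U : Finset ℕ) : (F.smulOn d p k X).PolyTime U :=
  Prog.PolyTime.callOn (by simp [hd, hp, hk, hX])
    (F.smulProg_polyTime.of_oracleFree U F.smulProg_free)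

theorem addOn_polyTime {d p X Y : RExpr} (hd : d.InputOnly) (hp : p.InputOnly)
    (hX : X.InputOnly) (hY : Y.InputOnly) (U : Finset ℕ) : (F.addOn d p X Y).PolyTime U :=
  Prog.PolyTime.callOn (by simp [hd, hp, hX, hY])
    (F.addProg_polyTime.of_oracleFree U F.addProg_free)

theorem smulOn_programFree (d p k X : RExpr) : (F.smulOn d p k X).ProgramFree :=
  F.smulProg_free.programFree.callOn _

theorem addOn_programFree (d p X Y : RExpr) : (F.addOn d p X Y).ProgramFree :=
  F.addProg_free.programFree.callOn _

end GroupFamily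

open RExpr (inp)

namespace GroupFamily

variable (F : GroupFamily)

/-- On input `pp, A, B, ν` followed by `π`, run `D` on the tuple `pp, C, (M, B), (ν, υ, π)` with
`M = ν A`, `υ = (ν + 1) A` and `C = M + B`. -/
def tagTuple (D : Prog) : Prog :=
  (F.smulOn (inp 0) (inp 1) (inp 6) (inp 4)).letIn <|
  (F.smulOn (inp 1) (inp 2) (.op .add (inp 7) (.const 1)) (inp 5)).letIn <|
  (F.addOn (inp 2) (inp 3) (inp 1) (inp 7)).letIn <|
  ((Prog.exprs [inp 3, inp 4, inp 5, inp 6, inp 0, .const 1, inp 2, inp 8, inp 9, inp 1]).pair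
    (Prog.tail 10)).comp D

/-- Draw `ν` uniformly among the scalars other than `0` and `-1`, and pass `pp, A, B, ν, π` on to
`Q`, the input being `pp, A, B` followed by `π`. -/
def _root_.Prog.sampleNu (Q : Prog) : Prog :=
  (Prog.sample (.op .sub (inp 1) (.const 2))).letIn <|
  ((Prog.exprs [inp 1, inp 2, inp 3, inp 4, inp 5, inp 6, .op .add (inp 0) (.const 1)]).pair
    (Prog.tail 7)).comp Q

/-- On input `pp, A, B, ν`, simulate a proof for `(A, B)` and run `D` on the resulting tuple. -/
def simTuple (Sim D : Prog) : Prog :=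
  ((Prog.tail 0).pair (Prog.callOn [inp 0, inp 1, inp 2, inp 3, inp 4, inp 5] Sim)).comp
    (F.tagTuple D)

/-- The tuple is laid out as the input of a distinguisher in the games of tag simulation. -/
theorem tagTuple_run (D : Prog) (U : Finset ℕ) {lam : ℕ} (h A B : F.G lam) (n : ℕ)
    (π : List ℕ) :
    (F.tagTuple D).run U lam (F.encPP h ++ [F.enc lam A, F.enc lam B, n] ++ π) =
      D.run U lam (F.encPP h ++ [F.enc lam (n • A + B)] ++
        [1, F.enc lam (n • A), F.enc lam B] ++ ([n, F.enc lam ((n + 1) • A)] ++ π)) := by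
  rw [tagTuple, Prog.letIn_run_of_pure (smulOn_run (n := n) (Z := A) (inputOnly_inp _)
    (inputOnly_inp _) (inputOnly_inp _) (inputOnly_inp _) rfl rfl rfl rfl U),
    Prog.letIn_run_of_pure (smulOn_run (n := n + 1) (Z := A) (inputOnly_inp _)
    (inputOnly_inp _) (inputOnly_op (inputOnly_inp _) (inputOnly_const _)) (inputOnly_inp _)
    rfl rfl rfl rfl U),
    Prog.letIn_run_of_pure (addOn_run (V := n • A) (W := B) (inputOnly_inp _)
    (inputOnly_inp _) (inputOnly_inp _) (inputOnly_inp _) rfl rfl rfl rfl U),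
    Prog.comp_run, Prog.pair_run, Prog.exprs_run (by simp [inputOnly_inp, RExpr.InputOnly]),
    LawfulMonad.pure_bind, Prog.tail_run, LawfulMonad.pure_bind, LawfulMonad.pure_bind]
  rfl

theorem tagTuple_polyTime {D : Prog} {U : Finset ℕ} (hD : D.PolyTime U) :
    (F.tagTuple D).PolyTime U :=
  (F.smulOn_polyTime (inputOnly_inp _) (inputOnly_inp _) (inputOnly_inp _) (inputOnly_inp _)
    U).letIn <|
  (F.smulOn_polyTime (inputOnly_inp _) (inputOnly_inp _)
    (inputOnly_op (inputOnly_inp _) (inputOnly_const _)) (inputOnly_inp _) U).letIn <|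
  (F.addOn_polyTime (inputOnly_inp _) (inputOnly_inp _) (inputOnly_inp _) (inputOnly_inp _)
    U).letIn <|
  ((Prog.exprs_polyTime (by simp [inputOnly_inp, RExpr.InputOnly]) U).pair
    (Prog.tail_polyTime 10 U)).comp hD

theorem tagTuple_programFree {D : Prog} (hD : D.ProgramFree) : (F.tagTuple D).ProgramFree :=
  (F.smulOn_programFree _ _ _ _).letIn <| (F.smulOn_programFree _ _ _ _).letIn <|
  (F.addOn_programFree _ _ _ _).letIn <|
  ((Prog.exprs_programFree _).pair (Prog.tail_programFree 10)).comp hD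

theorem simTuple_run (Sim D : Prog) (U : Finset ℕ) {lam : ℕ} (h A B : F.G lam) (n : ℕ) :
    (F.simTuple Sim D).run U lam (F.encPP h ++ [F.enc lam A, F.enc lam B, n]) =
      Sim.run U lam (F.encPP h ++ [F.enc lam A, F.enc lam B]) >>= fun π =>
        (F.tagTuple D).run U lam (F.encPP h ++ [F.enc lam A, F.enc lam B, n] ++ π) := by
  rw [simTuple, Prog.comp_run, Prog.pair_run, Prog.tail_run, LawfulMonad.pure_bind,
    Prog.callOn_run (by simp [inputOnly_inp])]
  simp only [bind_assoc, LawfulMonad.pure_bind]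
  rfl

theorem simTuple_polyTime {Sim D : Prog} {U : Finset ℕ} (hS : Sim.PolyTime U)
    (hD : D.PolyTime U) : (F.simTuple Sim D).PolyTime U :=
  ((Prog.tail_polyTime 0 U).pair (hS.callOn (by simp [inputOnly_inp]))).comp
    (F.tagTuple_polyTime hD)

theorem map_uniformOfFintype_equiv {α β : Type} [Fintype α] [Fintype β] [Nonempty α] [Nonempty β]
    (e : α ≃ β) : (PMF.uniformOfFintype α).map e = PMF.uniformOfFintype β := by
  refine PMF.ext fun b => ?_
  rw [PMF.map_apply, tsum_eq_single (e.symm b)]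
  · simp [Fintype.card_congr e]
  · intro a ha
    rw [if_neg]
    rintro rfl
    simp at ha

theorem ne_of_mem_support_sampleAvoiding {lam : ℕ} {a ν : F.Scalar lam}
    (h : ν ∈ (F.sampleAvoiding lam a).support) : ν ≠ 0 ∧ ν ≠ a := by
  obtain ⟨k, -, rfl⟩ := (PMF.mem_support_map_iff _ _ _).1 h
  exact k.2

/-- The numbers `1, ..., p - 2` represent the scalars other than `0` and `-1`. -/
theorem val_sampleAvoiding_neg_one (lam : ℕ) :
    ZMod.val <$> F.sampleAvoiding lam (-1) = (· + 1) <$> uniformNat (F.p lam - 2) := by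
  have hp := F.three_lt lam
  have := F.exists_scalar (lam := lam) (-1)
  have hneg : (-1 : ZMod (F.p lam)).val = F.p lam - 1 := by
    have h1 : (-1 : ZMod (F.p lam)) = ((F.p lam - 1 : ℕ) : ZMod (F.p lam)) := by
      rw [Nat.cast_sub (by omega)]; simp
    rw [h1, ZMod.val_natCast, Nat.mod_eq_of_lt (by omega)]
  set p := F.p lam with hpdef
  have hval : ∀ v : Fin (p - 2 - 1 + 1), (((v.val + 1 : ℕ) : ZMod p)).val = v.val + 1 := fun v => by
    rw [ZMod.val_natCast, Nat.mod_eq_of_lt]; have := v.2; omega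
  let e : Fin (p - 2 - 1 + 1) ≃ {k : F.Scalar lam // k ≠ 0 ∧ k ≠ -1} :=
    { toFun := fun v => ⟨((v.val + 1 : ℕ) : ZMod p), by
        constructor
        · intro h0
          have h1 := congrArg ZMod.val h0
          rw [hval, ZMod.val_zero] at h1
          omega
        · intro h0
          have h1 := congrArg ZMod.val h0
          rw [hval, hneg] at h1
          have := v.2; omega⟩
      invFun := fun k => ⟨k.1.val - 1, by
        have h1 : k.1.val < p := ZMod.val_lt k.1
        have h2 : k.1.val ≠ p - 1 := fun h => k.2.2 (ZMod.val_injective p (h.trans hneg.symm))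
        omega⟩
      left_inv := fun v => by
        apply Fin.ext
        show (((v.val + 1 : ℕ) : ZMod p)).val - 1 = v.val
        rw [hval]; omega
      right_inv := fun k => by
        apply Subtype.ext
        have h1 : k.1.val ≠ 0 := fun h => k.2.1 ((ZMod.val_eq_zero k.1).1 h)
        show (((k.1.val - 1 + 1 : ℕ) : ZMod p)) = k.1
        rw [show k.1.val - 1 + 1 = k.1.val by omega]
        exact ZMod.natCast_zmod_val k.1 }
  rw [sampleAvoiding, ← map_uniformOfFintype_equiv e]
  show ((_ : PMF _).map _).map _ = ((_ : PMF _).map _).map _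
  rw [PMF.map_comp, PMF.map_comp, PMF.map_comp]
  congr 1
  funext v
  exact hval v

theorem sampleNu_run (Q : Prog) (U : Finset ℕ) {lam : ℕ} (h A B : F.G lam) (π : List ℕ) :
    Q.sampleNu.run U lam (F.encPP h ++ [F.enc lam A, F.enc lam B] ++ π) =
      OracleComp.lift (F.sampleAvoiding lam (-1)) >>= fun ν =>
        Q.run U lam (F.encPP h ++ [F.enc lam A, F.enc lam B, ν.val] ++ π) := by
  rw [← OracleComp.lift_map_bind (F.sampleAvoiding lam (-1)) ZMod.val (fun n =>
    Q.run U lam (F.encPP h ++ [F.enc lam A, F.enc lam B, n] ++ π)), val_sampleAvoiding_neg_one,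
    OracleComp.lift_map_bind, Prog.sampleNu, Prog.letIn_run, Prog.sample_run]
  simp only [bind_assoc, LawfulMonad.pure_bind]
  refine bind_congr fun v => ?_
  rw [Prog.comp_run, Prog.pair_run, Prog.exprs_run (by simp [inputOnly_inp, RExpr.InputOnly]),
    LawfulMonad.pure_bind, Prog.tail_run, LawfulMonad.pure_bind, LawfulMonad.pure_bind]
  rfl

theorem _root_.Prog.PolyTime.sampleNu {Q : Prog} {U : Finset ℕ} (hQ : Q.PolyTime U) :
    Q.sampleNu.PolyTime U :=
  (Prog.sample_polyTime _ U).letIn <|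
  ((Prog.exprs_polyTime (by simp [inputOnly_inp, RExpr.InputOnly]) U).pair
    (Prog.tail_polyTime 7 U)).comp hQ

theorem _root_.Prog.ProgramFree.sampleNu {Q : Prog} (hQ : Q.ProgramFree) : Q.sampleNu.ProgramFree :=
  (Prog.sample_programFree _).letIn <|
  ((Prog.exprs_programFree _).pair (Prog.tail_programFree 7)).comp hQ

/-- The bit length of the group order is bounded by a linear function of the security parameter; the
sum takes care of the finitely many exceptions to the asymptotic bound. -/
theorem exists_p_le : ∃ K : ℕ, ∀ lam, F.p lam ≤ 2 ^ (K * (lam + 1)) := by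
  obtain ⟨c, hc⟩ := F.size_theta.1.bound
  obtain ⟨N, hN⟩ := eventually_atTop.1 hc
  refine ⟨⌈c⌉₊ + ∑ i ∈ Finset.range N, Nat.clog 2 (F.p i), fun lam => ?_⟩
  have key : Nat.clog 2 (F.p lam) ≤
      (⌈c⌉₊ + ∑ i ∈ Finset.range N, Nat.clog 2 (F.p i)) * (lam + 1) := by
    rcases lt_or_ge lam N with h | h
    · have h1 : Nat.clog 2 (F.p lam) ≤ ∑ i ∈ Finset.range N, Nat.clog 2 (F.p i) :=
        Finset.single_le_sum (f := fun i => Nat.clog 2 (F.p i)) (fun _ _ => Nat.zero_le _)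
          (Finset.mem_range.2 h)
      nlinarith
    · have h1 := hN lam h
      simp only [Real.norm_natCast] at h1
      have h2 : (Nat.clog 2 (F.p lam) : ℝ) ≤ ((⌈c⌉₊ * lam : ℕ) : ℝ) := by
        push_cast
        exact h1.trans (mul_le_mul_of_nonneg_right (Nat.le_ceil c) (Nat.cast_nonneg _))
      have h3 : Nat.clog 2 (F.p lam) ≤ ⌈c⌉₊ * lam := by exact_mod_cast h2
      exact h3.trans (Nat.mul_le_mul (Nat.le_add_right _ _) (Nat.le_succ _))
  exact (Nat.le_pow_clog (by norm_num) _).trans (Nat.pow_le_pow_right (by norm_num) key)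

/-! ### The scalar action -/

theorem card_nsmul {lam : ℕ} (X : F.G lam) : F.p lam • X = 0 := by
  rw [← F.card lam]; exact card_nsmul_eq_zero'

/-- Scalars act through any of their representatives. -/
theorem natCast_act {lam : ℕ} (n : ℕ) (X : F.G lam) : F.act (n : F.Scalar lam) X = n • X := by
  rw [act, ZMod.val_natCast]
  conv_rhs => rw [← Nat.div_add_mod n (F.p lam), add_nsmul, mul_nsmul, card_nsmul, smul_zero,
    zero_add]

theorem act_add {lam : ℕ} (a b : F.Scalar lam) (X : F.G lam) :
    F.act (a + b) X = F.act a X + F.act b X := by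
  conv_lhs => rw [← ZMod.natCast_zmod_val a, ← ZMod.natCast_zmod_val b, ← Nat.cast_add,
    natCast_act, add_nsmul]
  rfl

theorem act_mul {lam : ℕ} (a b : F.Scalar lam) (X : F.G lam) :
    F.act (a * b) X = F.act a (F.act b X) := by
  conv_lhs => rw [← ZMod.natCast_zmod_val a, ← ZMod.natCast_zmod_val b, ← Nat.cast_mul,
    natCast_act, mul_comm, mul_nsmul]
  rfl

@[simp] theorem act_one {lam : ℕ} (X : F.G lam) : F.act 1 X = X := by
  rw [← Nat.cast_one, natCast_act, one_nsmul]

theorem act_ne_zero {lam : ℕ} {a : F.Scalar lam} {X : F.G lam} (ha : a ≠ 0) (hX : X ≠ 0) :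
    F.act a X ≠ 0 := by
  intro h
  apply hX
  rw [← act_one F X, ← inv_mul_cancel₀ ha, act_mul, h, act, smul_zero]

theorem act_injective {lam : ℕ} {X : F.G lam} (hX : X ≠ 0) :
    Function.Injective fun a : F.Scalar lam => F.act a X := by
  intro a b hab
  by_contra hne
  have h : F.act (a - b) X + F.act b X = F.act b X := by
    rw [← act_add, sub_add_cancel]; exact hab
  exact act_ne_zero F (sub_ne_zero.2 hne) hX (by simpa using h)

end GroupFamily

/-! ### The tag simulator as a program -/

namespace GroupFamily

variable (F : GroupFamily)

/-- The part of the tag simulator that handles an opening: on input `pp, C, 1, M, R` draw `ν`,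
compute `k = ν⁻¹`, `υ = (k + 1) M`, `A = k M` and `B = C - M`, and simulate a proof for `(A, B)`. -/
def simCertOpened (K : ℕ) (Sim : Prog) : Prog :=
  (Prog.sample (.op .sub (inp 1) (.const 2))).letIn <|
  (Prog.callOn [inp 2, .op .add (inp 0) (.const 1)] (Prog.modInv K)).letIn <|
  (F.smulOn (inp 2) (inp 3) (.op .add (inp 0) (.const 1)) (inp 8)).letIn <|
  (F.smulOn (inp 3) (inp 4) (inp 1) (inp 9)).letIn <|
  (F.smulOn (inp 4) (inp 5) (.op .sub (inp 5) (.const 1)) (inp 10)).letIn <|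
  (F.addOn (inp 5) (inp 6) (inp 9) (inp 0)).letIn <|
  (Prog.exprs [.op .add (inp 5) (.const 1), inp 3]).pair
    (Prog.callOn [inp 6, inp 7, inp 8, inp 9, inp 2, inp 0] Sim)

/-- The tag simulator; the trivial tag is `(0, 0)` with the empty proof. -/
def simCertProg (K : ℕ) (Sim : Prog) : Prog :=
  .ite (inp 5) (F.simCertOpened K Sim)
    ((Prog.exprs [.const 0]).pair (F.smulOn (inp 0) (inp 1) (.const 0) (inp 4)))

theorem simCertProg_polyTime (K : ℕ) {Sim : Prog} {U : Finset ℕ} (hS : Sim.PolyTime U) :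
    (F.simCertProg K Sim).PolyTime U := by
  refine Prog.PolyTime.ite _ ?_ ((Prog.exprs_polyTime (by simp [RExpr.InputOnly]) U).pair
    (F.smulOn_polyTime (inputOnly_inp _) (inputOnly_inp _) (inputOnly_const _) (inputOnly_inp _) U))
  exact (Prog.sample_polyTime _ U).letIn <|
    ((Prog.modInv_polyTime K U).callOn (by simp [inputOnly_inp, RExpr.InputOnly])).letIn <|
    (F.smulOn_polyTime (inputOnly_inp _) (inputOnly_inp _)
      (inputOnly_op (inputOnly_inp _) (inputOnly_const _)) (inputOnly_inp _) U).letIn <|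
    (F.smulOn_polyTime (inputOnly_inp _) (inputOnly_inp _) (inputOnly_inp _)
      (inputOnly_inp _) U).letIn <|
    (F.smulOn_polyTime (inputOnly_inp _) (inputOnly_inp _)
      (inputOnly_op (inputOnly_inp _) (inputOnly_const _)) (inputOnly_inp _) U).letIn <|
    (F.addOn_polyTime (inputOnly_inp _) (inputOnly_inp _) (inputOnly_inp _)
      (inputOnly_inp _) U).letIn <|
    (Prog.exprs_polyTime (by simp [inputOnly_inp, RExpr.InputOnly]) U).pair
      (hS.callOn (by simp [inputOnly_inp]))

/-- The machine computes the tag simulator, including the trivial tag on a failed opening. -/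
theorem simCertProg_run {K : ℕ} (hK : ∀ lam, F.p lam ≤ 2 ^ (K * (lam + 1))) (Φ : FischlinSetup F)
    (Sim : Prog) {lam : ℕ} (h C : F.G lam) (o : Option (F.G lam × F.G lam)) :
    (F.simCertProg K Sim).run Φ.programmable lam
        (F.encPP h ++ [F.enc lam C] ++ USV.encOpening o) =
      USV.encTag <$> USV.simCert Φ Sim h C o := by
  set U := Φ.programmable with hU
  -- The encoding of a failed opening starts with `0`, that of an opening with `1`; the group
  -- element `0` of the trivial tag is obtained as `0 • C`.
  rcases o with _ | ⟨M, R⟩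
  · rw [simCertProg, Prog.ite_run, if_neg (by simp [USV.encOpening, encPP]), Prog.pair_run,
      Prog.exprs_run (by simp [RExpr.InputOnly]), LawfulMonad.pure_bind,
      smulOn_run (n := 0) (Z := C) (inputOnly_inp _) (inputOnly_inp _) (inputOnly_const _)
        (inputOnly_inp _) rfl rfl rfl rfl U, LawfulMonad.pure_bind]
    simp [USV.simCert, USV.encTag]
  · rw [simCertProg, Prog.ite_run, if_pos (by simp [USV.encOpening, encPP])]
    have hsim : USV.simCert Φ Sim h C (some (M, R)) =
        OracleComp.lift (F.sampleAvoiding lam (-1)) >>= fun nu =>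
          Φ.simProof Sim h (F.act (1 + nu⁻¹) M - M) (C - M) >>= fun π =>
            pure ⟨nu, F.act (1 + nu⁻¹) M, π⟩ := rfl
    -- The machine draws `ν - 1` from `{0, ..., p - 3}`.
    have huni : uniformNat (F.p lam - 2) =
        (fun ν : F.Scalar lam => ν.val - 1) <$> F.sampleAvoiding lam (-1) := by
      have := congrArg (fun q => (fun n => n - 1) <$> q) (F.val_sampleAvoiding_neg_one lam)
      simp only [Functor.map_map, Nat.add_sub_cancel, id_map'] at this
      exact this.symm
    rw [hsim, simCertOpened, Prog.letIn_run, Prog.sample_run]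
    have hn : (RExpr.op .sub (inp 1) (.const 2)).onInput lam
        (F.encPP h ++ [F.enc lam C] ++ USV.encOpening (some (M, R))) = F.p lam - 2 := rfl
    rw [hn, huni, OracleComp.lift_map_bind]
    simp only [bind_assoc, LawfulMonad.pure_bind, _root_.map_bind]
    refine OracleComp.lift_bind_congr fun ν hν => ?_
    have hp := F.three_lt lam
    have hν0 : ν ≠ 0 := (F.ne_of_mem_support_sampleAvoiding hν).1
    have hν1 : ν.val - 1 + 1 = ν.val := by
      have : ν.val ≠ 0 := fun h0 => hν0 ((ZMod.val_eq_zero ν).1 h0)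
      omega
    have hinv : (Prog.callOn [inp 2, .op .add (inp 0) (.const 1)] (Prog.modInv K)).run U lam
        ([ν.val - 1] ++ (F.encPP h ++ [F.enc lam C] ++ USV.encOpening (some (M, R)))) =
          pure [ν⁻¹.val] := by
      rw [Prog.callOn_run (by simp [inputOnly_inp, RExpr.InputOnly])]
      have h1 : List.map (RExpr.onInput lam
          ([ν.val - 1] ++ (F.encPP h ++ [F.enc lam C] ++ USV.encOpening (some (M, R)))))
          [inp 2, .op .add (inp 0) (.const 1)] = [F.p lam, ν.val] := by
        show [F.p lam, ν.val - 1 + 1] = _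
        rw [hν1]
      rw [h1]
      exact Prog.modInv_run hp (hK lam) ν hν0 U
    have hu : (ν⁻¹.val + 1) • M = F.act (1 + ν⁻¹) M := by
      rw [add_comm (1 : F.Scalar lam), act_add, act_one, add_nsmul, one_nsmul]; rfl
    have hA : ν⁻¹.val • M = F.act (1 + ν⁻¹) M - M := by
      rw [← hu, add_nsmul, one_nsmul, add_sub_cancel_right]
    -- Subtraction of `M` is addition of `(p - 1) M`.
    have hB : C + (F.p lam - 1) • M = C - M := by
      have h1 : (F.p lam - 1) • M + M = 0 := by
        rw [← succ_nsmul, Nat.sub_add_cancel (by omega), card_nsmul]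
      rw [sub_eq_add_neg, eq_neg_of_add_eq_zero_left h1]
    rw [Prog.letIn_run_of_pure hinv,
      Prog.letIn_run_of_pure (smulOn_run (n := ν⁻¹.val + 1) (Z := M) (inputOnly_inp _)
        (inputOnly_inp _) (inputOnly_op (inputOnly_inp _) (inputOnly_const _)) (inputOnly_inp _)
        rfl rfl rfl rfl U),
      Prog.letIn_run_of_pure (smulOn_run (n := ν⁻¹.val) (Z := M) (inputOnly_inp _)
        (inputOnly_inp _) (inputOnly_inp _) (inputOnly_inp _) rfl rfl rfl rfl U),
      Prog.letIn_run_of_pure (smulOn_run (n := F.p lam - 1) (Z := M) (inputOnly_inp _)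
        (inputOnly_inp _) (inputOnly_op (inputOnly_inp _) (inputOnly_const _)) (inputOnly_inp _)
        rfl rfl rfl rfl U),
      Prog.letIn_run_of_pure (addOn_run (V := C) (W := (F.p lam - 1) • M) (inputOnly_inp _)
        (inputOnly_inp _) (inputOnly_inp _) (inputOnly_inp _) rfl rfl rfl rfl U),
      Prog.pair_run, Prog.exprs_run (by simp [inputOnly_inp, RExpr.InputOnly]),
      LawfulMonad.pure_bind, Prog.callOn_run (by simp [inputOnly_inp]), hu, hA, hB]
    simp only [LawfulApplicative.map_pure]
    have hout : ∀ z, List.map (RExpr.onInput lam ([F.enc lam (C - M)] ++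
        ([F.enc lam ((F.p lam - 1) • M)] ++ ([F.enc lam (F.act (1 + ν⁻¹) M - M)] ++
        ([F.enc lam (F.act (1 + ν⁻¹) M)] ++ ([ν⁻¹.val] ++ ([ν.val - 1] ++
        (F.encPP h ++ [F.enc lam C] ++ USV.encOpening (some (M, R))))))))))
        [.op .add (inp 5) (.const 1), inp 3] ++ z =
        USV.encTag (⟨ν, F.act (1 + ν⁻¹) M, z⟩ : USVTag F lam) := by
      intro z
      show [ν.val - 1 + 1, F.enc lam (F.act (1 + ν⁻¹) M)] ++ z = _
      rw [hν1]; rfl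
    simp only [hout]
    rfl

end GroupFamily

/-! ### Couplings -/

/-- `p` and `q` have a coupling that is supported in the relation `R`. -/
def Coupled {α β : Type} (R : α → β → Prop) (p : PMF α) (q : PMF β) : Prop :=
  ∃ w : PMF (α × β), Prod.fst <$> w = p ∧ Prod.snd <$> w = q ∧ ∀ ab ∈ w.support, R ab.1 ab.2

namespace Coupled

variable {α β γ δ : Type} {R : α → β → Prop} {S : γ → δ → Prop}

theorem pure {a : α} {b : β} (h : R a b) : Coupled R (pure a) (pure b) := by
  refine ⟨Pure.pure (a, b), by simp, by simp, fun ab hab => ?_⟩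
  obtain rfl := PMF.mem_support_pure.1 hab
  exact h

/-- The independent coupling, if all possible outcomes are related. -/
theorem of_forall (p : PMF α) (q : PMF β) (h : ∀ a ∈ p.support, ∀ b ∈ q.support, R a b) :
    Coupled R p q := by
  refine ⟨p >>= fun a => q >>= fun b => Pure.pure (a, b), ?_, ?_, fun ab hab => ?_⟩
  · simp only [_root_.map_bind, LawfulApplicative.map_pure]
    show p.bind (fun a => q.bind fun _ => PMF.pure a) = p
    simp [PMF.bind_const]
  · simp only [_root_.map_bind, LawfulApplicative.map_pure]
    show p.bind (fun a => q.bind fun b => PMF.pure b) = q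
    simp [PMF.bind_const]
  · obtain ⟨a, ha, hab⟩ := PMF.mem_support_bind.1 hab
    obtain ⟨b, hb, hab⟩ := PMF.mem_support_bind.1 hab
    obtain rfl := PMF.mem_support_pure.1 hab
    exact h a ha b hb

/-- Couplings compose: after a coupled first step, couple the continuations of each related pair. -/
theorem bind {p : PMF α} {q : PMF β} {f : α → PMF γ} {g : β → PMF δ} (h : Coupled R p q)
    (hfg : ∀ a b, R a b → Coupled S (f a) (g b)) : Coupled S (p >>= f) (q >>= g) := by
  classical
  obtain ⟨w, hp, hq, hw⟩ := h
  set v : α × β → PMF (γ × δ) := fun ab =>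
    if h : R ab.1 ab.2 then (hfg _ _ h).choose
    else (f ab.1 >>= fun c => (fun d => (c, d)) <$> g ab.2)
    with hv
  have hsup : ∀ ab ∈ w.support, Prod.fst <$> v ab = f ab.1 ∧ Prod.snd <$> v ab = g ab.2 ∧
      ∀ cd ∈ (v ab).support, S cd.1 cd.2 := by
    intro ab hab
    have := (hfg _ _ (hw ab hab)).choose_spec
    simp only [hv, dif_pos (hw ab hab)]
    exact this
  refine ⟨w >>= v, ?_, ?_, fun cd hcd => ?_⟩
  · rw [_root_.map_bind, PMF.bind_congr_support fun ab hab => (hsup ab hab).1, ← hp, bind_map_left]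
  · rw [_root_.map_bind, PMF.bind_congr_support fun ab hab => (hsup ab hab).2.1, ← hq,
      bind_map_left]
  · obtain ⟨ab, hab, hcd⟩ := PMF.mem_support_bind.1 hcd
    exact (hsup ab hab).2.2 cd hcd

theorem bind_same (p : PMF α) {f : α → PMF γ} {g : α → PMF δ}
    (hfg : ∀ a, Coupled S (f a) (g a)) : Coupled S (p >>= f) (p >>= g) := by
  refine bind (R := fun a b => a = b) ⟨(fun a => (a, a)) <$> p, ?_, ?_, fun ab hab => ?_⟩
    (fun a b h => h ▸ hfg a)
  · rw [Functor.map_map]; simp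
  · rw [Functor.map_map]; simp
  · obtain ⟨a, -, rfl⟩ := PMF.mem_support_fmap.1 hab
    rfl

theorem iterM {R : α → β → Prop} {f : α → PMF α} {g : β → PMF β}
    (hfg : ∀ a b, R a b → Coupled R (f a) (g b)) (n : ℕ) {a : α} {b : β} (h : R a b) :
    Coupled R (iterM f n a) (_root_.iterM g n b) := by
  induction n generalizing a b with
  | zero => exact pure h
  | succ n ih => exact (hfg a b h).bind fun a b h => ih h

/-- Coupled distributions give the same distribution of a value on which the relation agrees. -/
theorem map_eq {p : PMF α} {q : PMF β} (h : Coupled R p q) {f : α → γ} {g : β → γ}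
    (hfg : ∀ a b, R a b → f a = g b) : f <$> p = g <$> q := by
  obtain ⟨w, rfl, rfl, hw⟩ := h
  rw [Functor.map_map, Functor.map_map, map_eq_bind_pure_comp, map_eq_bind_pure_comp]
  exact PMF.bind_congr_support fun ab hab => congrArg Pure.pure (hfg _ _ (hw ab hab))

theorem exists_of_mem_left {p : PMF α} {q : PMF β} (h : Coupled R p q) {a : α}
    (ha : a ∈ p.support) : ∃ b ∈ q.support, R a b := by
  obtain ⟨w, rfl, rfl, hw⟩ := h
  obtain ⟨ab, hab, rfl⟩ := PMF.mem_support_fmap.1 ha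
  exact ⟨ab.2, PMF.mem_support_fmap.2 ⟨ab, hab, rfl⟩, hw ab hab⟩

end Coupled

/-! ### Simulating the lazily sampled oracle in memory -/

/-- Where the arrays of a program go when its oracle is simulated: arrays `4`, `5`, `6` are freed,
the input and output arrays stay. -/
def shiftArrays (a : ℕ) : ℕ := if a < 4 then a else a + 4

theorem shiftArrays_injective : shiftArrays.Injective := fun a b h => by
  unfold shiftArrays at h; split_ifs at h <;> omega

theorem shiftArrays_ne {a b : ℕ} (hb : 4 ≤ b ∧ b < 8) : shiftArrays a ≠ b := by
  unfold shiftArrays; split_ifs <;> omega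

/-- An injective polynomial encoding of a context and a string: the cell of array `4` that stores
the value of the oracle. -/
def oracleKey (ctx x : ℕ) : ℕ := (ctx + x) * (ctx + x) + x

theorem oracleKey_injective {c x c' x' : ℕ} (h : oracleKey c x = oracleKey c' x') :
    c = c' ∧ x = x' := by
  unfold oracleKey at h
  have hs : c + x = c' + x' := by
    rcases lt_trichotomy (c + x) (c' + x') with hlt | heq | hlt
    · have : (c + x + 1) * (c + x + 1) ≤ (c' + x') * (c' + x') := Nat.mul_le_mul hlt hlt
      nlinarith
    · exact heq
    · have : (c' + x' + 1) * (c' + x' + 1) ≤ (c + x) * (c + x) := Nat.mul_le_mul hlt hlt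
      nlinarith
  rw [hs] at h
  omega

/-- The expression that evaluates to the `oracleKey` of the values of `ctx` and `x`. -/
def RExpr.oracleKey (ctx x : RExpr) : RExpr :=
  .op .add (.op .mul (.op .add ctx x) (.op .add ctx x)) x

theorem RExpr.eval_oracleKey (ctx x : RExpr) (m : Memory) :
    (RExpr.oracleKey ctx x).eval m = _root_.oracleKey (ctx.eval m) (x.eval m) := rfl

theorem RExpr.cost_oracleKey_le (ctx x : RExpr) (m : Memory) :
    (RExpr.oracleKey ctx x).cost m ≤ 20 * (ctx.cost m + x.cost m + 1) ∧
      (_root_.oracleKey (ctx.eval m) (x.eval m)).size ≤ 20 * (ctx.cost m + x.cost m + 1) := by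
  have h1 := ctx.size_eval_le_cost m
  have h2 := x.size_eval_le_cost m
  have h3 := Nat.size_add_le (ctx.eval m) (x.eval m)
  have h4 := Nat.size_mul_le (ctx.eval m + x.eval m) (ctx.eval m + x.eval m)
  have h5 := Nat.size_add_le ((ctx.eval m + x.eval m) * (ctx.eval m + x.eval m)) (x.eval m)
  constructor
  · simp only [RExpr.oracleKey, RExpr.cost, RExpr.eval, ArithOp.eval]; omega
  · unfold _root_.oracleKey; omega

/-- An expression that vanishes iff the value of cell `1` of array `6` is in the list. -/
def RExpr.notMem : List ℕ → RExpr
  | [] => .const 1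
  | u :: l => .op .mul (.op .add (.op .sub (.read 6 (.const 1)) (.const u))
      (.op .sub (.const u) (.read 6 (.const 1)))) (RExpr.notMem l)

theorem RExpr.eval_notMem (l : List ℕ) (m : Memory) :
    (RExpr.notMem l).eval m = 0 ↔ m 6 1 ∈ l := by
  induction l with
  | nil => simp [RExpr.notMem, RExpr.eval]
  | cons u l ih =>
    simp only [RExpr.notMem, RExpr.eval, ArithOp.eval, Nat.mul_eq_zero, ih, List.mem_cons]
    refine or_congr ?_ Iff.rfl
    omega

theorem RExpr.cost_notMem_le (l : List ℕ) :
    ∃ W, ∀ m : Memory, (RExpr.notMem l).cost m ≤ W * ((m 6 1).size + 1) := by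
  induction l with
  | nil => exact ⟨2, fun m => by simp [RExpr.notMem, RExpr.cost]⟩
  | cons u l ih =>
    obtain ⟨W, hW⟩ := ih
    refine ⟨2 * W + 50 * (u + 1), fun m => ?_⟩
    have h1 := hW m
    have h2 := (RExpr.notMem l).size_eval_le_cost m
    have h3 := Nat.size_le_self u
    have h4 := Nat.size_add_le (m 6 1 - u) (u - m 6 1)
    have h5 := Nat.size_le_size (Nat.sub_le (m 6 1) u)
    have h6 := Nat.size_le_size (Nat.sub_le u (m 6 1))
    have h7 := Nat.size_mul_le (m 6 1 - u + (u - m 6 1)) ((RExpr.notMem l).eval m)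
    simp only [RExpr.notMem, RExpr.cost, RExpr.eval, ArithOp.eval, Nat.size_one]
    nlinarith

/-- Replace the oracle commands by accesses to array `4`, where `0` stands for an undefined point
and `y + 1` for the value `y`.  Cell `0` of array `5` holds `2 ^ lam`, array `6` is scratch space,
and the programmable contexts are the elements of the list `l`. -/
def Prog.internal (l : List ℕ) : Prog → Prog
  | .skip => .skip
  | .assign a i e => .assign (shiftArrays a) (i.rename shiftArrays) (e.rename shiftArrays)
  | .seq P Q => .seq (P.internal l) (Q.internal l)
  | .ite e P Q => .ite (e.rename shiftArrays) (P.internal l) (Q.internal l)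
  | .loop n P => .loop (n.rename shiftArrays) (P.internal l)
  | .rand a i n => .rand (shiftArrays a) (i.rename shiftArrays) (n.rename shiftArrays)
  | .query a i ctx x =>
      .seq (.assign 6 (.const 0) (.oracleKey (ctx.rename shiftArrays) (x.rename shiftArrays)))
      (.seq (.ite (.read 4 (.read 6 (.const 0))) .skip
          (.seq (.rand 6 (.const 1) (.read 5 (.const 0)))
            (.assign 4 (.read 6 (.const 0)) (.op .add (.read 6 (.const 1)) (.const 1)))))
        (.assign (shiftArrays a) (i.rename shiftArrays)
          (.op .sub (.read 4 (.read 6 (.const 0))) (.const 1))))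
  | .program a i ctx x y =>
      .seq (.assign 6 (.const 0) (.oracleKey (ctx.rename shiftArrays) (x.rename shiftArrays)))
      (.seq (.assign 6 (.const 1) (ctx.rename shiftArrays))
      (.seq (.assign 6 (.const 2) (y.rename shiftArrays))
      (.seq (.assign 6 (.const 3) (.const 0))
      (.seq (.ite (.notMem l) .skip (.ite (.read 4 (.read 6 (.const 0))) .skip
          (.ite (.op .sub (.read 5 (.const 0)) (.read 6 (.const 2)))
            (.seq (.assign 4 (.read 6 (.const 0)) (.op .add (.read 6 (.const 2)) (.const 1)))
              (.assign 6 (.const 3) (.const 1))) .skip)))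
        (.assign (shiftArrays a) (i.rename shiftArrays) (.read 6 (.const 3)))))))

/-- The content of array `4` for an entry of the oracle table. -/
def entryCode {lam : ℕ} : Option (Fin (2 ^ lam)) → ℕ
  | none => 0
  | some y => y.val + 1

theorem entryCode_size_le {lam : ℕ} (o : Option (Fin (2 ^ lam))) :
    (entryCode o).size ≤ lam + 1 := by
  cases o with
  | none => simp [entryCode]
  | some y =>
    have := y.2
    refine Nat.size_le.2 (lt_of_le_of_lt (b := 2 ^ lam) ?_ (Nat.pow_lt_pow_right (by norm_num)
      (Nat.lt_succ_self lam)))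
    simp only [entryCode]; omega

/-- The configuration `d` of the transformed program represents the configuration `c`; the
simulation slows the program down by a factor of `K` and needed `k` steps of preparation. -/
structure OracleSim {lam : ℕ} (K k : ℕ) (d c : Config lam) : Prop where
  mem : ∀ a, d.mem (shiftArrays a) = c.mem a
  table : ∀ ctx x, d.mem 4 (oracleKey ctx x) = entryCode (c.table ctx x)
  range : d.mem 5 0 = 2 ^ lam
  steps : d.steps ≤ K * c.steps + k

theorem uniformNat_of_pos {n : ℕ} (hn : 0 < n) [Nonempty (Fin n)] :
    uniformNat n = Fin.val <$> PMF.uniformOfFintype (Fin n) := by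
  obtain ⟨k, rfl⟩ : ∃ k, n = k + 1 := ⟨n - 1, by omega⟩
  rfl

theorem OTable.define_apply {lam : ℕ} (T : OTable lam) (ctx x : ℕ) (y : Fin (2 ^ lam))
    (ctx' x' : ℕ) :
    T.define ctx x y ctx' x' = if ctx' = ctx ∧ x' = x then some y else T ctx' x' := by
  unfold OTable.define
  by_cases hc : ctx' = ctx
  · subst hc
    by_cases hx : x' = x
    · subst hx; simp
    · simp [hx]
  · simp [hc]

section

variable {lam : ℕ} {U : Finset ℕ} {K k : ℕ} {d c : Config lam}

/-- Expressions keep value and cost, since the simulation does not write to renamed arrays. -/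
theorem OracleSim.eval (h : OracleSim K k d c) (e : RExpr) {m : Memory}
    (hm : ∀ a, m (shiftArrays a) = d.mem (shiftArrays a)) :
    (e.rename shiftArrays).eval m = e.eval c.mem ∧
      (e.rename shiftArrays).cost m = e.cost c.mem := by
  rw [RExpr.eval_rename, RExpr.cost_rename]
  have : (fun a => m (shiftArrays a)) = c.mem := funext fun a => (hm a).trans (h.mem a)
  rw [this]
  exact ⟨rfl, rfl⟩

theorem Prog.exec_seq (V : Finset ℕ) (P Q : Prog) (c : Config lam) :
    (Prog.seq P Q).exec V c = P.exec V c >>= Q.exec V := rfl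

theorem Prog.exec_ite (V : Finset ℕ) (e : RExpr) (P Q : Prog) (c : Config lam) :
    (Prog.ite e P Q).exec V c = if e.eval c.mem ≠ 0 then P.exec V (c.charge (1 + e.cost c.mem))
      else Q.exec V (c.charge (1 + e.cost c.mem)) := rfl

theorem Prog.exec_ite_mk (V : Finset ℕ) (e : RExpr) (P Q : Prog) (m : Memory) (T : OTable lam)
    (s : ℕ) : (Prog.ite e P Q).exec V ⟨m, T, s⟩ = if e.eval m ≠ 0 then
      P.exec V ⟨m, T, s + (1 + e.cost m)⟩ else Q.exec V ⟨m, T, s + (1 + e.cost m)⟩ := rfl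

theorem Prog.exec_skip_mk (V : Finset ℕ) (m : Memory) (T : OTable lam) (s : ℕ) :
    Prog.skip.exec V ⟨m, T, s⟩ = pure ⟨m, T, s + 1⟩ := rfl

theorem Prog.exec_assign_mk (V : Finset ℕ) (a : ℕ) (i e : RExpr) (m : Memory) (T : OTable lam)
    (s : ℕ) : (Prog.assign a i e).exec V ⟨m, T, s⟩ =
      pure ⟨m.write a (i.eval m) (e.eval m), T, s + (1 + i.cost m + e.cost m)⟩ := rfl

/-- Writing a value to an ordinary array on both sides preserves the representation. -/
theorem OracleSim.write (h : OracleSim K k d c) {m : Memory} {T T' : OTable lam} {s r : ℕ}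
    (hm : ∀ a, m (shiftArrays a) = d.mem (shiftArrays a)) (h5 : m 5 0 = d.mem 5 0)
    (h4 : ∀ ctx x, m 4 (oracleKey ctx x) = entryCode (T ctx x)) (a i v : ℕ)
    (hs : s ≤ d.steps + K * r) :
    OracleSim K k ⟨m.write (shiftArrays a) i v, T', s⟩ (c.update a i v T r) where
  mem b := by
    funext j
    simp only [Config.update_mem, Memory.write_apply, shiftArrays_injective.eq_iff, hm, h.mem]
  table ctx x := by
    show m.write (shiftArrays a) i v 4 (oracleKey ctx x) = _
    rw [Memory.write_apply, if_neg (fun h => shiftArrays_ne (by norm_num) h.1.symm), h4]; rfl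
  range := by
    show m.write (shiftArrays a) i v 5 0 = _
    rw [Memory.write_apply, if_neg (fun h => shiftArrays_ne (by norm_num) h.1.symm), h5, h.range]
  steps := by
    have := h.steps
    simp only [Config.update_steps, Nat.mul_add]
    omega

/-- Fresh points are coupled by drawing the same value. The factor `1000` is a generous bound for
the number of bookkeeping steps per unit of cost of the simulated command. -/
theorem OracleSim.query (hK : 1000 ≤ K) (l : List ℕ) (V : Finset ℕ) (h : OracleSim K k d c)
    (a : ℕ) (i ctx x : RExpr) :
    Coupled (OracleSim K k) (((Prog.query a i ctx x).internal l).exec V d)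
      ((Prog.query a i ctx x).exec U c) := by
  set κ := oracleKey (ctx.eval c.mem) (x.eval c.mem) with hκ
  have hne : ∀ b, shiftArrays b ≠ 4 ∧ shiftArrays b ≠ 5 ∧ shiftArrays b ≠ 6 := fun b =>
    ⟨shiftArrays_ne (by norm_num), shiftArrays_ne (by norm_num), shiftArrays_ne (by norm_num)⟩
  obtain ⟨v1, w1⟩ := h.eval ctx (m := d.mem) fun _ => rfl
  obtain ⟨v2, w2⟩ := h.eval x (m := d.mem) fun _ => rfl
  have hkey := RExpr.cost_oracleKey_le (ctx.rename shiftArrays) (x.rename shiftArrays) d.mem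
  rw [v1, v2, w1, w2, ← hκ] at hkey
  have hent : d.mem 4 κ = entryCode (c.table (ctx.eval c.mem) (x.eval c.mem)) := h.table _ _
  have hsz := entryCode_size_le (c.table (ctx.eval c.mem) (x.eval c.mem))
  set m1 := d.mem.write 6 0 κ with hm1
  have e60 : m1 6 0 = κ := by simp [hm1, Memory.write_apply]
  have e4 : m1 4 = d.mem 4 := by funext j; simp [hm1, Memory.write_apply]
  have e5 : m1 5 0 = 2 ^ lam := by simp [hm1, Memory.write_apply, h.range]
  set cost1 := (RExpr.oracleKey (ctx.rename shiftArrays) (x.rename shiftArrays)).cost d.mem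
    with hcost1
  have A1 : (Prog.assign 6 (.const 0)
      (.oracleKey (ctx.rename shiftArrays) (x.rename shiftArrays))).exec V d =
      pure ⟨m1, d.table, d.steps + (2 + cost1)⟩ := by
    cases d with | mk m T s =>
    rw [Prog.exec_assign_mk]
    simp only [RExpr.eval_oracleKey, v1, v2, ← hκ]
    simp [RExpr.cost, RExpr.eval, hm1, hcost1]
  rw [Prog.internal, Prog.exec_seq_of_pure A1, Prog.exec_seq, Prog.exec_ite]
  set r := 1 + lam + i.cost c.mem + ctx.cost c.mem + x.cost c.mem with hr
  have hcost : (RExpr.read 4 (.read 6 (.const 0))).cost m1 ≤ 4 + κ.size + (lam + 1) := by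
    simp only [RExpr.cost, RExpr.eval, e60, e4, hent, Nat.size_zero]; omega
  cases hT : c.table (ctx.eval c.mem) (x.eval c.mem) with
  | some y =>
    rw [hT] at hent hsz
    have hq : (Prog.query a i ctx x).exec U c =
        pure (c.update a (i.eval c.mem) y.val c.table r) := by
      simp only [Prog.exec, oracleQuery, hT, LawfulMonad.pure_bind, hr]
    rw [hq, if_pos (by simp [RExpr.eval, e60, e4, hent, entryCode])]
    obtain ⟨v3, w3⟩ := h.eval i (m := m1) fun b => by
      funext j; simp [hm1, Memory.write_apply, (hne b).2.2]
    simp only [Prog.exec, LawfulMonad.pure_bind]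
    refine Coupled.pure ?_
    have this := h.write (m := m1) (T := c.table) (T' := d.table) (a := a) (i := i.eval c.mem)
      (v := y.val) (r := r)
      (s := d.steps + (2 + cost1) + (1 + (RExpr.read 4 (.read 6 (.const 0))).cost m1) + 1 +
        (1 + i.cost c.mem + (RExpr.op .sub (.read 4 (.read 6 (.const 0))) (.const 1)).cost m1))
      (fun b => by funext j; simp [hm1, Memory.write_apply, (hne b).2.2])
      (by rw [e5, h.range]) (fun _ _ => by rw [e4, h.table]) (by
        have h1 := Nat.size_le_size (Nat.sub_le (entryCode (some y)) 1)
        simp only [RExpr.cost, RExpr.eval, e60, e4, hent, ArithOp.eval, Nat.size_zero,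
          Nat.size_one] at hcost ⊢
        have h2 : 1000 * r ≤ K * r := Nat.mul_le_mul_right _ hK
        omega)
    convert this using 1
    simp only [Config.charge, Config.update, RExpr.eval, e60, e4, hent, entryCode, ArithOp.eval,
      v3, w3, Nat.add_sub_cancel]
  | none =>
    rw [hT] at hent hsz
    have hq : (Prog.query a i ctx x).exec U c =
        PMF.uniformOfFintype (Fin (2 ^ lam)) >>= fun y =>
          pure (c.update a (i.eval c.mem) y.val
            (c.table.define (ctx.eval c.mem) (x.eval c.mem) y) r) := by
      simp only [Prog.exec, oracleQuery, hT, bind_assoc, LawfulMonad.pure_bind, hr]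
    rw [hq, if_neg (by simp [RExpr.eval, e60, e4, hent, entryCode]), Prog.exec_seq,
      Prog.exec_rand]
    have hv : (RExpr.read 5 (.const 0)).eval m1 = 2 ^ lam := e5
    simp only [Config.charge_mem, hv, uniformNat_of_pos (Nat.two_pow_pos lam), bind_map_left,
      bind_assoc, LawfulMonad.pure_bind]
    refine Coupled.bind_same _ fun y => ?_
    simp only [Prog.exec, LawfulMonad.pure_bind]
    refine Coupled.pure ?_
    set m2 := m1.write 6 1 y.val with hm2
    have e60' : m2 6 0 = κ := by simp [hm2, Memory.write_apply, e60]
    have e61' : m2 6 1 = y.val := by simp [hm2, Memory.write_apply]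
    set m3 := m2.write 4 κ (y.val + 1) with hm3
    have e60'' : m3 6 0 = κ := by simp [hm3, Memory.write_apply, e60']
    have e4'' : m3 4 κ = y.val + 1 := by simp [hm3, Memory.write_apply]
    have hm3d : ∀ b, m3 (shiftArrays b) = d.mem (shiftArrays b) := fun b => by
      funext j; simp [hm3, hm2, hm1, Memory.write_apply, (hne b).2.2, (hne b).1]
    obtain ⟨v3, w3⟩ := h.eval i (m := m3) hm3d
    have hy : y.val.size ≤ lam := Nat.size_le.2 y.2
    have hy1 : (y.val + 1).size ≤ lam + 1 := entryCode_size_le (some y)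
    have h2l : (2 ^ lam).size ≤ lam + 1 := Nat.size_le.2
      (Nat.pow_lt_pow_right (by norm_num) (Nat.lt_succ_self lam))
    have this := h.write (m := m3)
      (T := c.table.define (ctx.eval c.mem) (x.eval c.mem) y)
      (T' := d.table) (a := a) (i := i.eval c.mem)
      (v := y.val) (r := r)
      (s := d.steps + (2 + cost1) + (1 + (RExpr.read 4 (.read 6 (.const 0))).cost m1) +
        (1 + (RExpr.const 1).cost m1 + (RExpr.read 5 (.const 0)).cost m1) +
        (1 + (RExpr.read 6 (.const 0)).cost m2 +
          (RExpr.op .add (.read 6 (.const 1)) (.const 1)).cost m2) +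
        (1 + i.cost c.mem + (RExpr.op .sub (.read 4 (.read 6 (.const 0))) (.const 1)).cost m3))
      hm3d (by simp [hm3, hm2, Memory.write_apply, e5, h.range])
      (fun c' x' => by
        rw [hm3, Memory.write_apply, OTable.define_apply]
        by_cases hcx : c' = ctx.eval c.mem ∧ x' = x.eval c.mem
        · rw [if_pos ⟨rfl, by rw [hcx.1, hcx.2]⟩, if_pos hcx]; rfl
        · rw [if_neg fun h' => hcx (oracleKey_injective h'.2), if_neg hcx, ← h.table]
          simp [hm2, hm1, Memory.write_apply])
      (by
        simp only [RExpr.cost, RExpr.eval, e60, e60', e60'', e61', e5, e4'', ArithOp.eval,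
          Nat.size_zero, Nat.size_one, Nat.add_sub_cancel] at hcost ⊢
        have h2 : 1000 * r ≤ K * r := Nat.mul_le_mul_right _ hK
        omega)
    convert this using 1
    simp only [Config.charge, Config.update, RExpr.eval, e60', e60'', e61', e4'', ArithOp.eval,
      v3, w3, Nat.add_sub_cancel, ← hm2, ← hm3]

theorem Prog.exec_program (a : ℕ) (i ctx x y : RExpr) :
    (Prog.program a i ctx x y).exec U c =
      if h : ctx.eval c.mem ∈ U ∧ c.table (ctx.eval c.mem) (x.eval c.mem) = none ∧
          y.eval c.mem < 2 ^ lam then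
        pure (c.update a (i.eval c.mem) 1
          (c.table.define (ctx.eval c.mem) (x.eval c.mem) ⟨y.eval c.mem, h.2.2⟩)
          (1 + lam + i.cost c.mem + ctx.cost c.mem + x.cost c.mem + y.cost c.mem))
      else pure (c.update a (i.eval c.mem) 0 c.table
          (1 + lam + i.cost c.mem + ctx.cost c.mem + x.cost c.mem + y.cost c.mem)) := by
  simp only [Prog.exec, oracleProgram]
  split_ifs <;> first | (simp only [LawfulMonad.pure_bind]; rfl) | (exfalso; tauto)

/-- Programming succeeds in memory exactly if it succeeds on the oracle. The bookkeeping now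
includes the test whether the context is programmable, at a cost that is governed by `W`. -/
theorem OracleSim.program {l : List ℕ} {W : ℕ}
    (hW : ∀ m : Memory, (RExpr.notMem l).cost m ≤ W * ((m 6 1).size + 1)) (hl : ∀ u, u ∈ l ↔ u ∈ U)
    (hK : 1000 + W ≤ K) (V : Finset ℕ) (h : OracleSim K k d c) (a : ℕ) (i ctx x y : RExpr) :
    Coupled (OracleSim K k) (((Prog.program a i ctx x y).internal l).exec V d)
      ((Prog.program a i ctx x y).exec U c) := by
  set κ := oracleKey (ctx.eval c.mem) (x.eval c.mem) with hκ
  have hne : ∀ b, shiftArrays b ≠ 4 ∧ shiftArrays b ≠ 5 ∧ shiftArrays b ≠ 6 := fun b =>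
    ⟨shiftArrays_ne (by norm_num), shiftArrays_ne (by norm_num), shiftArrays_ne (by norm_num)⟩
  set m1 := d.mem.write 6 0 κ with hm1
  set m2 := m1.write 6 1 (ctx.eval c.mem) with hm2
  set m3 := m2.write 6 2 (y.eval c.mem) with hm3
  set m4 := m3.write 6 3 0 with hm4
  obtain ⟨v1, w1⟩ := h.eval ctx (m := d.mem) fun _ => rfl
  obtain ⟨v2, w2⟩ := h.eval x (m := d.mem) fun _ => rfl
  obtain ⟨v1', w1'⟩ := h.eval ctx (m := m1) fun b => by
    funext j; simp [hm1, Memory.write_apply, (hne b).2.2]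
  obtain ⟨v2', w2'⟩ := h.eval y (m := m2) fun b => by
    funext j; simp [hm2, hm1, Memory.write_apply, (hne b).2.2]
  have hkey := RExpr.cost_oracleKey_le (ctx.rename shiftArrays) (x.rename shiftArrays) d.mem
  rw [v1, v2, w1, w2, ← hκ] at hkey
  have hent : d.mem 4 κ = entryCode (c.table (ctx.eval c.mem) (x.eval c.mem)) := h.table _ _
  have hsz := entryCode_size_le (c.table (ctx.eval c.mem) (x.eval c.mem))
  set cost1 := (RExpr.oracleKey (ctx.rename shiftArrays) (x.rename shiftArrays)).cost d.mem
    with hcost1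
  have e60 : m4 6 0 = κ := by simp [hm4, hm3, hm2, hm1, Memory.write_apply]
  have e61 : m4 6 1 = ctx.eval c.mem := by simp [hm4, hm3, hm2, Memory.write_apply]
  have e62 : m4 6 2 = y.eval c.mem := by simp [hm4, hm3, Memory.write_apply]
  have e63 : m4 6 3 = 0 := by simp [hm4, Memory.write_apply]
  have e4 : m4 4 = d.mem 4 := by funext j; simp [hm4, hm3, hm2, hm1, Memory.write_apply]
  have e5 : m4 5 0 = 2 ^ lam := by simp [hm4, hm3, hm2, hm1, Memory.write_apply, h.range]
  have hm4d : ∀ b, m4 (shiftArrays b) = d.mem (shiftArrays b) := fun b => by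
    funext j; simp [hm4, hm3, hm2, hm1, Memory.write_apply, (hne b).2.2]
  set s1 := d.steps + (2 + cost1) + (3 + ctx.cost c.mem) + (4 + y.cost c.mem) + 5 with hs1
  have sz2 : Nat.size 2 = 2 := by decide
  have sz3 : Nat.size 3 = 2 := by decide
  have A : ∀ Q : Prog, (Prog.seq (.assign 6 (.const 0)
        (.oracleKey (ctx.rename shiftArrays) (x.rename shiftArrays)))
      (.seq (.assign 6 (.const 1) (ctx.rename shiftArrays))
      (.seq (.assign 6 (.const 2) (y.rename shiftArrays))
      (.seq (.assign 6 (.const 3) (.const 0)) Q)))).exec V d = Q.exec V ⟨m4, d.table, s1⟩ := by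
    intro Q
    have hd : d = ⟨d.mem, d.table, d.steps⟩ := rfl
    rw [hd]
    simp only [Prog.exec_seq, Prog.exec_assign_mk, LawfulMonad.pure_bind, RExpr.eval_oracleKey, v1,
      v2, ← hκ, RExpr.eval, ← hm1, ← hm2, ← hm3, ← hm4, v1', v2', w1', w2', ← hcost1, hs1]
    congr 2
  rw [Prog.internal, A, Prog.exec_seq, Prog.exec_ite_mk, Prog.exec_program]
  set r := 1 + lam + i.cost c.mem + ctx.cost c.mem + x.cost c.mem + y.cost c.mem with hr
  have hKr : 1000 * r + W * r ≤ K * r := by rw [← Nat.add_mul]; exact Nat.mul_le_mul_right _ hK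
  have hcM : (RExpr.notMem l).cost m4 ≤ W * r := by
    refine (hW m4).trans (Nat.mul_le_mul_left _ ?_)
    have := ctx.size_eval_le_cost c.mem
    rw [e61]; omega
  have hcost : (RExpr.read 4 (.read 6 (.const 0))).cost m4 ≤ 4 + κ.size + (lam + 1) := by
    simp only [RExpr.cost, RExpr.eval, e60, e4, hent, Nat.size_zero]; omega
  have hysz := y.size_eval_le_cost c.mem
  obtain ⟨v3, w3⟩ := h.eval i hm4d
  -- All three reasons for failure lead to the same configuration, up to the number of steps.
  have fail : ∀ s, s ≤ s1 + W * r + 4 + κ.size + 500 * r → Coupled (OracleSim K k)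
      ((Prog.assign (shiftArrays a) (i.rename shiftArrays) (.read 6 (.const 3))).exec V
        ⟨m4, d.table, s⟩) (pure (c.update a (i.eval c.mem) 0 c.table r)) := fun s hs => by
    rw [Prog.exec_assign_mk]
    refine Coupled.pure ?_
    simp only [v3, w3, RExpr.eval, e63]
    refine h.write hm4d (by rw [e5, h.range]) (fun _ _ => by rw [e4, h.table]) _ _ _ ?_
    simp only [RExpr.cost, RExpr.eval, e63, Nat.size_zero, sz3]
    omega
  by_cases hU : ctx.eval c.mem ∈ U
  swap
  · rw [dif_neg (fun h => hU h.1), if_pos (by rw [Ne, RExpr.eval_notMem, e61, hl]; exact hU),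
      Prog.exec_skip_mk, LawfulMonad.pure_bind]
    refine fail _ ?_
    omega
  rw [if_neg (by rw [not_not, RExpr.eval_notMem, e61, hl]; exact hU), Prog.exec_ite_mk]
  have hv : (RExpr.read 4 (.read 6 (.const 0))).eval m4 =
      entryCode (c.table (ctx.eval c.mem) (x.eval c.mem)) := by
    simp only [RExpr.eval, e60, e4, hent]
  by_cases hT : c.table (ctx.eval c.mem) (x.eval c.mem) = none
  swap
  · obtain ⟨y', hy'⟩ := Option.ne_none_iff_exists'.1 hT
    rw [dif_neg (fun h => hT h.2.1), if_pos (by rw [hv, hy']; exact Nat.succ_ne_zero _),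
      Prog.exec_skip_mk, LawfulMonad.pure_bind]
    refine fail _ ?_
    omega
  rw [if_neg (by rw [hv, hT]; simp [entryCode]), Prog.exec_ite_mk]
  have hcost' : (RExpr.op .sub (.read 5 (.const 0)) (.read 6 (.const 2))).cost m4 ≤
      50 * (lam + y.cost c.mem + 1) := by
    have h2l : (2 ^ lam).size ≤ lam + 1 := Nat.size_le.2
      (Nat.pow_lt_pow_right (by norm_num) (Nat.lt_succ_self lam))
    have h1 := Nat.size_le_size (Nat.sub_le (2 ^ lam) (y.eval c.mem))
    simp only [RExpr.cost, RExpr.eval, e5, e62, ArithOp.eval, Nat.size_zero, sz2]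
    omega
  have hv' : (RExpr.op .sub (.read 5 (.const 0)) (.read 6 (.const 2))).eval m4 =
      2 ^ lam - y.eval c.mem := by
    simp only [RExpr.eval, e5, e62, ArithOp.eval]
  by_cases hy : y.eval c.mem < 2 ^ lam
  swap
  · rw [dif_neg (fun h => hy h.2.2), if_neg (by rw [hv']; omega),
      Prog.exec_skip_mk, LawfulMonad.pure_bind]
    refine fail _ ?_
    omega
  rw [dif_pos ⟨hU, hT, hy⟩, if_pos (by rw [hv']; omega), Prog.exec_seq, Prog.exec_assign_mk,
    LawfulMonad.pure_bind, Prog.exec_assign_mk, LawfulMonad.pure_bind, Prog.exec_assign_mk]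
  refine Coupled.pure ?_
  set T' := c.table.define (ctx.eval c.mem) (x.eval c.mem) ⟨y.eval c.mem, hy⟩ with hT'
  have e4v : (RExpr.read 6 (.const 0)).eval m4 = κ := e60
  have e4w : (RExpr.op .add (.read 6 (.const 2)) (.const 1)).eval m4 = y.eval c.mem + 1 := by
    simp only [RExpr.eval, e62, ArithOp.eval]
  have hy1 : (y.eval c.mem + 1).size ≤ lam + 1 :=
    entryCode_size_le (some (⟨y.eval c.mem, hy⟩ : Fin (2 ^ lam)))
  rw [e4v, e4w]
  set m5 := m4.write 4 κ (y.eval c.mem + 1) with hm5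
  simp only [RExpr.eval]
  set m6 := m5.write 6 3 1 with hm6
  have e63' : m6 6 3 = 1 := by simp [hm6, Memory.write_apply]
  have hm6d : ∀ b, m6 (shiftArrays b) = d.mem (shiftArrays b) := fun b => by
    rw [← hm4d]; funext j
    simp [hm6, hm5, Memory.write_apply, (hne b).1, (hne b).2.2]
  obtain ⟨v4, w4⟩ := h.eval i hm6d
  rw [v4, w4, e63']
  refine h.write hm6d (by simp [hm6, hm5, Memory.write_apply, e5, h.range]) (fun c' x' => ?_)
    _ _ _ ?_
  · rw [hm6, Memory.write_apply, if_neg (by norm_num), hm5, Memory.write_apply, hT',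
      OTable.define_apply]
    by_cases hcx : c' = ctx.eval c.mem ∧ x' = x.eval c.mem
    · rw [if_pos ⟨rfl, by rw [hcx.1, hcx.2]⟩, if_pos hcx]; rfl
    · rw [if_neg fun h' => hcx (oracleKey_injective h'.2), if_neg hcx, e4, ← h.table]
  · simp only [RExpr.cost, RExpr.eval, e60, e62, e63', ArithOp.eval, Nat.size_zero,
      Nat.size_one, sz3, sz2] at hcost hcost' ⊢
    omega

/-- The representation is kept by a whole program. -/
theorem Prog.exec_internal {l : List ℕ} {W : ℕ}
    (hW : ∀ m : Memory, (RExpr.notMem l).cost m ≤ W * ((m 6 1).size + 1)) (hl : ∀ u, u ∈ l ↔ u ∈ U)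
    (hK : 1000 + W ≤ K) (V : Finset ℕ) (P : Prog) (h : OracleSim K k d c) :
    Coupled (OracleSim K k) ((P.internal l).exec V d) (P.exec U c) := by
  -- All commands except for the oracle commands cost the same on both sides.
  have charge : ∀ {d c : Config lam} (r : ℕ), OracleSim K k d c →
      OracleSim K k (d.charge r) (c.charge r) := fun r h =>
    ⟨h.mem, h.table, h.range, by
      have h1 := h.steps
      have h2 : 1 * r ≤ K * r := Nat.mul_le_mul_right _ (by omega)
      simp only [Config.charge, Nat.mul_add]
      omega⟩
  have write : ∀ {d c : Config lam} (a i v r : ℕ), OracleSim K k d c →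
      OracleSim K k (d.update (shiftArrays a) i v d.table r) (c.update a i v c.table r) :=
    fun a i v r h => h.write (fun _ => rfl) rfl h.table a i v (by
      have h2 : 1 * r ≤ K * r := Nat.mul_le_mul_right _ (by omega)
      omega)
  induction P generalizing d c with
  | skip => exact Coupled.pure (charge 1 h)
  | assign a i e =>
    obtain ⟨v1, w1⟩ := h.eval i (m := d.mem) fun _ => rfl
    obtain ⟨v2, w2⟩ := h.eval e (m := d.mem) fun _ => rfl
    simp only [Prog.internal, Prog.exec, v1, v2, w1, w2]
    exact Coupled.pure (write _ _ _ _ h)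
  | seq P Q ihP ihQ => exact (ihP h).bind fun _ _ h' => ihQ h'
  | ite e P Q ihP ihQ =>
    obtain ⟨v1, w1⟩ := h.eval e (m := d.mem) fun _ => rfl
    simp only [Prog.internal, Prog.exec, v1, w1]
    split_ifs
    · exact ihP (charge _ h)
    · exact ihQ (charge _ h)
  | loop n P ih =>
    obtain ⟨v1, w1⟩ := h.eval n (m := d.mem) fun _ => rfl
    simp only [Prog.internal, Prog.exec, v1, w1]
    exact Coupled.iterM (fun _ _ h' => ih h') _ (charge _ h)
  | rand a i n =>
    obtain ⟨v1, w1⟩ := h.eval i (m := d.mem) fun _ => rfl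
    obtain ⟨v2, w2⟩ := h.eval n (m := d.mem) fun _ => rfl
    simp only [Prog.internal, Prog.exec_rand, v1, v2, w1, w2]
    exact Coupled.bind_same _ fun v => Coupled.pure (write _ _ _ _ h)
  | query a i ctx x => exact h.query (by omega) l V a i ctx x
  | program a i ctx x y => exact h.program hW hl hK V a i ctx x y

end

theorem Prog.internal_oracleFree (l : List ℕ) (P : Prog) : (P.internal l).OracleFree := by
  induction P <;> simp_all [Prog.internal, Prog.OracleFree]

/-- The program that answers the oracle queries of `P` itself, by lazy sampling: cell `0` of array
`5` is set to `2 ^ lam` before the start. -/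
def Prog.internalized (U : Finset ℕ) (P : Prog) : Prog :=
  .seq (.seq (.assign 5 (.const 0) (.const 1))
    (.loop (.read 0 (.const 0)) (.assign 5 (.const 0)
      (.op .add (.read 5 (.const 0)) (.read 5 (.const 0))))))
    (P.internal U.toList)

theorem Prog.internalized_oracleFree (U : Finset ℕ) (P : Prog) :
    (P.internalized U).OracleFree :=
  ⟨⟨trivial, trivial⟩, P.internal_oracleFree _⟩

/-- The initial loop, which doubles cell `0` of array `5` for `lam` times. -/
theorem Prog.exec_internalized_init {lam : ℕ} (V : Finset ℕ) (x : List ℕ) (T : OTable lam) :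
    ∃ s ≤ 100 * (lam + 1) * (lam + 1), (Prog.seq (.assign 5 (.const 0) (.const 1))
    (.loop (.read 0 (.const 0)) (.assign 5 (.const 0)
      (.op .add (.read 5 (.const 0)) (.read 5 (.const 0)))))).exec V (startConfig lam x T) =
      pure ⟨(startConfig lam x T).mem.write 5 0 (2 ^ lam), T, s⟩ := by
  set m := (startConfig lam x T).mem with hm
  have key : ∀ (n k s : ℕ), k + n ≤ lam → ∃ s' ≤ s + n * (50 * (lam + 1)),
      iterM ((Prog.assign 5 (.const 0)
        (.op .add (.read 5 (.const 0)) (.read 5 (.const 0)))).exec V) n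
        (⟨m.write 5 0 (2 ^ k), T, s⟩ : Config lam) = pure ⟨m.write 5 0 (2 ^ (k + n)), T, s'⟩ := by
    intro n
    induction n with
    | zero => exact fun k s _ => ⟨s, by omega, rfl⟩
    | succ n ih =>
      intro k s hk
      have sz : ∀ k ≤ lam, (2 ^ k).size ≤ lam + 1 := fun k hk => Nat.size_le.2
        (Nat.pow_lt_pow_right (by norm_num) (by omega))
      have e : m.write 5 0 (2 ^ k) 5 0 = 2 ^ k := by simp [Memory.write_apply]
      have e2 : (m.write 5 0 (2 ^ k)).write 5 0 (2 ^ k + 2 ^ k) = m.write 5 0 (2 ^ (k + 1)) := by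
        funext a j
        simp only [Memory.write_apply, pow_succ]
        split_ifs <;> omega
      have h1 := sz k (by omega)
      have h2 := sz (k + 1) (by omega)
      rw [pow_succ, mul_two] at h2
      obtain ⟨s', hs', h'⟩ := ih (k + 1) (s + (1 + (RExpr.const 0).cost (m.write 5 0 (2 ^ k)) +
        (RExpr.op .add (.read 5 (.const 0)) (.read 5 (.const 0))).cost (m.write 5 0 (2 ^ k))))
        (by omega)
      refine ⟨s', hs'.trans ?_, ?_⟩
      · simp only [RExpr.cost, RExpr.eval, ArithOp.eval, e, Nat.size_zero, Nat.succ_mul]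
        omega
      · rw [iterM, Prog.exec_assign_mk, LawfulMonad.pure_bind]
        simp only [RExpr.eval, ArithOp.eval, e, e2]
        rw [h', Nat.add_right_comm, Nat.add_assoc]
  have hm0 : m.write 5 0 1 0 0 = lam := by simp [Memory.write_apply, hm, startConfig]
  obtain ⟨s, hs, h⟩ := key lam 0 (4 + (3 + lam.size)) (by omega)
  refine ⟨s, hs.trans ?_, ?_⟩
  · have := Nat.size_le_self lam
    nlinarith
  · have hst : startConfig lam x T = ⟨m, T, 0⟩ := rfl
    rw [hst, Prog.exec_seq, Prog.exec_assign_mk, LawfulMonad.pure_bind, Prog.exec]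
    simp only [RExpr.eval, hm0]
    rw [pow_zero, zero_add] at h
    rw [← h]
    congr 2
    simp only [Config.charge, RExpr.cost, RExpr.eval, Nat.size_zero, Nat.size_one, hm0]
    congr 1
    omega

/-- The machine behaves like `P` on the empty oracle, whatever its own oracle is. -/
theorem Prog.internalized_coupled {U : Finset ℕ} (P : Prog) : ∃ K, ∀ (V : Finset ℕ) {lam : ℕ}
    (x : List ℕ) (T : OTable lam), Coupled (OracleSim K (100 * (lam + 1) * (lam + 1)))
      ((P.internalized U).exec V (startConfig lam x T))
      (P.exec U (startConfig lam x (emptyTable lam))) := by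
  obtain ⟨W, hW⟩ := RExpr.cost_notMem_le U.toList
  refine ⟨1000 + W, fun V lam x T => ?_⟩
  obtain ⟨s, hs, h⟩ := Prog.exec_internalized_init V x T
  rw [Prog.internalized, Prog.exec_seq_of_pure h]
  refine Prog.exec_internal hW (fun u => Finset.mem_toList) le_rfl V P ⟨fun a => ?_,
    fun c' x' => ?_, ?_, ?_⟩
  · funext j
    show Memory.write _ _ _ _ _ _ = _
    rw [Memory.write_apply, if_neg fun h => shiftArrays_ne (by norm_num) h.1]
    unfold shiftArrays
    split_ifs with ha
    · rfl
    · rcases a with _ | _ | _ | _ | a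
      all_goals first | omega | rfl
  · rfl
  · simp [Memory.write_apply]
  · simpa [startConfig] using hs

/-- A machine that simulates its oracle by itself has, without oracle, the output distribution that
the original machine has on the empty oracle. -/
theorem Prog.internalized_run {U : Finset ℕ} (P : Prog) {lam : ℕ} (x : List ℕ) (V : Finset ℕ)
    (T : OTable lam) : Prod.fst <$> (P.internalized U).run V lam x T =
      Prod.fst <$> P.run U lam x (emptyTable lam) := by
  obtain ⟨K, hK⟩ := P.internalized_coupled (U := U)
  simp only [Prog.run, _root_.map_bind, LawfulApplicative.map_pure]
  have := (hK V x T).map_eq (f := Config.output) (g := Config.output) fun d c h => by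
    have h2 := h.mem 2
    have h3 := h.mem 3
    simp only [shiftArrays] at h2 h3
    norm_num at h2 h3
    rw [Config.output, Config.output, h2, h3]
  simp only [map_eq_bind_pure_comp] at this
  exact this

/-- The polynomial bound of `P` holds for all oracle answers, hence for the simulated ones. -/
theorem Prog.PolyTime.internalized {U : Finset ℕ} {P : Prog} (hP : P.PolyTime U) (V : Finset ℕ) :
    (P.internalized U).PolyTime V := by
  obtain ⟨K, hK⟩ := P.internalized_coupled (U := U)
  obtain ⟨q, hq⟩ := hP
  refine ⟨(Polynomial.C (K + 1)) * q + 100 * (Polynomial.X + 1) * (Polynomial.X + 1),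
    fun lam x T d hd => ?_⟩
  obtain ⟨c, hc, h⟩ := (hK V x T).exists_of_mem_left hd
  have hqc := hq lam x _ c hc
  have hout : d.output = c.output := by
    have h2 := h.mem 2
    have h3 := h.mem 3
    simp only [shiftArrays] at h2 h3
    norm_num at h2 h3
    rw [Config.output, Config.output, h2, h3]
  have hst := h.steps
  rw [hout]
  simp only [Polynomial.eval_add, Polynomial.eval_mul, Polynomial.eval_C, Polynomial.eval_X,
    Polynomial.eval_one, Polynomial.eval_ofNat]
  have h1 : 100 * (lam + 1) * (lam + 1) ≤
      100 * (lam + listSize x + 1) * (lam + listSize x + 1) := by gcongr <;> omega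
  have h2 : K * (c.steps + listSize c.output) ≤ K * q.eval (lam + listSize x) :=
    Nat.mul_le_mul_left _ hqc
  nlinarith

/-! ### Probabilities of events -/

open scoped ENNReal

namespace PMF

variable {α β : Type}

/-- The probability of an event. -/
def pr (p : PMF α) (s : α → Prop) : ℝ≥0∞ := p.toOuterMeasure {a | s a}

theorem pr_bind (p : PMF α) (f : α → PMF β) (s : β → Prop) :
    (p >>= f).pr s = ∑' a, p a * (f a).pr s := PMF.toOuterMeasure_bind_apply p f _

theorem pr_mono (p : PMF α) {s t : α → Prop} (h : ∀ a ∈ p.support, s a → t a) : p.pr s ≤ p.pr t :=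
  PMF.toOuterMeasure_mono _ fun a ha => h a ha.2 ha.1

theorem pr_le_one (p : PMF α) (s : α → Prop) : p.pr s ≤ 1 :=
  (p.pr_mono (t := fun _ => True) fun _ _ _ => trivial).trans
    (by simp [pr, PMF.toOuterMeasure_apply, PMF.tsum_coe])

theorem pr_eq_zero (p : PMF α) {s : α → Prop} (h : ∀ a ∈ p.support, ¬ s a) : p.pr s = 0 :=
  (PMF.toOuterMeasure_apply_eq_zero_iff p _).2 (Set.disjoint_left.2 h)

theorem pr_pure_of_not {a : α} {s : α → Prop} (h : ¬ s a) : (Pure.pure a : PMF α).pr s = 0 :=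
  pr_eq_zero _ fun b hb => by rwa [PMF.mem_support_pure.1 hb]

theorem pr_map (p : PMF α) (f : α → β) (s : β → Prop) : (f <$> p).pr s = p.pr (fun a => s (f a)) :=
  PMF.toOuterMeasure_map_apply f p _

theorem pr_bind_le (p : PMF α) (f : α → PMF β) (s : β → Prop) {ε : ℝ≥0∞}
    (h : ∀ a ∈ p.support, (f a).pr s ≤ ε) : (p >>= f).pr s ≤ ε := by
  rw [pr_bind]
  calc ∑' a, p a * (f a).pr s ≤ ∑' a, p a * ε := by
        refine ENNReal.tsum_le_tsum fun a => ?_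
        by_cases ha : p a = 0
        · simp [ha]
        · gcongr
          exact h a ((PMF.mem_support_iff _ _).2 ha)
    _ = ε := by rw [ENNReal.tsum_mul_right, PMF.tsum_coe, one_mul]

/-- The probability of an event after two steps, when the first step fails with small probability
and the event is unlikely unless the first step has failed. -/
theorem pr_bind_le_add (p : PMF α) (f : α → PMF β) (s : β → Prop) (t : α → Prop) {ε : ℝ≥0∞}
    (h : ∀ a ∈ p.support, ¬ t a → (f a).pr s ≤ ε) : (p >>= f).pr s ≤ p.pr t + ε := by
  classical
  rw [pr_bind]
  calc ∑' a, p a * (f a).pr s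
      ≤ ∑' a, (({a | t a} : Set α).indicator p a + p a * ε) := by
        refine ENNReal.tsum_le_tsum fun a => ?_
        by_cases ha : p a = 0
        · simp [ha]
        · by_cases hta : t a
          · rw [Set.indicator_of_mem (by exact hta)]
            calc p a * (f a).pr s ≤ p a * 1 := by gcongr; exact pr_le_one _ _
              _ ≤ p a + p a * ε := by rw [mul_one]; exact le_self_add
          · rw [Set.indicator_of_notMem (by exact hta), zero_add]
            gcongr
            exact h a ((PMF.mem_support_iff _ _).2 ha) hta
    _ = p.pr t + ε := by
        rw [ENNReal.tsum_add, ENNReal.tsum_mul_right, PMF.tsum_coe, one_mul, pr,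
          PMF.toOuterMeasure_apply]

/-- The probability of an event under a uniform choice. -/
theorem pr_uniform [Fintype α] [Nonempty α] (s : α → Prop) [DecidablePred s] :
    (PMF.uniformOfFintype α).pr s = (Finset.univ.filter s).card / Fintype.card α := by
  rw [pr, PMF.toOuterMeasure_uniformOfFintype_apply, Fintype.card_subtype]
  rfl

end PMF

/-! ### Running a program on two oracle tables -/

/-- The table `T'` extends the table `T`. -/
def OTable.Le {lam : ℕ} (T T' : OTable lam) : Prop :=
  ∀ ctx x y, T ctx x = some y → T' ctx x = some y

theorem OTable.le_define {lam : ℕ} {T : OTable lam} {ctx x : ℕ} (h : T ctx x = none)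
    (y : Fin (2 ^ lam)) : T.Le (T.define ctx x y) := fun ctx' x' y' h' => by
  rw [OTable.define_apply, if_neg]
  · exact h'
  · rintro ⟨rfl, rfl⟩
    simp [h] at h'

theorem mem_support_oracleQuery {lam ctx x : ℕ} {T : OTable lam} {v : ℕ × OTable lam}
    (h : v ∈ (oracleQuery ctx x T).support) :
    v.2 = T ∨ T ctx x = none ∧ ∃ y, v = (y.val, T.define ctx x y) := by
  unfold oracleQuery at h
  cases hT : T ctx x with
  | some y =>
    rw [hT] at h
    exact .inl (congrArg Prod.snd (PMF.mem_support_pure.1 h))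
  | none =>
    rw [hT] at h
    obtain ⟨y, -, hy⟩ := PMF.mem_support_bind.1 h
    exact .inr ⟨rfl, y, PMF.mem_support_pure.1 hy⟩

theorem mem_support_oracleProgram {lam ctx x y : ℕ} {U : Finset ℕ} {T : OTable lam}
    {v : Bool × OTable lam} (h : v ∈ (oracleProgram U ctx x y T).support) :
    v.2 = T ∨ T ctx x = none ∧ ∃ y, v.2 = T.define ctx x y := by
  unfold oracleProgram at h
  split_ifs at h with h1 h2
  · exact .inr ⟨h2.2, ⟨y, h1⟩, congrArg Prod.snd (PMF.mem_support_pure.1 h)⟩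
  · exact .inl (congrArg Prod.snd (PMF.mem_support_pure.1 h))
  · exact .inl (congrArg Prod.snd (PMF.mem_support_pure.1 h))

/-- A property of configurations that survives every command survives a whole program.  A command
takes at least one step, and defines at most one new point of the oracle. -/
theorem Prog.exec_invariant {lam : ℕ} {U : Finset ℕ} {I : Config lam → Prop}
    (hsame : ∀ c m s, I c → c.steps < s → I ⟨m, c.table, s⟩)
    (hdef : ∀ c m s ctx x y, I c → c.steps < s → c.table ctx x = none →
      I ⟨m, c.table.define ctx x y, s⟩) (P : Prog) {c c' : Config lam} (hc : I c)
    (h : c' ∈ (P.exec U c).support) : I c' := by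
  induction P generalizing c c' with
  | skip =>
    obtain rfl := PMF.mem_support_pure.1 h
    exact hsame c _ _ hc (Nat.lt_succ_self _)
  | assign a i e =>
    obtain rfl := PMF.mem_support_pure.1 h
    exact hsame c _ _ hc (by omega)
  | seq P Q ihP ihQ =>
    obtain ⟨d, hd, h⟩ := PMF.mem_support_bind.1 h
    exact ihQ (ihP hc hd) h
  | ite e P Q ihP ihQ =>
    rw [Prog.exec_ite] at h
    split_ifs at h
    · exact ihP (hsame c _ _ hc (by omega)) h
    · exact ihQ (hsame c _ _ hc (by omega)) h
  | loop n P ih =>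
    have : ∀ (k : ℕ) (c : Config lam), I c → ∀ c' ∈ (iterM (P.exec U) k c).support, I c' := by
      intro k
      induction k with
      | zero =>
        intro c hc c' hc'
        obtain rfl := PMF.mem_support_pure.1 hc'
        exact hc
      | succ k ihk =>
        intro c hc c' hc'
        obtain ⟨d, hd, h⟩ := PMF.mem_support_bind.1 hc'
        exact ihk d (ih hc hd) c' h
    exact this _ _ (hsame c _ _ hc (by omega)) c' h
  | rand a i n =>
    obtain ⟨v, -, h⟩ := PMF.mem_support_bind.1 h
    obtain rfl := PMF.mem_support_pure.1 h
    exact hsame c _ _ hc (by omega)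
  | query a i ctx x =>
    obtain ⟨v, hv, h⟩ := PMF.mem_support_bind.1 h
    obtain rfl := PMF.mem_support_pure.1 h
    unfold Config.update
    obtain h1 | ⟨h0, y, rfl⟩ := mem_support_oracleQuery hv
    · rw [h1]; exact hsame c _ _ hc (by omega)
    · exact hdef c _ _ _ _ y hc (by omega) h0
  | program a i ctx x y =>
    obtain ⟨v, hv, h⟩ := PMF.mem_support_bind.1 h
    obtain rfl := PMF.mem_support_pure.1 h
    unfold Config.update
    obtain h1 | ⟨h0, y, h1⟩ := mem_support_oracleProgram hv
    · rw [h1]; exact hsame c _ _ hc (by omega)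
    · rw [h1]; exact hdef c _ _ _ _ y hc (by omega) h0

theorem Prog.exec_table_le {lam : ℕ} {U : Finset ℕ} (P : Prog) {c c' : Config lam}
    (h : c' ∈ (P.exec U c).support) : c.table.Le c'.table :=
  Prog.exec_invariant (I := fun d => c.table.Le d.table) (fun _ _ _ h _ => h)
    (fun _ _ _ _ _ y h _ h0 ctx x z hz => OTable.le_define h0 y ctx x z (h ctx x z hz)) P
    (fun _ _ _ h => h) h

/-- A program defines at most as many points of the oracle as it makes steps. -/
theorem Prog.exec_table_card {lam : ℕ} {U : Finset ℕ} (P : Prog) {x : List ℕ} {c : Config lam}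
    (h : c ∈ (P.exec U (startConfig lam x (emptyTable lam))).support) :
    ∃ E : Finset (ℕ × ℕ), E.card ≤ c.steps ∧ ∀ ctx x, c.table ctx x ≠ none → (ctx, x) ∈ E := by
  refine Prog.exec_invariant (I := fun c => ∃ E : Finset (ℕ × ℕ), E.card ≤ c.steps ∧
    ∀ ctx x, c.table ctx x ≠ none → (ctx, x) ∈ E) ?_ ?_ P ⟨∅, le_rfl, fun _ _ h => (h rfl).elim⟩ h
  · rintro c m s ⟨E, h1, h2⟩ hs
    exact ⟨E, h1.trans hs.le, h2⟩
  · rintro c m s ctx x y ⟨E, h1, h2⟩ hs -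
    refine ⟨insert (ctx, x) E, (Finset.card_insert_le _ _).trans (by
      simp only; omega), fun ctx' x' h => ?_⟩
    simp only [OTable.define_apply] at h
    split_ifs at h with h'
    · rw [h'.1, h'.2]; exact Finset.mem_insert_self _ _
    · exact Finset.mem_insert_of_mem (h2 _ _ h)

/-- A common defined point of two tables. -/
def OTable.Meets {lam : ℕ} (T T' : OTable lam) : Prop :=
  ∃ ctx x, T ctx x ≠ none ∧ T' ctx x ≠ none

theorem OTable.Meets.mono {lam : ℕ} {T T₁ T₂ : OTable lam} (h : T.Meets T₁) (hle : T₁.Le T₂) :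
    T.Meets T₂ := by
  obtain ⟨ctx, x, h1, h2⟩ := h
  obtain ⟨y, hy⟩ := Option.ne_none_iff_exists'.1 h2
  exact ⟨ctx, x, h1, by rw [hle _ _ _ hy]; exact Option.some_ne_none _⟩

/-- `d` is `c` with the additional oracle entries of `T`, unless a point of `T` has been defined
in `c` as well. -/
def SameUpTo {lam : ℕ} (T : OTable lam) (d c : Config lam) : Prop :=
  (d.mem = c.mem ∧ d.steps = c.steps ∧
    ∀ ctx x, d.table ctx x = (c.table ctx x).or (T ctx x)) ∨ T.Meets c.table

/-- A program runs in the same way with and without the oracle entries of `T`, until it touches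
one of them. -/
theorem Prog.exec_sameUpTo {lam : ℕ} (U : Finset ℕ) (T : OTable lam) (P : Prog) {d c : Config lam}
    (h : SameUpTo T d c) : Coupled (SameUpTo T) (P.exec U d) (P.exec U c) := by
  -- Once a point of `T` has been defined, it stays defined, and nothing remains to be shown.
  have bad : ∀ (P : Prog) (d c : Config lam), T.Meets c.table →
      Coupled (SameUpTo T) (P.exec U d) (P.exec U c) := fun P d c h =>
    Coupled.of_forall _ _ fun _ _ c' hc' => .inr (h.mono (P.exec_table_le hc'))
  induction P generalizing d c with
  | seq P Q ihP ihQ => exact (ihP h).bind fun _ _ h' => ihQ h'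
  | skip =>
    obtain ⟨hm, hs, hT⟩ | h := h
    · exact Coupled.pure (.inl ⟨hm, congrArg (· + 1) hs, hT⟩)
    · exact bad _ _ _ h
  | assign a i e =>
    obtain ⟨hm, hs, hT⟩ | h := h
    · simp only [Prog.exec, hm]
      exact Coupled.pure (.inl ⟨by simp [hm], by simp [hs], hT⟩)
    · exact bad _ _ _ h
  | ite e P Q ihP ihQ =>
    obtain ⟨hm, hs, hT⟩ | h := h
    · have h' : ∀ k, SameUpTo T (d.charge k) (c.charge k) := fun k =>
        .inl ⟨hm, congrArg (· + k) hs, hT⟩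
      simp only [Prog.exec, hm]
      split_ifs
      · exact ihP (h' _)
      · exact ihQ (h' _)
    · exact bad _ _ _ h
  | loop n P ih =>
    obtain ⟨hm, hs, hT⟩ | h := h
    · simp only [Prog.exec, hm]
      exact Coupled.iterM (fun _ _ h' => ih h') _ (.inl ⟨hm, congrArg (· + _) hs, hT⟩)
    · exact bad _ _ _ h
  | rand a i n =>
    obtain ⟨hm, hs, hT⟩ | h := h
    · simp only [Prog.exec_rand, hm]
      exact Coupled.bind_same _ fun v => Coupled.pure (.inl ⟨by simp [hm], by simp [hs], hT⟩)
    · exact bad _ _ _ h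
  | query a i ctx x =>
    obtain ⟨hm, hs, hT⟩ | h := h
    swap
    · exact bad _ _ _ h
    simp only [Prog.exec, hm, oracleQuery, hT]
    set cx := ctx.eval c.mem
    set xx := x.eval c.mem
    cases hc : c.table cx xx with
    | some y =>
      simp only [Option.some_or, LawfulMonad.pure_bind]
      exact Coupled.pure (.inl ⟨by simp [hm], by simp [hs], hT⟩)
    | none =>
      cases hTx : T cx xx with
      | none =>
        simp only [Option.none_or, bind_assoc, LawfulMonad.pure_bind]
        refine Coupled.bind_same _ fun y => Coupled.pure (.inl ⟨by simp [hm], by simp [hs],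
          fun ctx' x' => ?_⟩)
        simp only [Config.update, OTable.define_apply, hT]
        split_ifs <;> simp
      | some z =>
        -- The point is fresh on the right but already defined on the left: this is the bad event.
        refine Coupled.of_forall _ _ fun d' _ c' hc' => .inr ⟨cx, xx, by simp [hTx], ?_⟩
        simp only [bind_assoc, LawfulMonad.pure_bind] at hc'
        obtain ⟨y, -, hc'⟩ := PMF.mem_support_bind.1 hc'
        obtain rfl := PMF.mem_support_pure.1 hc'
        simp [Config.update, OTable.define_apply]
  | program a i ctx x y =>
    obtain ⟨hm, hs, hT⟩ | h := h
    swap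
    · exact bad _ _ _ h
    simp only [Prog.exec_program, hm]
    by_cases hTx : T (ctx.eval c.mem) (x.eval c.mem) = none
    · have hT' : d.table (ctx.eval c.mem) (x.eval c.mem) =
          c.table (ctx.eval c.mem) (x.eval c.mem) := by rw [hT, hTx, Option.or_none]
      simp only [hT']
      split_ifs with h1
      · refine Coupled.pure (.inl ⟨by simp [hm], by simp [hs], fun ctx' x' => ?_⟩)
        simp only [Config.update, OTable.define_apply, hT]
        split_ifs <;> simp
      · exact Coupled.pure (.inl ⟨by simp [hm], by simp [hs], hT⟩)
    · rw [dif_neg (fun h' => hTx (Option.or_eq_none_iff.1 ((hT _ _).symm.trans h'.2.1)).2)]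
      split_ifs with h1
      · exact Coupled.pure (.inr ⟨ctx.eval c.mem, x.eval c.mem, hTx, by
          simp [Config.update, OTable.define_apply]⟩)
      · exact Coupled.pure (.inl ⟨by simp [hm], by simp [hs], hT⟩)

theorem sameUpTo_start {lam : ℕ} (T : OTable lam) (x : List ℕ) :
    SameUpTo T (startConfig lam x T) (startConfig lam x (emptyTable lam)) :=
  .inl ⟨rfl, rfl, fun _ _ => rfl⟩

/-! ### Completeness of the Fischlin transform -/

open scoped ENNReal

theorem OracleComp.bind_apply {lam : ℕ} {α β : Type} (m : OracleComp lam α)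
    (f : α → OracleComp lam β) (T : OTable lam) :
    (m >>= f) T = m T >>= fun v => f v.1 v.2 := rfl

theorem OracleComp.pure_apply {lam : ℕ} {α : Type} (a : α) (T : OTable lam) :
    (pure a : OracleComp lam α) T = pure (a, T) := rfl

theorem PMF.pr_exists_mem_le {α β : Type} (p : PMF α) (E : Finset β) (s : β → α → Prop) {ε : ℝ≥0∞}
    (h : ∀ b ∈ E, p.pr (s b) ≤ ε) : p.pr (fun a => ∃ b ∈ E, s b a) ≤ E.card * ε := by
  have : {a | ∃ b ∈ E, s b a} = ⋃ b ∈ E, {a | s b a} := by ext; simp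
  rw [PMF.pr, this]
  refine (MeasureTheory.measure_biUnion_finset_le E _).trans ?_
  rw [← nsmul_eq_mul]
  exact Finset.sum_le_card_nsmul _ _ _ h

/-- Since `b ≤ lam`, the last `b` bits of a uniform `lam`-bit string are uniform. -/
theorem pr_uniform_mod_ne_zero_le {lam b : ℕ} (hb : b ≤ lam) :
    (PMF.uniformOfFintype (Fin (2 ^ lam))).pr (fun y => ¬ y.val % 2 ^ b = 0) ≤
      1 - (2 ^ b : ℝ≥0∞)⁻¹ := by
  rw [PMF.pr_uniform, Finset.filter_not, Finset.card_sdiff_of_subset (Finset.filter_subset _ _),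
    Finset.card_univ, Fintype.card_fin]
  have hcard : 2 ^ (lam - b) ≤
      (Finset.univ.filter fun y : Fin (2 ^ lam) => y.val % 2 ^ b = 0).card := by
    have hpow : 2 ^ (lam - b) * 2 ^ b = 2 ^ lam := by rw [← pow_add, Nat.sub_add_cancel hb]
    have := Finset.card_le_card_of_injOn (s := (Finset.univ : Finset (Fin (2 ^ (lam - b)))))
      (t := Finset.univ.filter fun y : Fin (2 ^ lam) => y.val % 2 ^ b = 0)
      (fun k => ⟨k.val * 2 ^ b, by
        rw [← hpow]; exact Nat.mul_lt_mul_of_pos_right k.2 (by positivity)⟩)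
      (fun k _ => by simp) (fun k _ k' _ h => by
        have := congrArg Fin.val h
        exact Fin.ext (Nat.eq_of_mul_eq_mul_right (by positivity) this))
    simpa using this
  calc (((2 ^ lam - (Finset.univ.filter fun y : Fin (2 ^ lam) => y.val % 2 ^ b = 0).card : ℕ) :
        ℝ≥0∞)) / ((2 ^ lam : ℕ) : ℝ≥0∞)
      ≤ ((2 ^ lam - 2 ^ (lam - b) : ℕ) : ℝ≥0∞) / ((2 ^ lam : ℕ) : ℝ≥0∞) := by gcongr
    _ = 1 - (2 ^ b : ℝ≥0∞)⁻¹ := by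
        rw [ENNReal.natCast_sub, ENNReal.sub_div (by simp), ENNReal.div_self (by simp) (by simp)]
        congr 1
        have : (2 ^ lam : ℕ) = 2 ^ (lam - b) * 2 ^ b := by rw [← pow_add, Nat.sub_add_cancel hb]
        rw [this]
        push_cast
        rw [ENNReal.div_eq_inv_mul, ENNReal.mul_inv (by simp) (by simp), mul_right_comm,
          ENNReal.inv_mul_cancel (by simp) (by simp), one_mul]

namespace FischlinSetup

section Search

variable {lam : ℕ} (ctx b : ℕ)

/-- The `b`-bit hash of the point `x e` of the oracle. -/
def pointHash (x : ℕ → ℕ) (e : ℕ) : OracleComp lam ℕ :=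
  oracleQuery ctx (x e) >>= fun y => pure (y % 2 ^ b)

/-- The table `T'` extends `T`, by points of context `ctx` that satisfy `X`. -/
def Extends (X : ℕ → Prop) (T T' : OTable lam) : Prop :=
  T.Le T' ∧ ∀ c x, T' c x ≠ none → T c x ≠ none ∨ c = ctx ∧ X x

variable {ctx b}

theorem Extends.refl (X : ℕ → Prop) (T : OTable lam) : Extends ctx X T T :=
  ⟨fun _ _ _ h => h, fun _ _ h => .inl h⟩

theorem Extends.trans {X : ℕ → Prop} {T T' T'' : OTable lam} (h : Extends ctx X T T')
    (h' : Extends ctx X T' T'') : Extends ctx X T T'' :=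
  ⟨fun c x y hy => h'.1 c x y (h.1 c x y hy), fun c x hx => (h'.2 c x hx).elim (h.2 c x) .inr⟩

theorem Extends.mono {X Y : ℕ → Prop} {T T' : OTable lam} (h : Extends ctx X T T')
    (hXY : ∀ x, X x → Y x) : Extends ctx Y T T' :=
  ⟨h.1, fun c x hx => (h.2 c x hx).imp id fun h => ⟨h.1, hXY _ h.2⟩⟩

theorem Extends.define {X : ℕ → Prop} {T : OTable lam} {x : ℕ} (h : T ctx x = none) (hx : X x)
    (y : Fin (2 ^ lam)) : Extends ctx X T (T.define ctx x y) := by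
  refine ⟨OTable.le_define h y, fun c x' h' => ?_⟩
  rw [OTable.define_apply] at h'
  split_ifs at h' with h1
  · exact .inr ⟨h1.1, h1.2 ▸ hx⟩
  · exact .inl h'

theorem pointHash_of_none {x : ℕ → ℕ} {e : ℕ} {T : OTable lam} (h : T ctx (x e) = none) :
    pointHash ctx b x e T = PMF.uniformOfFintype (Fin (2 ^ lam)) >>= fun y =>
      pure (y.val % 2 ^ b, T.define ctx (x e) y) := by
  simp only [pointHash, OracleComp.bind_apply, oracleQuery, h, bind_assoc, LawfulMonad.pure_bind,
    OracleComp.pure_apply]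

theorem pointHash_of_some {x : ℕ → ℕ} {e : ℕ} {T : OTable lam} {y : Fin (2 ^ lam)}
    (h : T ctx (x e) = some y) : pointHash ctx b x e T = pure (y.val % 2 ^ b, T) := by
  simp only [pointHash, OracleComp.bind_apply, oracleQuery, h, LawfulMonad.pure_bind,
    OracleComp.pure_apply]

/-- The search defines no points of the oracle but those it is about. -/
theorem extends_of_mem_support_raritySearch {x : ℕ → ℕ} {n e least best : ℕ} {T : OTable lam}
    {v : ℕ × OTable lam} (h : v ∈ (raritySearch (pointHash ctx b x) n e least best T).support) :
    Extends ctx (fun z => ∃ e, z = x e) T v.2 := by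
  induction n generalizing e least best T v with
  | zero =>
    obtain rfl := PMF.mem_support_pure.1 h
    exact Extends.refl _ _
  | succ n ih =>
    rw [raritySearch, OracleComp.bind_apply] at h
    obtain ⟨u, hu, h⟩ := PMF.mem_support_bind.1 h
    have hTu : Extends ctx (fun z => ∃ e, z = x e) T u.2 := by
      cases hT : T ctx (x e) with
      | some y =>
        rw [pointHash_of_some hT] at hu
        obtain rfl := PMF.mem_support_pure.1 hu
        exact Extends.refl _ _
      | none =>
        rw [pointHash_of_none hT] at hu
        obtain ⟨y, -, hu⟩ := PMF.mem_support_bind.1 hu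
        obtain rfl := PMF.mem_support_pure.1 hu
        exact Extends.define hT ⟨e, rfl⟩ y
    split_ifs at h
    · obtain rfl := PMF.mem_support_pure.1 h
      exact hTu
    · exact hTu.trans (ih h)
    · exact hTu.trans (ih h)

/-- At the point `x` the table has a value whose last `b` bits vanish. -/
def Vanishes (ctx b : ℕ) (T : OTable lam) (x : ℕ) : Prop :=
  ∃ y, T ctx x = some y ∧ y.val % 2 ^ b = 0

/-- On fresh points, the rarity search fails to find a vanishing hash with probability at most
`(1 - 2⁻ᵇ)ⁿ`. -/
theorem pr_raritySearch_le (hb : b ≤ lam) {x : ℕ → ℕ} (hx : x.Injective) {n e least best : ℕ}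
    {T : OTable lam} (hT : ∀ e', e ≤ e' → T ctx (x e') = none) :
    (raritySearch (pointHash ctx b x) n e least best T).pr
      (fun v => ¬ (v.1 < e + n ∧ Vanishes ctx b v.2 (x v.1))) ≤ (1 - (2 ^ b : ℝ≥0∞)⁻¹) ^ n := by
  induction n generalizing e least best T with
  | zero => simpa using PMF.pr_le_one _ _
  | succ n ih =>
    rw [raritySearch, OracleComp.bind_apply, pointHash_of_none (hT e le_rfl), bind_assoc]
    simp only [LawfulMonad.pure_bind]
    set ε := (1 - (2 ^ b : ℝ≥0∞)⁻¹) with hε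
    rw [PMF.pr_bind]
    calc _ ≤ ∑' y, ({y : Fin (2 ^ lam) | ¬ y.val % 2 ^ b = 0} : Set _).indicator
            (PMF.uniformOfFintype (Fin (2 ^ lam))) y * ε ^ n := by
          refine ENNReal.tsum_le_tsum fun y => ?_
          by_cases hy : y.val % 2 ^ b = 0
          · rw [if_pos hy, OracleComp.pure_apply, PMF.pr_pure_of_not, mul_zero]
            · exact zero_le
            · rw [not_not]
              exact ⟨by simp, y, by simp [OTable.define_apply], hy⟩
          · rw [if_neg hy, Set.indicator_of_mem (by exact hy)]
            gcongr
            have hT' : ∀ e', e + 1 ≤ e' → (T.define ctx (x e) y) ctx (x e') = none := by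
              intro e' he'
              rw [OTable.define_apply, if_neg]
              · exact hT e' (by omega)
              · rintro ⟨-, h⟩
                have := hx h
                omega
            have hlt : e + (n + 1) = e + 1 + n := by omega
            split_ifs <;> rw [hlt] <;> exact ih hT'
      _ = (PMF.uniformOfFintype (Fin (2 ^ lam))).pr (fun y => ¬ y.val % 2 ^ b = 0) * ε ^ n := by
          rw [ENNReal.tsum_mul_right, PMF.pr, PMF.toOuterMeasure_apply]
      _ ≤ ε * ε ^ n := by gcongr; exact pr_uniform_mod_ne_zero_le hb
      _ = ε ^ (n + 1) := (pow_succ' _ _).symm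

variable {ι R : Type}

theorem extends_of_mem_support_mapM {x : ι → ℕ → ℕ} {f : ι → ℕ → R} {n least : ℕ} {l : List ι}
    {T : OTable lam} {v : List R × OTable lam}
    (h : v ∈ ((l.mapM fun i => raritySearch (pointHash ctx b (x i)) n 0 least 0 >>= fun e =>
      pure (f i e)) T).support) : Extends ctx (fun z => ∃ i e, z = x i e) T v.2 := by
  induction l generalizing T v with
  | nil =>
    obtain rfl := PMF.mem_support_pure.1 h
    exact Extends.refl _ _
  | cons i l ih =>
    rw [List.mapM_cons, OracleComp.bind_apply] at h
    obtain ⟨u, hu, h⟩ := PMF.mem_support_bind.1 h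
    rw [OracleComp.bind_apply] at hu h
    obtain ⟨u', hu', hu⟩ := PMF.mem_support_bind.1 hu
    obtain rfl := PMF.mem_support_pure.1 hu
    obtain ⟨v', hv', h⟩ := PMF.mem_support_bind.1 h
    obtain rfl := PMF.mem_support_pure.1 h
    exact ((extends_of_mem_support_raritySearch hu').mono fun z hz => ⟨i, hz⟩).trans
      (ih (v := v') hv')

/-- If the searches of different indices concern different points, none of which is defined, then
all of them succeed, up to the sum of their failure probabilities. -/
theorem pr_mapM_raritySearch_le (hb : b ≤ lam) {x : ι → ℕ → ℕ}
    (hx : ∀ i e i' e', x i e = x i' e' → i = i' ∧ e = e') {f : ι → ℕ → R} {n least : ℕ}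
    {l : List ι} (hl : l.Nodup) {T : OTable lam} (hT : ∀ i ∈ l, ∀ e, T ctx (x i e) = none) :
    ((l.mapM fun i => raritySearch (pointHash ctx b (x i)) n 0 least 0 >>= fun e =>
      pure (f i e)) T).pr (fun v => ¬ ∃ ε : ι → ℕ, v.1 = l.map (fun i => f i (ε i)) ∧
        ∀ i ∈ l, ε i < n ∧ Vanishes ctx b v.2 (x i (ε i))) ≤
      l.length * (1 - (2 ^ b : ℝ≥0∞)⁻¹) ^ n := by
  classical
  induction l generalizing T with
  | nil =>
    rw [List.mapM_nil, OracleComp.pure_apply, PMF.pr_pure_of_not]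
    · exact zero_le
    · simp
  | cons i l ih =>
    obtain ⟨hil, hl⟩ := List.nodup_cons.1 hl
    rw [List.mapM_cons, bind_assoc, OracleComp.bind_apply, List.length_cons, Nat.cast_add,
      Nat.cast_one, add_mul, one_mul, add_comm]
    refine (PMF.pr_bind_le_add _ _ _ _ fun v hv hgood => ?_).trans (add_le_add_left
      (pr_raritySearch_le (e := 0) hb (fun e e' h => (hx _ _ _ _ h).2)
        fun e _ => hT i (by simp) e) _)
    rw [not_not] at hgood
    have hvT := extends_of_mem_support_raritySearch hv
    rw [LawfulMonad.pure_bind, OracleComp.bind_apply]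
    refine (PMF.pr_bind_le_add _ _ _ _ fun u hu hu' => ?_).trans (add_le_of_le_of_nonpos
      (ih hl (T := v.2) fun k hk e => ?_) le_rfl)
    · rw [not_not] at hu'
      obtain ⟨ε, h1, h2⟩ := hu'
      rw [OracleComp.pure_apply, PMF.pr_pure_of_not]
      rw [not_not]
      have hne : ∀ k ∈ l, Function.update ε i v.1 k = ε k := fun k hk =>
        Function.update_of_ne (fun h : k = i => hil (h ▸ hk)) _ _
      refine ⟨Function.update ε i v.1, ?_, ?_⟩
      · rw [List.map_cons, Function.update_self, h1]
        refine congrArg (List.cons _) ?_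
        exact List.map_congr_left fun k hk => by rw [hne k hk]
      · intro k hk
        rcases List.mem_cons.1 hk with rfl | hk
        · rw [Function.update_self]
          obtain ⟨h3, y, h4, h5⟩ := hgood
          exact ⟨by simpa using h3, y, (extends_of_mem_support_mapM hu).1 _ _ _ h4, h5⟩
        · rw [hne k hk]
          exact h2 k hk
    · by_contra hne
      rcases hvT.2 _ _ hne with h | ⟨-, e', h⟩
      · exact h (hT k (List.mem_cons_of_mem _ hk) e)
      · exact hil ((hx _ _ _ _ h).1 ▸ hk)

end Search

variable {F : GroupFamily} (Φ : FischlinSetup F) {lam : ℕ}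

/-- The point of the oracle at which the hash value of a repetition is taken. -/
def point (A B : F.G lam) (a : List (F.G lam × F.G lam)) (i e : ℕ) (z : F.Scalar lam) : ℕ :=
  Φ.code ([F.enc lam A, F.enc lam B] ++ a.flatMap (fun J => [F.enc lam J.1, F.enc lam J.2]) ++
      [i, e, z.val])

/-- Proofs can be recovered from their encoding, as every repetition takes four entries. -/
theorem encProof_injective : Function.Injective (encProof (F := F) (lam := lam)) := by
  intro π τ h
  induction π generalizing τ with
  | nil =>
    cases τ with
    | nil => rfl
    | cons d τ => simp [encProof] at h
  | cons c π ih =>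
    cases τ with
    | nil => simp [encProof] at h
    | cons d τ =>
      simp only [encProof, List.flatMap_cons, List.cons_append, List.nil_append,
        List.cons.injEq] at h
      obtain ⟨h1, h2, h3, h4, h5⟩ := h
      rw [ih h5]
      congr 1
      exact Prod.ext (F.enc_injective _ h1) (Prod.ext (F.enc_injective _ h2)
        (Prod.ext h3 (ZMod.val_injective _ h4)))

theorem verify_encProof (h A B : F.G lam) (π : List (Repetition F lam)) :
    Φ.verify h A B (encProof π) = Φ.verifyParsed h A B π := by
  have hex : ∃ τ : List (Repetition F lam), encProof τ = encProof π := ⟨π, rfl⟩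
  rw [verify, dif_pos hex, encProof_injective hex.choose_spec]

theorem mapM_apply_of_forall {α β : Type} {f : α → OracleComp lam β} {g : α → β} {T : OTable lam}
    (l : List α) (h : ∀ a ∈ l, f a T = pure (g a, T)) : l.mapM f T = pure (l.map g, T) := by
  induction l with
  | nil => rfl
  | cons a l ih =>
    rw [List.mapM_cons, OracleComp.bind_apply, h a (by simp), LawfulMonad.pure_bind,
      OracleComp.bind_apply, ih fun b hb => h b (List.mem_cons_of_mem _ hb),
      LawfulMonad.pure_bind, OracleComp.pure_apply, List.map_cons]

/-- The first messages of the prover. -/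
def firstMessages (h : F.G lam) (j : Fin (Φ.r lam) → F.Scalar lam) : List (F.G lam × F.G lam) :=
  List.ofFn fun i => (F.act (j i) (F.gen lam), F.act (j i) h)

/-- The point of the oracle that the prover queries in repetition `i` for challenge `e`. -/
def proverPoint (h A B : F.G lam) (w : F.Scalar lam) (j : Fin (Φ.r lam) → F.Scalar lam)
    (i : Fin (Φ.r lam)) (e : ℕ) : ℕ :=
  Φ.point A B (Φ.firstMessages h j) (i.val + 1) e (j i + e * w)

/-- A point of the prover determines all of its first messages and thereby all of its exponents. -/
theorem proverPoint_injective (h A B : F.G lam) (w : F.Scalar lam)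
    {j j' : Fin (Φ.r lam) → F.Scalar lam} {i i' : Fin (Φ.r lam)} {e e' : ℕ}
    (heq : Φ.proverPoint h A B w j i e = Φ.proverPoint h A B w j' i' e') :
    j = j' ∧ i = i' ∧ e = e' := by
  have h1 := Φ.code.injective heq
  simp only [List.append_assoc] at h1
  have h2 := List.append_cancel_left h1
  have hlen : ∀ a : List (F.G lam × F.G lam), (a.flatMap fun J =>
      [F.enc lam J.1, F.enc lam J.2]).length = 2 * a.length := by
    intro a
    induction a with
    | nil => rfl
    | cons J a ih => simp only [List.flatMap_cons, List.length_append, ih, List.length_cons,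
        List.length_nil]; omega
  obtain ⟨h3, h4⟩ := List.append_inj h2 (by simp only [hlen, firstMessages, List.length_ofFn])
  simp only [List.cons.injEq] at h4
  have h5 : ∀ a b : List (F.G lam × F.G lam),
      (a.flatMap fun J => [F.enc lam J.1, F.enc lam J.2]) =
        (b.flatMap fun J => [F.enc lam J.1, F.enc lam J.2]) → a = b := by
    intro a
    induction a with
    | nil => intro b hb; cases b with
      | nil => rfl
      | cons => simp at hb
    | cons J a ih => intro b hb; cases b with
      | nil => simp at hb
      | cons J' b =>
        simp only [List.flatMap_cons, List.cons_append, List.nil_append, List.cons.injEq] at hb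
        rw [ih b hb.2.2]
        congr 1
        exact Prod.ext (F.enc_injective _ hb.1) (F.enc_injective _ hb.2.1)
  have h6 := List.ofFn_injective (h5 _ _ h3)
  refine ⟨funext fun k => ?_, Fin.ext (by omega), h4.2.1⟩
  exact F.act_injective (F.gen_ne_zero lam) (congrArg Prod.fst (congrFun h6 k))

/-- The prover after the choice of its first messages. -/
def proveWith (h A B : F.G lam) (w : F.Scalar lam) (j : Fin (Φ.r lam) → F.Scalar lam) :
    OracleComp lam (List (Repetition F lam)) :=
  (List.finRange (Φ.r lam)).mapM fun i =>
    raritySearch (pointHash Φ.ctx (Φ.b lam) (Φ.proverPoint h A B w j i)) (2 ^ Φ.t lam) 0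
      (2 ^ Φ.b lam - 1) 0 >>= fun e =>
    pure (F.act (j i) (F.gen lam), F.act (j i) h, e, j i + e * w)

theorem prove_apply (h A B : F.G lam) (w : F.Scalar lam) (T : OTable lam) :
    Φ.prove h A B w T = PMF.uniformOfFintype (Fin (Φ.r lam) → F.Scalar lam) >>= fun j =>
      Φ.proveWith h A B w j T := by
  show (PMF.uniformOfFintype _ >>= fun j => pure (j, T)) >>= _ = _
  rw [bind_assoc]
  simp only [LawfulMonad.pure_bind]
  rfl

/-- If the prover has found a vanishing hash in every repetition, its proof is accepted. -/
theorem verify_of_vanishes {h : F.G lam} (hh : h ≠ 0) {w : F.Scalar lam} (hw : w ≠ 0)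
    (j : Fin (Φ.r lam) → F.Scalar lam) (ε : Fin (Φ.r lam) → ℕ) {T : OTable lam}
    (hε : ∀ i, ε i < 2 ^ Φ.t lam ∧ Vanishes Φ.ctx (Φ.b lam) T
      (Φ.proverPoint h (F.act w (F.gen lam)) (F.act w h) w j i (ε i))) :
    Φ.verify h (F.act w (F.gen lam)) (F.act w h) (encProof ((List.finRange (Φ.r lam)).map fun i =>
      (F.act (j i) (F.gen lam), F.act (j i) h, ε i, j i + ε i * w))) T = pure (true, T) := by
  rw [verify_encProof, verifyParsed]
  set π := (List.finRange (Φ.r lam)).map fun i =>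
      (F.act (j i) (F.gen lam), F.act (j i) h, ε i, j i + ε i * w) with hπ
  have hfirst : (π.map fun c => (c.1, c.2.1)) = Φ.firstMessages h j := by
    rw [hπ, List.map_map, firstMessages, List.ofFn_eq_map]
    rfl
  rw [OracleComp.bind_apply, mapM_apply_of_forall (g := fun _ => 0), LawfulMonad.pure_bind,
    OracleComp.pure_apply]
  · congr 2
    refine @decide_eq_true _ (_) ⟨by simp [hπ], fun c hc => ?_, by simp⟩
    obtain ⟨i, -, rfl⟩ := List.mem_map.1 hc
    refine ⟨F.act_ne_zero hw (F.gen_ne_zero lam), F.act_ne_zero hw hh, (hε i).1, ?_, ?_⟩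
    · simp only [F.act_add, ← F.natCast_act, F.act_mul]
    · simp only [F.act_add, ← F.natCast_act, F.act_mul]
  · rintro ⟨c, k⟩ hck
    rw [List.mem_zipIdx_iff_getElem?, List.getElem?_eq_some_iff] at hck
    obtain ⟨hk, hck⟩ := hck
    simp only [hπ, List.getElem_map, List.getElem_finRange] at hck
    obtain ⟨-, y, hy, hy0⟩ := hε ⟨k, by simpa [hπ] using hk⟩
    rw [hfirst]
    have := pointHash_of_some (b := Φ.b lam) (x := Φ.proverPoint h (F.act w (F.gen lam)) (F.act w h)
      w j ⟨k, by simpa [hπ] using hk⟩) hy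
    rw [hy0] at this
    rw [← this, ← hck]
    rfl

/-- A bound for the completeness error: `r` searches of `2 ^ t` attempts each, with success
probability `2⁻ᵇ` per attempt. -/
def error (lam : ℕ) : ℝ≥0∞ := Φ.r lam * (1 - (2 ^ Φ.b lam : ℝ≥0∞)⁻¹) ^ 2 ^ Φ.t lam

/-- Completeness in the strong form that the verifier accepts with certainty and without changing
the oracle table, with a failure probability over the run of the prover. -/
theorem pr_prove_not_verify_le {h : F.G lam} (hh : h ≠ 0) {w : F.Scalar lam} (hw : w ≠ 0) :
    (Φ.prove h (F.act w (F.gen lam)) (F.act w h) w (emptyTable lam)).pr (fun v =>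
      ¬ Φ.verify h (F.act w (F.gen lam)) (F.act w h) (encProof v.1) v.2 = pure (true, v.2)) ≤
      Φ.error lam := by
  rw [prove_apply]
  refine PMF.pr_bind_le _ _ _ fun j _ => ?_
  refine (PMF.pr_mono _ fun v _ hv => ?_).trans ((pr_mapM_raritySearch_le (ctx := Φ.ctx)
    (Φ.b_le lam) (x := Φ.proverPoint h (F.act w (F.gen lam)) (F.act w h) w j)
    (f := fun i e => (F.act (j i) (F.gen lam), F.act (j i) h, e, j i + e * w))
    (fun i e i' e' heq => (Φ.proverPoint_injective _ _ _ _ heq).2)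
    (List.nodup_finRange _) (T := emptyTable lam) fun _ _ _ => rfl).trans_eq ?_)
  · rintro ⟨ε, h1, h2⟩
    refine hv ?_
    rw [h1]
    exact Φ.verify_of_vanishes hh hw j ε fun i => h2 i (List.mem_finRange i)
  · rw [List.length_finRange, error]

/-- The prover is unlikely to query a given set of points of the oracle, since all of its queries
contain its first messages. -/
theorem pr_prove_meets_le (h A B : F.G lam) (w : F.Scalar lam) (E : Finset (ℕ × ℕ)) :
    (Φ.prove h A B w (emptyTable lam)).pr (fun v => ∃ c ∈ E, v.2 c.1 c.2 ≠ none) ≤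
      E.card * (F.p lam : ℝ≥0∞)⁻¹ := by
  classical
  rw [prove_apply]
  refine (PMF.pr_bind_le_add _ _ _ (fun j => ∃ c ∈ E, ∃ i e, c.2 = Φ.proverPoint h A B w j i e)
    (ε := 0) fun j _ hj => ?_).trans ?_
  · refine (PMF.pr_eq_zero _ fun v hv => ?_).le
    rintro ⟨c, hc, hcv⟩
    rcases (extends_of_mem_support_mapM hv).2 _ _ hcv with h | ⟨-, h⟩
    · exact h rfl
    · exact hj ⟨c, hc, h⟩
  · rw [add_zero]
    refine PMF.pr_exists_mem_le _ _ _ fun c _ => ?_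
    rw [PMF.pr_uniform]
    by_cases hex : ∃ j i e, c.2 = Φ.proverPoint h A B w j i e
    · obtain ⟨j, i, e, hj⟩ := hex
      have hcard : (Finset.univ.filter fun j' : Fin (Φ.r lam) → F.Scalar lam =>
          ∃ i e, c.2 = Φ.proverPoint h A B w j' i e).card ≤ 1 := by
        refine Finset.card_le_one.2 fun j₁ h₁ j₂ h₂ => ?_
        obtain ⟨i₁, e₁, h₁⟩ := (Finset.mem_filter.1 h₁).2
        obtain ⟨i₂, e₂, h₂⟩ := (Finset.mem_filter.1 h₂).2
        exact (Φ.proverPoint_injective h A B w (h₁.symm.trans h₂)).1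
      -- At most one choice out of `p ^ r` leads to the point, and `r` is positive as there is a
      -- repetition at all.
      have hr : Φ.r lam ≠ 0 := fun h0 => (Fin.cast h0 i).elim0
      have hp : F.p lam ≤ Fintype.card (Fin (Φ.r lam) → F.Scalar lam) := by
        rw [Fintype.card_fun, ZMod.card, Fintype.card_fin]
        exact Nat.le_self_pow hr _
      calc _ ≤ ((1 : ℕ) : ℝ≥0∞) / (F.p lam : ℝ≥0∞) := by gcongr
        _ = _ := by simp
    · rw [Finset.filter_false_of_mem fun j _ hj => hex ⟨j, hj⟩]
      simp

end FischlinSetup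

/-! ### Distance of Boolean experiments -/

open scoped ENNReal

/-- The probabilities of `true` differ by at most `ε`. -/
def Near (ε : ℝ≥0∞) (p q : PMF Bool) : Prop := p true ≤ q true + ε ∧ q true ≤ p true + ε

namespace Near

variable {α : Type} {ε δ : ℝ≥0∞} {p q r : PMF Bool}

theorem refl (p : PMF Bool) : Near 0 p p := ⟨le_self_add, le_self_add⟩

theorem mono (h : Near ε p q) (hle : ε ≤ δ) : Near δ p q :=
  ⟨h.1.trans (by gcongr), h.2.trans (by gcongr)⟩

theorem trans (h : Near ε p q) (h' : Near δ q r) : Near (ε + δ) p r := by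
  constructor
  · calc p true ≤ q true + ε := h.1
      _ ≤ r true + δ + ε := by gcongr; exact h'.1
      _ = r true + (ε + δ) := by ring
  · calc r true ≤ q true + δ := h'.2
      _ ≤ p true + ε + δ := by gcongr; exact h.2
      _ = p true + (ε + δ) := by ring

theorem one (p q : PMF Bool) : Near 1 p q :=
  ⟨(p.coe_le_one _).trans le_add_self, (q.coe_le_one _).trans le_add_self⟩

theorem abs_sub_le (h : Near ε p q) (hε : ε ≠ ∞) :
    |(p true).toReal - (q true).toReal| ≤ ε.toReal := by
  have key : ∀ {a b : ℝ≥0∞}, b ≠ ∞ → a ≤ b + ε → a.toReal ≤ b.toReal + ε.toReal := fun hb h => by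
    rw [← ENNReal.toReal_add hb hε]
    exact ENNReal.toReal_mono (ENNReal.add_ne_top.2 ⟨hb, hε⟩) h
  have h1 := key (q.apply_ne_top _) h.1
  have h2 := key (p.apply_ne_top _) h.2
  rw [abs_le]
  constructor <;> linarith

theorem bool_add (p : PMF Bool) : p true + p false = 1 := by
  have := p.tsum_coe
  rwa [tsum_fintype, Fintype.sum_bool] at this

/-- It suffices to bound both outcomes in one direction. -/
theorem of_le (h : ∀ b, q b ≤ p b + ε) : Near ε p q := by
  refine ⟨?_, h true⟩
  have h1 : p true + q false ≤ q true + ε + q false := by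
    calc p true + q false ≤ p true + (p false + ε) := by gcongr; exact h false
      _ = q true + ε + q false := by
        rw [← add_assoc, bool_add, ← bool_add q]; ring
  exact (ENNReal.add_le_add_iff_right (q.apply_ne_top _)).1 h1

/-- The error of the continuations is averaged over the outcomes of the first step. -/
theorem bind (p : PMF α) {f g : α → PMF Bool} (e : α → ℝ≥0∞)
    (h : ∀ a ∈ p.support, Near (e a) (f a) (g a)) :
    Near (∑' a, p a * e a) (p >>= f) (p >>= g) := by
  have key : ∀ {f g : α → PMF Bool}, (∀ a ∈ p.support, f a true ≤ g a true + e a) →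
      (p >>= f) true ≤ (p >>= g) true + ∑' a, p a * e a := fun {f g} h => by
    show (p.bind f) true ≤ (p.bind g) true + _
    rw [PMF.bind_apply, PMF.bind_apply, ← ENNReal.tsum_add]
    refine ENNReal.tsum_le_tsum fun a => ?_
    rw [← mul_add]
    by_cases ha : p a = 0
    · simp [ha]
    · gcongr
      exact h a ((PMF.mem_support_iff _ _).2 ha)
  exact ⟨key fun a ha => (h a ha).1, key fun a ha => (h a ha).2⟩

theorem bind_const (p : PMF α) {f g : α → PMF Bool} (h : ∀ a ∈ p.support, Near ε (f a) (g a)) :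
    Near ε (p >>= f) (p >>= g) := by
  have := bind p (fun _ => ε) h
  rwa [ENNReal.tsum_mul_right, PMF.tsum_coe, one_mul] at this

/-- Experiments that continue in the same way unless a bad event happens. -/
theorem bind_bad (p : PMF α) {f g : α → PMF Bool} (bad : α → Prop)
    (h : ∀ a ∈ p.support, ¬ bad a → f a = g a) : Near (p.pr bad) (p >>= f) (p >>= g) := by
  classical
  have := bind p (f := f) (g := g) (fun a => if bad a then 1 else 0) fun a ha => by
    split_ifs with hb
    · exact one _ _
    · rw [h a ha hb]; exact refl _
  refine this.mono (le_of_eq ?_)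
  rw [PMF.pr, PMF.toOuterMeasure_apply]
  refine tsum_congr fun a => ?_
  by_cases hb : bad a <;> simp [hb]

end Near

/-- Coupled experiments whose results agree unless a bad event happens on the right side. -/
theorem Coupled.near {α β : Type} {R : α → β → Prop} {p : PMF α} {q : PMF β}
    (h : Coupled R p q) {f : α → Bool} {g : β → Bool} {bad : β → Prop}
    (hR : ∀ a b, R a b → f a = g b ∨ bad b) : Near (q.pr bad) (f <$> p) (g <$> q) := by
  obtain ⟨w, rfl, rfl, hw⟩ := h
  rw [PMF.pr_map, Functor.map_map, Functor.map_map, map_eq_bind_pure_comp, map_eq_bind_pure_comp]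
  refine Near.bind_bad w _ fun ab hab hb => ?_
  exact congrArg Pure.pure ((hR _ _ (hw ab hab)).resolve_right hb)

/-! ### Sampling scalars -/

namespace GroupFamily

variable (F : GroupFamily) {lam : ℕ}

theorem sampleAvoiding_apply_of_not {a k : F.Scalar lam} (h : ¬ (k ≠ 0 ∧ k ≠ a)) :
    F.sampleAvoiding lam a k = 0 :=
  (PMF.apply_eq_zero_iff _ _).2 fun hk => h (F.ne_of_mem_support_sampleAvoiding hk)

theorem sampleAvoiding_apply {a k : F.Scalar lam} (h : k ≠ 0 ∧ k ≠ a) :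
    F.sampleAvoiding lam a k = ((Finset.univ \ {0, a} : Finset (F.Scalar lam)).card : ℝ≥0∞)⁻¹ := by
  classical
  have := F.exists_scalar a
  rw [sampleAvoiding, PMF.map_apply, tsum_eq_single ⟨k, h⟩]
  · rw [if_pos rfl, PMF.uniformOfFintype_apply, Fintype.card_subtype]
    congr 3
    ext x
    simp
  · rintro ⟨k', hk'⟩ hne
    rw [if_neg]
    rintro rfl
    exact hne rfl

theorem card_avoiding_le (a : F.Scalar lam) :
    (Finset.univ \ {0, a} : Finset (F.Scalar lam)).card ≤ F.p lam - 1 := by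
  have h1 : (Finset.univ \ {0, a} : Finset (F.Scalar lam)) ⊆ Finset.univ.erase 0 := by
    intro x hx
    simp only [Finset.mem_sdiff, Finset.mem_insert, Finset.mem_singleton, not_or] at hx
    simp [hx.2.1]
  refine (Finset.card_le_card h1).trans_eq ?_
  rw [Finset.card_erase_of_mem (Finset.mem_univ _), Finset.card_univ, ZMod.card]

theorem sampleUnit_apply {k : F.Scalar lam} (h : k ≠ 0) :
    F.sampleUnit lam k = ((F.p lam - 1 : ℕ) : ℝ≥0∞)⁻¹ := by
  rw [sampleUnit, sampleAvoiding_apply F ⟨h, h⟩, Finset.pair_eq_singleton,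
    Finset.card_sdiff_of_subset (Finset.subset_univ _), Finset.card_univ, ZMod.card,
    Finset.card_singleton]

theorem card_avoiding_of_ne {a : F.Scalar lam} (ha : a ≠ 0) :
    (Finset.univ \ {0, a} : Finset (F.Scalar lam)).card = F.p lam - 2 := by
  rw [Finset.card_sdiff_of_subset (Finset.subset_univ _), Finset.card_univ, ZMod.card,
    Finset.card_pair ha.symm]

/-- Pairs of units `(m, r)` with `m + r ≠ 0` are uniform in whichever order they are drawn. -/
theorem sampleUnit_bind_sampleAvoiding_comm {α : Type} (f : F.Scalar lam → F.Scalar lam → PMF α) :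
    (F.sampleUnit lam >>= fun m => F.sampleAvoiding lam (-m) >>= fun r => f m r) =
      F.sampleUnit lam >>= fun r => F.sampleAvoiding lam (-r) >>= fun m => f m r := by
  refine PMF.ext fun x => ?_
  show (PMF.bind _ fun m => PMF.bind _ fun r => f m r) x =
    (PMF.bind _ fun r => PMF.bind _ fun m => f m r) x
  simp only [PMF.bind_apply, ← ENNReal.tsum_mul_left]
  rw [ENNReal.tsum_comm]
  refine tsum_congr fun r => tsum_congr fun m => ?_
  rw [← mul_assoc, ← mul_assoc]
  congr 1
  -- Both sides vanish unless `m`, `r` and `m + r` are nonzero, in which case they agree.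
  by_cases hm : m = 0
  · subst hm
    rw [sampleUnit, F.sampleAvoiding_apply_of_not (a := 0) (k := 0) (by simp),
      F.sampleAvoiding_apply_of_not (a := -r) (k := 0) (by simp)]
    simp
  by_cases hr : r = 0
  · subst hr
    rw [sampleUnit, F.sampleAvoiding_apply_of_not (k := 0) (by simp),
      F.sampleAvoiding_apply_of_not (k := 0) (by simp)]
    simp
  rw [F.sampleUnit_apply hm, F.sampleUnit_apply hr]
  by_cases hmr : r = -m
  · rw [F.sampleAvoiding_apply_of_not (by simp [hmr]),
      F.sampleAvoiding_apply_of_not (by simp [hmr])]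
  · rw [F.sampleAvoiding_apply ⟨hr, hmr⟩,
      F.sampleAvoiding_apply ⟨hm, fun h => hmr (by rw [h, neg_neg])⟩,
      F.card_avoiding_of_ne (neg_ne_zero.2 hm), F.card_avoiding_of_ne (neg_ne_zero.2 hr)]

/-- Multiplication by a unit permutes the units. -/
theorem map_mul_sampleAvoiding {c : F.Scalar lam} (hc : c ≠ 0) (a : F.Scalar lam) :
    (fun k => c * k) <$> F.sampleAvoiding lam a = F.sampleAvoiding lam (c * a) := by
  have := F.exists_scalar a
  have := F.exists_scalar (c * a)
  let e : {k : F.Scalar lam // k ≠ 0 ∧ k ≠ a} ≃ {k : F.Scalar lam // k ≠ 0 ∧ k ≠ c * a} :=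
    (Equiv.mulLeft₀ c hc).subtypeEquiv fun k => by simp [hc]
  rw [sampleAvoiding, sampleAvoiding, ← map_uniformOfFintype_equiv e]
  show ((_ : PMF _).map _).map _ = ((_ : PMF _).map _).map _
  rw [PMF.map_comp, PMF.map_comp]
  rfl

/-- Drawing a scalar that avoids `a ≠ 0` is almost the same as drawing a unit. -/
theorem near_sampleAvoiding {a : F.Scalar lam} (ha : a ≠ 0) (f : F.Scalar lam → PMF Bool) :
    Near ((F.p lam - 1 : ℕ) : ℝ≥0∞)⁻¹ (F.sampleAvoiding lam a >>= f) (F.sampleUnit lam >>= f) := by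
  refine Near.of_le fun b => ?_
  show (PMF.bind _ f) b ≤ (PMF.bind _ f) b + _
  rw [PMF.bind_apply, PMF.bind_apply]
  -- Only the value `a` is more likely for a uniform unit than for a scalar that avoids `a`.
  calc ∑' k, F.sampleUnit lam k * f k b
      ≤ ∑' k, (F.sampleAvoiding lam a k * f k b +
          if k = a then ((F.p lam - 1 : ℕ) : ℝ≥0∞)⁻¹ else 0) := by
        refine ENNReal.tsum_le_tsum fun k => ?_
        by_cases hka : k = a
        · subst hka
          rw [if_pos rfl, F.sampleUnit_apply ha]
          calc _ ≤ ((F.p lam - 1 : ℕ) : ℝ≥0∞)⁻¹ * 1 := by gcongr; exact PMF.coe_le_one _ _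
            _ ≤ _ := by rw [mul_one]; exact le_add_self
        · rw [if_neg hka, add_zero]
          by_cases hk : k = 0
          · rw [sampleUnit, F.sampleAvoiding_apply_of_not (by simp [hk]), zero_mul]
            exact zero_le
          · rw [F.sampleUnit_apply hk, F.sampleAvoiding_apply ⟨hk, hka⟩]
            gcongr
            exact F.card_avoiding_le a
    _ = _ := by rw [ENNReal.tsum_add, tsum_ite_eq]

end GroupFamily

/-! ### The experiments -/

open scoped ENNReal

namespace OracleComp

variable {lam : ℕ} {α β : Type}

theorem run'_bind (m : OracleComp lam α) (f : α → OracleComp lam β) (T : OTable lam) :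
    (m >>= f).run' T = m T >>= fun v => (f v.1).run' v.2 := by
  show Prod.fst <$> (m T >>= fun v => f v.1 v.2) = _
  rw [_root_.map_bind]
  rfl

theorem lift_bind_apply (p : PMF α) (f : α → OracleComp lam β) (T : OTable lam) :
    (OracleComp.lift p >>= f) T = p >>= fun a => f a T := by
  show (p >>= fun a => pure (a, T)) >>= (fun q => f q.1 q.2) = _
  simp only [bind_assoc, LawfulMonad.pure_bind]

theorem run'_lift_bind (p : PMF α) (f : α → OracleComp lam β) (T : OTable lam) :
    (OracleComp.lift p >>= f).run' T = p >>= fun a => (f a).run' T := by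
  show Prod.fst <$> (OracleComp.lift p >>= f) T = _
  rw [lift_bind_apply, _root_.map_bind]
  rfl

end OracleComp

theorem PMF.bind_swap {α β γ : Type} (p : PMF α) (q : PMF β) (f : α → β → PMF γ) :
    (p >>= fun a => q >>= fun b => f a b) = q >>= fun b => p >>= fun a => f a b :=
  PMF.bind_comm p q f

namespace GroupFamily

variable (F : GroupFamily) {lam : ℕ}

theorem act_sub {X : F.G lam} (m r : F.Scalar lam) :
    F.act (m + r) X - F.act m X = F.act r X := by
  rw [F.act_add, add_sub_cancel_left]

/-- The input of a distinguisher for tags that belongs to the statement `(A, B)`, its proof `π`, and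
the scalar `ν`: the opening is `(ν A, B)`. -/
def tagInput (h A B : F.G lam) (ν : F.Scalar lam) (π : List ℕ) : List ℕ :=
  F.encPP h ++ [F.enc lam (F.act ν A + B)] ++ USV.encOpening (some (F.act ν A, B)) ++
    USV.encTag (⟨ν, F.act (ν + 1) A, π⟩ : USVTag F lam)

theorem tagTuple_accepts (D : Prog) (U : Finset ℕ) (h A B : F.G lam) (ν : F.Scalar lam)
    (π : List ℕ) :
    (F.tagTuple D).accepts U lam (F.encPP h ++ [F.enc lam A, F.enc lam B, ν.val] ++ π) =
      D.accepts U lam (F.tagInput h A B ν π) := by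
  have : (ν.val + 1) • A = F.act (ν + 1) A := by
    rw [F.act_add, F.act_one, add_nsmul, one_nsmul]; rfl
  rw [Prog.accepts, tagTuple_run, this]
  rfl

theorem sampleNu_accepts (Q : Prog) (U : Finset ℕ) (h A B : F.G lam) (π : List ℕ) :
    Q.sampleNu.accepts U lam (F.encPP h ++ [F.enc lam A, F.enc lam B] ++ π) =
      OracleComp.lift (F.sampleAvoiding lam (-1)) >>= fun ν =>
        Q.accepts U lam (F.encPP h ++ [F.enc lam A, F.enc lam B, ν.val] ++ π) := by
  rw [Prog.accepts, sampleNu_run, bind_assoc]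
  rfl

end GroupFamily

namespace USV

variable {F : GroupFamily} (Φ : FischlinSetup F) (St : TransparentSetup F) (D Sim : Prog) {lam : ℕ}

/-- The distinguisher `D` on an honest tag for the statement with witness `w`. -/
def honest (h : F.G lam) (w ν : F.Scalar lam) : PMF Bool :=
  Φ.prove h (F.act w (F.gen lam)) (F.act w h) w (emptyTable lam) >>= fun v =>
    (D.accepts Φ.programmable lam (F.tagInput h (F.act w (F.gen lam)) (F.act w h) ν
      (FischlinSetup.encProof v.1))).run' v.2

/-- The distinguisher `D` on a simulated tag for the statement `(A, B)`, the oracle table being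
`T` at the start. -/
def simulated (h A B : F.G lam) (ν : F.Scalar lam) (T : OTable lam) : PMF Bool :=
  ((F.simTuple Sim D).accepts Φ.programmable lam
    (F.encPP h ++ [F.enc lam A, F.enc lam B, ν.val])).run' T

/-- Running `simTuple` means running `D` on the tuple with a simulated proof. -/
theorem simTuple_accepts (h A B : F.G lam) (ν : F.Scalar lam) :
    (F.simTuple Sim D).accepts Φ.programmable lam
      (F.encPP h ++ [F.enc lam A, F.enc lam B, ν.val]) =
      Φ.simProof Sim h A B >>= fun π => D.accepts Φ.programmable lam (F.tagInput h A B ν π) := by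
  rw [Prog.accepts, F.simTuple_run, bind_assoc]
  refine bind_congr fun π => ?_
  rw [← F.tagTuple_accepts]
  rfl

/-! #### The zero-knowledge experiments -/

theorem zkReal_run' : (Φ.zkReal St (F.tagTuple D).sampleNu lam).run' (emptyTable lam) =
    St.sample lam >>= fun h => F.sampleUnit lam >>= fun w => F.sampleAvoiding lam (-1) >>= fun ν =>
      honest Φ D h w ν := by
  have : Φ.zkReal St (F.tagTuple D).sampleNu lam =
      OracleComp.lift (St.sample lam) >>= fun h => OracleComp.lift (F.sampleUnit lam) >>= fun w =>
        Φ.prove h (F.act w (F.gen lam)) (F.act w h) w >>= fun π =>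
          (F.tagTuple D).sampleNu.accepts Φ.programmable lam (F.encPP h ++
            [F.enc lam (F.act w (F.gen lam)), F.enc lam (F.act w h)] ++
              FischlinSetup.encProof π) := rfl
  rw [this]
  simp only [F.sampleNu_accepts, F.tagTuple_accepts, OracleComp.run'_lift_bind,
    OracleComp.run'_bind (Φ.prove _ _ _ _)]
  refine bind_congr fun h => bind_congr fun w => ?_
  rw [PMF.bind_swap]
  rfl

theorem zkSim_run' : (Φ.zkSim St Sim (F.tagTuple D).sampleNu lam).run' (emptyTable lam) =
    St.sample lam >>= fun h => F.sampleUnit lam >>= fun w => F.sampleAvoiding lam (-1) >>= fun ν =>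
      simulated Φ D Sim h (F.act w (F.gen lam)) (F.act w h) ν (emptyTable lam) := by
  have : Φ.zkSim St Sim (F.tagTuple D).sampleNu lam =
      OracleComp.lift (St.sample lam) >>= fun h => OracleComp.lift (F.sampleUnit lam) >>= fun w =>
        Φ.simProof Sim h (F.act w (F.gen lam)) (F.act w h) >>= fun π =>
          (F.tagTuple D).sampleNu.accepts Φ.programmable lam (F.encPP h ++
            [F.enc lam (F.act w (F.gen lam)), F.enc lam (F.act w h)] ++ π) := rfl
  rw [this]
  simp only [F.sampleNu_accepts, F.tagTuple_accepts, OracleComp.run'_lift_bind,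
    OracleComp.run'_bind (Φ.simProof _ _ _ _), simulated, simTuple_accepts]
  exact bind_congr fun h => bind_congr fun w => PMF.bind_swap _ _ _

/-! #### The DDLEQ adversary -/

/-- The DDLEQ adversary: simulate a tag for the given pair, and run `D` on it, with a simulated
oracle. -/
def adversary : Prog := (F.simTuple Sim D).sampleNu.internalized Φ.programmable

/-- The distinguisher `D` on a simulated tag for a uniform pair, which is a true statement if `b`
is `true`. -/
def ddleqWorld (lam : ℕ) (b : Bool) : PMF Bool :=
  St.sample lam >>= fun h => F.sampleUnit lam >>= fun r => F.sampleUnit lam >>= fun s =>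
    F.sampleAvoiding lam (-1) >>= fun ν =>
      simulated Φ D Sim h (F.act r (F.gen lam)) (if b then F.act r h else F.act s h) ν
        (emptyTable lam)

/-- The adversary starts with an empty oracle of its own, whatever the oracle of the game is. -/
theorem adversary_accepts (h A B : F.G lam) (T : OTable lam) :
    ((adversary Φ D Sim).accepts ∅ lam (F.encPP h ++ [F.enc lam A, F.enc lam B])).run' T =
      F.sampleAvoiding lam (-1) >>= fun ν => simulated Φ D Sim h A B ν (emptyTable lam) := by
  have key : ∀ (P : Prog) (U : Finset ℕ) (x : List ℕ) (T : OTable lam),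
      (P.accepts U lam x).run' T = (fun o => o == [1]) <$> Prod.fst <$> P.run U lam x T := by
    intro P U x T
    rw [Prog.accepts, OracleComp.run'_bind, Functor.map_map, map_eq_bind_pure_comp]
    refine bind_congr fun v => ?_
    show Prod.fst <$> (pure (v.1 == [1], v.2) : PMF (Bool × OTable lam)) = _
    rw [LawfulApplicative.map_pure]
    rfl
  rw [key, adversary, Prog.internalized_run, ← key]
  have := F.sampleNu_accepts (F.simTuple Sim D) Φ.programmable h A B []
  rw [List.append_nil] at this
  rw [this, OracleComp.run'_lift_bind]
  simp only [List.append_nil]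
  rfl

theorem ddleqGame_run' : (ddleqGame St (adversary Φ D Sim) lam).run' (emptyTable lam) =
    PMF.uniformOfFintype Bool >>= fun b => (fun g => g == b) <$> ddleqWorld Φ St D Sim lam b := by
  have : ddleqGame St (adversary Φ D Sim) lam =
      OracleComp.lift (St.sample lam) >>= fun h => OracleComp.lift (F.sampleUnit lam) >>= fun r =>
      OracleComp.lift (F.sampleUnit lam) >>= fun s =>
      OracleComp.lift (PMF.uniformOfFintype Bool) >>= fun b =>
        (fun g => g == b) <$> (adversary Φ D Sim).accepts ∅ lam (F.encPP h ++
          [F.enc lam (F.act r (F.gen lam)), F.enc lam (if b then F.act r h else F.act s h)]) := by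
    simp only [map_eq_bind_pure_comp]
    rfl
  have hmap : ∀ (f : Bool → Bool) (c : OracleComp lam Bool) (T : OTable lam),
      (f <$> c).run' T = f <$> c.run' T := fun f c T => by
    rw [map_eq_bind_pure_comp, OracleComp.run'_bind]
    show _ = f <$> Prod.fst <$> c T
    rw [Functor.map_map, map_eq_bind_pure_comp]
    refine bind_congr fun v => ?_
    show Prod.fst <$> (pure (f v.1, v.2) : PMF (Bool × OTable lam)) = _
    rw [LawfulApplicative.map_pure]
    rfl
  rw [this]
  simp only [OracleComp.run'_lift_bind, hmap, adversary_accepts, ddleqWorld, _root_.map_bind]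
  simp only [PMF.bind_swap (PMF.uniformOfFintype Bool)]

/-- The distinguishing advantage is twice the guessing advantage. -/
theorem ddleqGame_prob :
    |((ddleqWorld Φ St D Sim lam true) true).toReal -
      ((ddleqWorld Φ St D Sim lam false) true).toReal| =
      2 * |(ddleqGame St (adversary Φ D Sim) lam).prob - 1 / 2| := by
  rw [OracleComp.prob, ddleqGame_run']
  set q := ddleqWorld Φ St D Sim lam
  have h1 : (PMF.uniformOfFintype Bool >>= fun b => (fun g => g == b) <$> q b) true =
      2⁻¹ * q true true + 2⁻¹ * q false false := by
    show (PMF.bind _ fun b => PMF.map (fun g => g == b) (q b)) true = _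
    rw [PMF.bind_apply, tsum_bool, add_comm]
    simp [PMF.map_apply]
  have h2 : (q false false).toReal = 1 - (q false true).toReal := by
    have := congrArg ENNReal.toReal (Near.bool_add (q false))
    rw [ENNReal.toReal_add (PMF.apply_ne_top _ _) (PMF.apply_ne_top _ _),
      ENNReal.toReal_one] at this
    linarith
  rw [h1, ENNReal.toReal_add (ENNReal.mul_ne_top (by simp) (PMF.apply_ne_top _ _))
    (ENNReal.mul_ne_top (by simp) (PMF.apply_ne_top _ _)), ENNReal.toReal_mul,
    ENNReal.toReal_mul, h2, ← abs_two, ← abs_mul, abs_two]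
  congr 1
  simp
  ring

/-! #### The real and the simulated game -/

/-- An honest tag derives the honest opening. -/
theorem derive_honest {h : F.G lam} {m r : F.Scalar lam} (hr : r ≠ 0) (hrm : r ≠ -m) (π : List ℕ) :
    derive (F.act m (F.gen lam) + F.act r h)
        (⟨m * r⁻¹, F.act (m + r) (F.gen lam), π⟩ : USVTag F lam) =
      some (F.act m (F.gen lam), F.act r h) := by
  have hmr : m + r ≠ 0 := fun h0 => hrm (eq_neg_of_add_eq_zero_right h0)
  have h1 : m * r⁻¹ + 1 = (m + r) * r⁻¹ := by rw [add_mul, mul_inv_cancel₀ hr]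
  rw [derive, if_neg]
  · have h2 : F.act (m * r⁻¹ * (m * r⁻¹ + 1)⁻¹) (F.act (m + r) (F.gen lam)) =
        F.act m (F.gen lam) := by
      rw [← F.act_mul, h1]
      congr 1
      field_simp
    simp only [h2, add_sub_cancel_left]
  · intro h0
    have h0 : m * r⁻¹ = -1 := h0
    have : m * r⁻¹ + 1 = 0 := by rw [h0, neg_add_cancel]
    rw [h1] at this
    exact mul_ne_zero hmr (inv_ne_zero hr) this

/-- If the proof of an honest tag is accepted, the tag opens to the honest opening. -/
theorem openCert_honest {h : F.G lam} {m r : F.Scalar lam} (hr : r ≠ 0) (hrm : r ≠ -m) (π : List ℕ)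
    {T : OTable lam} (hv : Φ.verify h (F.act r (F.gen lam)) (F.act r h) π T = pure (true, T)) :
    openCert Φ h (F.act m (F.gen lam) + F.act r h)
      (⟨m * r⁻¹, F.act (m + r) (F.gen lam), π⟩ : USVTag F lam) T =
      pure (some (F.act m (F.gen lam), F.act r h), T) := by
  rw [openCert, vcert, derive_honest hr hrm π]
  simp only [F.act_sub, add_sub_cancel_left]
  rw [OracleComp.bind_apply, hv, LawfulMonad.pure_bind]
  rfl

/-- The real game in terms of the scalars `m` and `r`, with the distributions in the order in which
they are drawn. -/
theorem realGame_run' : (realGame Φ St D lam).run' (emptyTable lam) =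
    St.sample lam >>= fun h => F.sampleUnit lam >>= fun m => F.sampleAvoiding lam (-m) >>= fun r =>
      Φ.prove h (F.act r (F.gen lam)) (F.act r h) r (emptyTable lam) >>= fun v =>
        openCert Φ h (F.act m (F.gen lam) + F.act r h)
          ⟨m * r⁻¹, F.act (m + r) (F.gen lam), FischlinSetup.encProof v.1⟩ v.2 >>= fun o =>
        (D.accepts Φ.programmable lam (F.encPP h ++ [F.enc lam (F.act m (F.gen lam) + F.act r h)] ++
          encOpening o.1 ++ encTag (⟨m * r⁻¹, F.act (m + r) (F.gen lam),
            FischlinSetup.encProof v.1⟩ : USVTag F lam))).run' o.2 := by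
  have : realGame Φ St D lam =
      OracleComp.lift (St.sample lam) >>= fun h => OracleComp.lift (F.sampleUnit lam) >>= fun m =>
      (OracleComp.lift (F.sampleAvoiding lam (-m)) >>= fun r =>
        Φ.prove h (F.act (m + r) (F.gen lam) - F.act m (F.gen lam))
          (F.act m (F.gen lam) + F.act r h - F.act m (F.gen lam)) r >>= fun π =>
        pure (F.act m (F.gen lam) + F.act r h,
          (⟨m * r⁻¹, F.act (m + r) (F.gen lam), FischlinSetup.encProof π⟩ : USVTag F lam))) >>=
      fun c =>
      openCert Φ h c.1 c.2 >>= fun o =>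
        D.accepts Φ.programmable lam (F.encPP h ++ [F.enc lam c.1] ++ encOpening o ++ encTag c.2) :=
    rfl
  rw [this]
  simp only [bind_assoc, LawfulMonad.pure_bind, F.act_sub, add_sub_cancel_left,
    OracleComp.run'_lift_bind, OracleComp.run'_bind (Φ.prove _ _ _ _),
    OracleComp.run'_bind (openCert _ _ _ _)]

/-- The honest prover, and then a simulated tag for the opening `(m G, r H)` on the resulting oracle
table: the statement for `ν` is `(ν⁻¹ m G, r H)`. -/
def afterProof (h : F.G lam) (m r : F.Scalar lam) : PMF Bool :=
  Φ.prove h (F.act r (F.gen lam)) (F.act r h) r (emptyTable lam) >>= fun v =>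
    F.sampleAvoiding lam (-1) >>= fun ν =>
      simulated Φ D Sim h (F.act (ν⁻¹ * m) (F.gen lam)) (F.act r h) ν v.2

/-- The simulated game in terms of the scalars `m` and `r`. -/
theorem simGame_run' : (simGame Φ St (fun _ => simCert Φ Sim) D lam).run' (emptyTable lam) =
    St.sample lam >>= fun h => F.sampleUnit lam >>= fun m => F.sampleAvoiding lam (-m) >>= fun r =>
      Φ.prove h (F.act r (F.gen lam)) (F.act r h) r (emptyTable lam) >>= fun v =>
        openCert Φ h (F.act m (F.gen lam) + F.act r h)
          ⟨m * r⁻¹, F.act (m + r) (F.gen lam), FischlinSetup.encProof v.1⟩ v.2 >>= fun o =>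
        (simCert Φ Sim h (F.act m (F.gen lam) + F.act r h) o.1 >>= fun ζ =>
          D.accepts Φ.programmable lam (F.encPP h ++
            [F.enc lam (F.act m (F.gen lam) + F.act r h)] ++ encOpening o.1 ++
              encTag ζ)).run' o.2 := by
  have : simGame Φ St (fun _ => simCert Φ Sim) D lam =
      OracleComp.lift (St.sample lam) >>= fun h => OracleComp.lift (F.sampleUnit lam) >>= fun m =>
      (OracleComp.lift (F.sampleAvoiding lam (-m)) >>= fun r =>
        Φ.prove h (F.act (m + r) (F.gen lam) - F.act m (F.gen lam))
          (F.act m (F.gen lam) + F.act r h - F.act m (F.gen lam)) r >>= fun π =>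
        pure (F.act m (F.gen lam) + F.act r h,
          (⟨m * r⁻¹, F.act (m + r) (F.gen lam), FischlinSetup.encProof π⟩ : USVTag F lam))) >>=
      fun c =>
      openCert Φ h c.1 c.2 >>= fun o => simCert Φ Sim h c.1 o >>= fun ζ =>
        D.accepts Φ.programmable lam (F.encPP h ++ [F.enc lam c.1] ++ encOpening o ++ encTag ζ) :=
    rfl
  rw [this]
  simp only [bind_assoc, LawfulMonad.pure_bind, F.act_sub, add_sub_cancel_left,
    OracleComp.run'_lift_bind, OracleComp.run'_bind (Φ.prove _ _ _ _),
    OracleComp.run'_bind (openCert _ _ _ _)]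

/-- The tag simulator on an opening `(M, R)`: it simulates a proof for `(ν⁻¹ M, R)`. -/
theorem simCert_bind (h M R : F.G lam) {α : Type} (f : USVTag F lam → OracleComp lam α) :
    simCert Φ Sim h (M + R) (some (M, R)) >>= f =
      OracleComp.lift (F.sampleAvoiding lam (-1)) >>= fun ν =>
        Φ.simProof Sim h (F.act ν⁻¹ M) R >>= fun π => f ⟨ν, F.act (1 + ν⁻¹) M, π⟩ := by
  have : simCert Φ Sim h (M + R) (some (M, R)) =
      OracleComp.lift (F.sampleAvoiding lam (-1)) >>= fun ν =>
        Φ.simProof Sim h (F.act (1 + ν⁻¹) M - M) (M + R - M) >>= fun π =>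
          pure ⟨ν, F.act (1 + ν⁻¹) M, π⟩ := rfl
  rw [this, bind_assoc]
  refine bind_congr fun ν => ?_
  have h1 : F.act (1 + ν⁻¹) M - M = F.act ν⁻¹ M := by
    rw [F.act_add, F.act_one, add_sub_cancel_left]
  rw [h1, add_sub_cancel_left, bind_assoc]
  simp only [LawfulMonad.pure_bind]

/-- The real experiment differs from the zero-knowledge experiment by the completeness error: the
scalars `(m, r)` and `(ν, w) = (m / r, r)` have corresponding distributions. -/
theorem near_realGame (hne : ∀ h ∈ (St.sample lam).support, h ≠ 0) :
    Near (Φ.error lam) ((realGame Φ St D lam).run' (emptyTable lam))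
      ((Φ.zkReal St (F.tagTuple D).sampleNu lam).run' (emptyTable lam)) := by
  rw [realGame_run', zkReal_run']
  refine Near.bind_const _ fun h hh => ?_
  -- Draw `r` first, and then `m = r ν`.
  rw [F.sampleUnit_bind_sampleAvoiding_comm]
  refine Near.bind_const _ fun r hr => ?_
  have hr0 := (F.ne_of_mem_support_sampleAvoiding hr).1
  have hmap : F.sampleAvoiding lam (-r) = (fun k => r * k) <$> F.sampleAvoiding lam (-1) := by
    rw [F.map_mul_sampleAvoiding hr0, mul_neg_one]
  rw [hmap, bind_map_left]
  refine Near.bind_const _ fun ν hν => ?_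
  obtain ⟨hν0, hν1⟩ := F.ne_of_mem_support_sampleAvoiding hν
  refine (Near.bind_bad _ _ fun v hv hgood => ?_).mono
    (Φ.pr_prove_not_verify_le (hne h hh) hr0)
  rw [not_not] at hgood
  have hrm : r ≠ -(r * ν) := fun h0 => hν1 (by
    have : r * (ν + 1) = 0 := by linear_combination h0
    exact eq_neg_of_add_eq_zero_left ((mul_eq_zero.1 this).resolve_left hr0))
  rw [openCert_honest Φ hr0 hrm _ hgood, LawfulMonad.pure_bind]
  have e1 : r * ν * r⁻¹ = ν := by field_simp
  have e2 : F.act (r * ν) (F.gen lam) = F.act ν (F.act r (F.gen lam)) := by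
    rw [← F.act_mul, mul_comm]
  have e3 : F.act (r * ν + r) (F.gen lam) = F.act (ν + 1) (F.act r (F.gen lam)) := by
    rw [← F.act_mul]; congr 1; ring
  rw [GroupFamily.tagInput, e1, e2, e3]

/-- Up to the completeness error, the tag simulator runs on the honest opening. -/
theorem near_simGame (hne : ∀ h ∈ (St.sample lam).support, h ≠ 0) :
    Near (Φ.error lam) ((simGame Φ St (fun _ => simCert Φ Sim) D lam).run' (emptyTable lam))
      (St.sample lam >>= fun h => F.sampleUnit lam >>= fun m =>
        F.sampleAvoiding lam (-m) >>= fun r =>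
        afterProof Φ D Sim h m r) := by
  rw [simGame_run']
  refine Near.bind_const _ fun h hh => Near.bind_const _ fun m hm =>
    Near.bind_const _ fun r hr => ?_
  obtain ⟨hr0, hrm⟩ := F.ne_of_mem_support_sampleAvoiding hr
  refine (Near.bind_bad _ _ fun v hv hgood => ?_).mono
    (Φ.pr_prove_not_verify_le (hne h hh) hr0)
  rw [not_not] at hgood
  rw [openCert_honest Φ hr0 hrm _ hgood, LawfulMonad.pure_bind, simCert_bind,
    OracleComp.run'_lift_bind]
  refine PMF.bind_congr_support fun ν hν => ?_
  obtain ⟨hν0, hν1⟩ := F.ne_of_mem_support_sampleAvoiding hν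
  rw [simulated, simTuple_accepts, F.act_mul]
  have e1 : F.act ν (F.act ν⁻¹ (F.act m (F.gen lam))) = F.act m (F.gen lam) := by
    rw [← F.act_mul, mul_inv_cancel₀ hν0, F.act_one]
  have e2 : F.act (ν + 1) (F.act ν⁻¹ (F.act m (F.gen lam))) =
      F.act (1 + ν⁻¹) (F.act m (F.gen lam)) := by
    rw [← F.act_mul]; congr 1; field_simp
  simp only [GroupFamily.tagInput, e1, e2]

/-- The entries that an honest proof leaves in the oracle table are unlikely to be touched by a
simulated tag. -/
theorem near_simulated_prove (h A B : F.G lam) (ν r : F.Scalar lam) {Q : ℕ}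
    (hQ : ∀ c ∈ ((F.simTuple Sim D).exec Φ.programmable (startConfig lam
      (F.encPP h ++ [F.enc lam A, F.enc lam B, ν.val]) (emptyTable lam))).support, c.steps ≤ Q) :
    Near (Q * (F.p lam : ℝ≥0∞)⁻¹)
      (Φ.prove h (F.act r (F.gen lam)) (F.act r h) r (emptyTable lam) >>= fun v =>
        simulated Φ D Sim h A B ν v.2)
      (simulated Φ D Sim h A B ν (emptyTable lam)) := by
  set x := F.encPP h ++ [F.enc lam A, F.enc lam B, ν.val] with hx
  set p := Φ.prove h (F.act r (F.gen lam)) (F.act r h) r (emptyTable lam) with hp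
  set q := (F.simTuple Sim D).exec Φ.programmable (startConfig lam x (emptyTable lam)) with hq
  have hsim : ∀ T, simulated Φ D Sim h A B ν T = (fun c => c.output == [1]) <$>
      (F.simTuple Sim D).exec Φ.programmable (startConfig lam x T) := fun T => by
    rw [simulated, Prog.accepts, OracleComp.run'_bind, Prog.run, map_eq_bind_pure_comp, bind_assoc]
    refine bind_congr fun c => ?_
    rw [LawfulMonad.pure_bind]
    show Prod.fst <$> (pure (c.output == [1], c.table) : PMF (Bool × OTable lam)) = _
    rw [LawfulApplicative.map_pure]
    rfl
  have hconst : (p >>= fun _ => simulated Φ D Sim h A B ν (emptyTable lam)) =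
      simulated Φ D Sim h A B ν (emptyTable lam) := PMF.bind_const p _
  rw [← hconst]
  refine (Near.bind p (fun v => q.pr fun c => v.2.Meets c.table) fun v _ => ?_).mono ?_
  · rw [hsim, hsim]
    refine ((F.simTuple Sim D).exec_sameUpTo Φ.programmable v.2 (sameUpTo_start v.2 x)).near
      fun a b hab => ?_
    rcases hab with ⟨hm, -, -⟩ | hab
    · left
      simp only [Config.output, hm]
    · exact .inr hab
  -- Fix the points that the simulated tag touches first, and run the prover afterwards.
  · have hswap : (p >>= fun v => q >>= fun c => pure (v, c)) =
        q >>= fun c => p >>= fun v => pure (v, c) := PMF.bind_swap _ _ _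
    calc _ = (p >>= fun v => q >>= fun c => pure (v, c)).pr
            (fun vc => vc.1.2.Meets vc.2.table) := by
          rw [PMF.pr_bind]
          exact tsum_congr fun v => congrArg _ (PMF.pr_map q (fun c => (v, c))
            (fun vc => vc.1.2.Meets vc.2.table)).symm
      _ ≤ Q * (F.p lam : ℝ≥0∞)⁻¹ := by
          rw [hswap]
          refine PMF.pr_bind_le _ _ _ fun c hc => ?_
          obtain ⟨E, hE, hcE⟩ := Prog.exec_table_card _ hc
          refine (PMF.pr_map p (fun v => (v, c)) _).trans_le ?_
          refine ((p.pr_mono fun v _ hv => ?_).trans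
            (Φ.pr_prove_meets_le h _ _ r E)).trans ?_
          · obtain ⟨ctx, y, h1, h2⟩ := hv
            exact ⟨(ctx, y), hcE _ _ h2, h1⟩
          · gcongr
            exact hE.trans (hQ c hc)

/-- After an honest proof, the simulated tag is distributed almost as in the DDLEQ experiment with a
random statement. -/
theorem near_afterProof {Q : ℕ} (hQ : ∀ (h A B : F.G lam) (ν : F.Scalar lam),
    ∀ c ∈ ((F.simTuple Sim D).exec Φ.programmable (startConfig lam
      (F.encPP h ++ [F.enc lam A, F.enc lam B, ν.val]) (emptyTable lam))).support, c.steps ≤ Q) :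
    Near (((F.p lam - 1 : ℕ) : ℝ≥0∞)⁻¹ + Q * (F.p lam : ℝ≥0∞)⁻¹)
      (St.sample lam >>= fun h => F.sampleUnit lam >>= fun m =>
        F.sampleAvoiding lam (-m) >>= fun r =>
        afterProof Φ D Sim h m r)
      (ddleqWorld Φ St D Sim lam false) := by
  -- For fixed `ν`, the unit `ν⁻¹ m` is uniform if `m` is.
  have hworld : ddleqWorld Φ St D Sim lam false =
      St.sample lam >>= fun h => F.sampleUnit lam >>= fun m => F.sampleUnit lam >>= fun r =>
        F.sampleAvoiding lam (-1) >>= fun ν =>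
          simulated Φ D Sim h (F.act (ν⁻¹ * m) (F.gen lam)) (F.act r h) ν (emptyTable lam) := by
    refine bind_congr fun h => ?_
    simp only [PMF.bind_swap (F.sampleUnit lam) (F.sampleAvoiding lam (-1))]
    refine PMF.bind_congr_support fun ν hν => ?_
    have hν0 := (F.ne_of_mem_support_sampleAvoiding hν).1
    have hmap : F.sampleUnit lam = (fun k => ν⁻¹ * k) <$> F.sampleUnit lam := by
      rw [GroupFamily.sampleUnit, F.map_mul_sampleAvoiding (inv_ne_zero hν0), mul_zero]
    exact (congrArg (· >>= _) hmap).trans (bind_map_left _ _ _)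
  rw [hworld]
  refine Near.bind_const _ fun h _ => Near.bind_const _ fun m hm => ?_
  have hm0 := (F.ne_of_mem_support_sampleAvoiding hm).1
  refine (F.near_sampleAvoiding (neg_ne_zero.2 hm0) _).trans (Near.bind_const _ fun r _ => ?_)
  rw [afterProof, PMF.bind_swap]
  exact Near.bind_const _ fun ν _ => near_simulated_prove Φ D Sim h _ _ ν r (hQ h _ _ ν)

end USV

/-! ### Negligible errors -/

open scoped ENNReal Topology

/-- The order grows exponentially, since its bit length grows at least linearly. -/
theorem GroupFamily.negligible_inv_p (F : GroupFamily) :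
    Negligible fun lam => ((F.p lam : ℝ))⁻¹ := by
  obtain ⟨C, hC, hbound⟩ := F.size_theta.2.exists_pos
  -- If `lam ≤ C * clog₂ p`, then `a ^ lam = 2 ^ (-lam / C) ≥ 1 / (2 ^ clog₂ p) ≥ 1 / (2 p)`.
  set a : ℝ := (2 : ℝ) ^ (-C⁻¹) with ha
  have ha0 : 0 < a := by positivity
  have ha1 : a < 1 := Real.rpow_lt_one_of_one_lt_of_neg (by norm_num) (by simpa using hC)
  have hdecay : Negligible fun lam : ℕ => 2 * a ^ lam :=
    SuperpolynomialDecay.const_mul (f := fun lam : ℕ => a ^ lam)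
      (fun k => tendsto_pow_const_mul_const_pow_of_abs_lt_one k
        (by rwa [abs_of_pos ha0])) 2
  refine hdecay.trans_eventually_abs_le ?_
  filter_upwards [hbound.bound] with lam hlam
  simp only [Real.norm_natCast] at hlam
  have hp : (0 : ℝ) < F.p lam := by exact_mod_cast (F.prime lam).pos
  simp only [Function.comp]
  rw [abs_of_pos (inv_pos.2 hp), abs_of_pos (by positivity)]
  have h1 : 2 ^ (Nat.clog 2 (F.p lam)) ≤ 2 * F.p lam := by
    have h2 := Nat.pow_pred_clog_lt_self (b := 2) (by norm_num) (x := F.p lam)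
      (by have := F.three_lt lam; omega)
    have h3 : Nat.clog 2 (F.p lam) ≠ 0 := (Nat.clog_pos (by norm_num)
      (by have := F.three_lt lam; omega)).ne'
    rw [← Nat.succ_pred_eq_of_ne_zero h3, pow_succ]
    omega
  have h2 : (2 : ℝ) ^ (Nat.clog 2 (F.p lam)) ≤ 2 * F.p lam := by exact_mod_cast h1
  have h3 : a ^ lam * (2 : ℝ) ^ (Nat.clog 2 (F.p lam)) ≥ 1 := by
    rw [ha, ← Real.rpow_natCast, ← Real.rpow_natCast, ← Real.rpow_mul (by norm_num),
      ← Real.rpow_add (by norm_num)]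
    refine Real.one_le_rpow (by norm_num) ?_
    have : C⁻¹ * lam ≤ Nat.clog 2 (F.p lam) := by rwa [inv_mul_le_iff₀ hC]
    linarith
  rw [inv_le_iff_one_le_mul₀ hp]
  nlinarith [pow_pos ha0 lam]

/-- The error is at most `r * exp (-2 ^ (t - b))`, where `r = O(log lam)` and `2 ^ (t - b)`
eventually exceeds every multiple of `log lam`. -/
theorem FischlinSetup.negligible_error {F : GroupFamily} (Φ : FischlinSetup F) :
    Negligible fun lam => (Φ.error lam).toReal := by
  intro k
  obtain ⟨C, hC, hr⟩ := Φ.r_log.exists_pos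
  refine squeeze_zero' (g := fun n : ℕ => C / (n : ℝ))
    (Eventually.of_forall fun n => by positivity) ?_ (tendsto_const_div_atTop_nhds_zero_nat C)
  -- The factor `lam ^ k` and the bound `r ≤ C * lam` cost `k + 1` powers, and one more makes the
  -- product tend to zero.
  filter_upwards [hr.bound, Φ.slack_large.bound (c := ((k : ℝ) + 2)⁻¹) (by positivity),
    eventually_ge_atTop 1] with n hrn hsn hn
  have hn0 : (0 : ℝ) < n := by exact_mod_cast hn
  have hn1 : (1 : ℝ) ≤ n := by exact_mod_cast hn
  have hlog := Real.log_nonneg hn1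
  rw [Real.norm_natCast, Real.norm_of_nonneg hlog] at hrn hsn
  have hb0 : (0 : ℝ) ≤ 1 - (2 ^ Φ.b n : ℝ)⁻¹ := by
    rw [sub_nonneg]
    exact inv_le_one_of_one_le₀ (one_le_pow₀ (by norm_num))
  have herr : (Φ.error n).toReal = Φ.r n * (1 - (2 ^ Φ.b n : ℝ)⁻¹) ^ 2 ^ Φ.t n := by
    rw [error, ENNReal.toReal_mul, ENNReal.toReal_pow, ENNReal.toReal_sub_of_le _ (by simp)]
    · simp
    · rw [ENNReal.inv_le_one]
      exact one_le_pow₀ (by norm_num)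
  have hpow : (1 - (2 ^ Φ.b n : ℝ)⁻¹) ^ 2 ^ Φ.t n ≤ ((n : ℝ) ^ (k + 2))⁻¹ := by
    have h1 : (1 - (2 ^ Φ.b n : ℝ)⁻¹) ≤ Real.exp (-(2 ^ Φ.b n : ℝ)⁻¹) := by
      have := Real.add_one_le_exp (-(2 ^ Φ.b n : ℝ)⁻¹)
      linarith
    calc _ ≤ Real.exp (-(2 ^ Φ.b n : ℝ)⁻¹) ^ 2 ^ Φ.t n := by gcongr
      _ = Real.exp (-((2 ^ (Φ.t n - Φ.b n) : ℕ) : ℝ)) := by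
          rw [← Real.exp_nat_mul]
          congr 1
          push_cast
          rw [pow_sub₀ _ (by norm_num) (Φ.b_le_t n)]
          ring
      _ ≤ Real.exp (-(((k + 2 : ℕ) : ℝ) * Real.log n)) := by
          gcongr
          rw [inv_mul_eq_div, le_div_iff₀ (by positivity)] at hsn
          push_cast at hsn ⊢
          linarith
      _ = ((n : ℝ) ^ (k + 2))⁻¹ := by
          rw [Real.exp_neg, Real.exp_nat_mul, Real.exp_log hn0]
  rw [herr]
  have hrn' : (Φ.r n : ℝ) ≤ C * n := hrn.trans (by
    gcongr
    exact (Real.log_le_sub_one_of_pos hn0).trans (by linarith))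
  calc (n : ℝ) ^ k * (Φ.r n * (1 - (2 ^ Φ.b n : ℝ)⁻¹) ^ 2 ^ Φ.t n)
      ≤ (n : ℝ) ^ k * (C * n * ((n : ℝ) ^ (k + 2))⁻¹) := by gcongr
    _ = C / n := by rw [pow_add]; field_simp

theorem FischlinSetup.error_ne_top {F : GroupFamily} (Φ : FischlinSetup F) (lam : ℕ) :
    Φ.error lam ≠ ∞ :=
  ENNReal.mul_ne_top (by simp) (ENNReal.pow_ne_top (ENNReal.sub_ne_top (by simp)))

/-- The running time of a polynomial-time program on the input of a simulated tag. -/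
theorem GroupFamily.exists_steps_le (F : GroupFamily) {P : Prog} {U : Finset ℕ}
    (hP : P.PolyTime U) : ∃ q : Polynomial ℕ, ∀ (lam : ℕ) (h A B : F.G lam) (ν : F.Scalar lam),
    ∀ c ∈ (P.exec U (startConfig lam (F.encPP h ++ [F.enc lam A, F.enc lam B, ν.val])
      (emptyTable lam))).support, c.steps ≤ q.eval lam := by
  obtain ⟨q, hq⟩ := hP
  obtain ⟨s, hs⟩ := F.size_bound
  obtain ⟨K, hK⟩ := F.exists_p_le
  -- The input consists of the description, four group elements, and two numbers up to `p`.
  refine ⟨q.comp (Polynomial.X + (5 * s + Polynomial.C (2 * K) * (Polynomial.X + 1) + 9)),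
    fun lam h A B ν c hc => ?_⟩
  refine (Nat.le_add_right _ _).trans ((hq lam _ _ c hc).trans ?_)
  rw [Polynomial.eval_comp]
  refine Polynomial.eval_mono_nat q ?_
  simp only [Polynomial.eval_add, Polynomial.eval_mul, Polynomial.eval_C, Polynomial.eval_X,
    Polynomial.eval_one, Polynomial.eval_ofNat]
  have hsize : ∀ n, n ≤ 2 ^ (K * (lam + 1)) → n.size ≤ K * (lam + 1) + 1 := fun n hn =>
    Nat.size_le.2 (hn.trans_lt (Nat.pow_lt_pow_right (by norm_num) (Nat.lt_succ_self _)))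
  have h1 := hsize _ (hK lam)
  have h2 := hsize _ ((ZMod.val_lt ν).le.trans (hK lam))
  have h3 := (hs lam).1
  have h4 := (hs lam).2
  have e1 := h4 (F.gen lam)
  have e2 := h4 h
  have e3 := h4 A
  have e4 := h4 B
  simp only [GroupFamily.encPP, listSize, List.cons_append, List.nil_append, List.map_cons,
    List.map_nil, List.sum_cons, List.sum_nil]
  have : 2 * K * (lam + 1) = K * (lam + 1) + K * (lam + 1) := by ring
  omega

theorem GroupFamily.poly_div_p_ne_top (F : GroupFamily) (q : Polynomial ℕ) (lam : ℕ) :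
    ((F.p lam - 1 : ℕ) : ℝ≥0∞)⁻¹ + (q.eval lam : ℕ) * (F.p lam : ℝ≥0∞)⁻¹ ≠ ∞ := by
  have hp := F.three_lt lam
  refine ENNReal.add_ne_top.2 ⟨?_, ENNReal.mul_ne_top (by simp) ?_⟩ <;>
    rw [ENNReal.inv_ne_top, Nat.cast_ne_zero] <;> omega

theorem GroupFamily.negligible_poly_div_p (F : GroupFamily) (q : Polynomial ℕ) :
    Negligible fun lam => (((F.p lam - 1 : ℕ) : ℝ≥0∞)⁻¹ +
      (q.eval lam : ℕ) * (F.p lam : ℝ≥0∞)⁻¹).toReal := by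
  have h1 := F.negligible_inv_p.mul_polynomial ((q + 2).map (Nat.castRingHom ℝ))
  refine h1.trans_abs_le fun lam => ?_
  have hp := F.three_lt lam
  have hp0 : (0 : ℝ) < F.p lam := by exact_mod_cast (by omega : 0 < F.p lam)
  have heval : Polynomial.eval (lam : ℝ) ((q + 2).map (Nat.castRingHom ℝ)) =
      ((q.eval lam : ℕ) : ℝ) + 2 := by
    rw [Polynomial.eval_natCast_map]
    simp
  obtain ⟨hp1, hp2⟩ := ENNReal.add_ne_top.1 (F.poly_div_p_ne_top q lam)
  rw [ENNReal.toReal_add hp1 hp2, heval, ENNReal.toReal_inv, ENNReal.toReal_mul, ENNReal.toReal_inv,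
    ENNReal.toReal_natCast, ENNReal.toReal_natCast, ENNReal.toReal_natCast, abs_of_nonneg
    (by positivity), abs_of_nonneg (by positivity), mul_add, mul_comm (_ : ℝ)⁻¹ (2 : ℝ),
    mul_comm (_ : ℝ)⁻¹ (_ : ℝ), add_comm]
  gcongr
  have h2 : (F.p lam : ℝ) ≤ 2 * ((F.p lam - 1 : ℕ) : ℝ) := by
    exact_mod_cast (by omega : F.p lam ≤ 2 * (F.p lam - 1))
  have h3 : (0 : ℝ) < ((F.p lam - 1 : ℕ) : ℝ) := by exact_mod_cast (by omega : 0 < F.p lam - 1)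
  rw [← div_eq_mul_inv, inv_eq_one_div, div_le_div_iff₀ h3 hp0]
  linarith

/-! ### Correctness and simulatability of tags -/

/-- A bound for every outcome of a first random choice bounds the whole experiment. -/
theorem OracleComp.le_prob_lift_bind {lam : ℕ} {α : Type} {p : PMF α}
    {f : α → OracleComp lam Bool} {c : ℝ} (h : ∀ a ∈ p.support, c ≤ (f a).prob) :
    c ≤ (OracleComp.lift p >>= f).prob := by
  rw [OracleComp.prob, OracleComp.run'_lift_bind, ← ENNReal.ofReal_le_iff_le_toReal
    (PMF.apply_ne_top _ _)]
  show _ ≤ (p.bind _) true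
  rw [PMF.bind_apply]
  calc ENNReal.ofReal c = ∑' a, p a * ENNReal.ofReal c := by
        rw [ENNReal.tsum_mul_right, PMF.tsum_coe, one_mul]
    _ ≤ _ := by
        refine ENNReal.tsum_le_tsum fun a => ?_
        by_cases ha : p a = 0
        · simp [ha]
        · gcongr
          exact (ENNReal.ofReal_le_iff_le_toReal (PMF.apply_ne_top _ _)).2
            (h a ((PMF.mem_support_iff _ _).2 ha))

namespace USV

variable {F : GroupFamily} (Φ : FischlinSetup F) (St : TransparentSetup F)

/-- A simulated tag derives the opening that it was made for. -/
theorem derive_simulated {lam : ℕ} (M R : F.G lam) {ν : F.Scalar lam} (h0 : ν ≠ 0) (h1 : ν ≠ -1)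
    (π : List ℕ) :
    derive (M + R) (⟨ν, F.act (1 + ν⁻¹) M, π⟩ : USVTag F lam) = some (M, R) := by
  have h2 : ν + 1 ≠ 0 := fun h => h1 (eq_neg_of_add_eq_zero_left h)
  have h3 : F.act (ν * (ν + 1)⁻¹) (F.act (1 + ν⁻¹) M) = M := by
    rw [← F.act_mul]
    have : ν * (ν + 1)⁻¹ * (1 + ν⁻¹) = 1 := by field_simp
    rw [this, F.act_one]
  rw [derive, if_neg h1]
  simp only [h3, add_sub_cancel_left]

/-- A simulated tag opens as it should, and is accepted whenever the simulated proof is. -/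
theorem simCert_correct (Sim : Prog) {lam : ℕ} (h M R : F.G lam) (hM : M ≠ 0) (hR : R ≠ 0)
    {f : USVTag F lam → Bool} (hf : ∀ ζ, derive (M + R) ζ = some (M, R) → f ζ = true) {c : ℝ}
    (hc : ∀ A B : F.G lam, A ≠ 0 → B ≠ 0 →
      c ≤ OracleComp.prob (Φ.simProof Sim h A B >>= fun π => Φ.verify h A B π)) :
    c ≤ OracleComp.prob (simCert Φ Sim h (M + R) (some (M, R)) >>= fun ζ =>
      vcert Φ h (M + R) ζ >>= fun v => pure (v && f ζ)) := by
  rw [simCert_bind]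
  refine OracleComp.le_prob_lift_bind fun ν hν => ?_
  obtain ⟨h0, h1⟩ := F.ne_of_mem_support_sampleAvoiding hν
  refine (hc (F.act ν⁻¹ M) R (F.act_ne_zero (inv_ne_zero h0) hM) hR).trans (le_of_eq ?_)
  congr 1
  refine bind_congr fun π => ?_
  have hder := derive_simulated M R h0 h1 π
  have h2 : F.act (1 + ν⁻¹) M - M = F.act ν⁻¹ M := by
    rw [F.act_add, F.act_one, add_sub_cancel_left]
  rw [hf _ hder, vcert, hder]
  simp only [Bool.and_true, add_sub_cancel_left, h2, bind_pure]

end USV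

end

theorem mainTheorem7 (F : GroupFamily) (St : TransparentSetup F) (Φ : FischlinSetup F)
    (hDDLEQ : DDLEQHard St) (Sim : Prog) (hSim : Φ.IsUniversalSimulator St Sim) :
    USV.IsTagSimulator Φ St (fun _ => USV.simCert Φ Sim) where
  polyTime := by
    obtain ⟨K, hK⟩ := F.exists_p_le
    exact ⟨F.simCertProg K Sim, F.simCertProg_polyTime K hSim.polyTime, fun lam h C o =>
      F.simCertProg_run hK Φ Sim h C o⟩
  correct := by
    obtain ⟨μ, hμ, h⟩ := hSim.universal
    refine ⟨μ, hμ, fun lam g hg C M R hC hM hR => ?_⟩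
    subst hC
    exact USV.simCert_correct Φ Sim g M R hM hR (fun ζ hζ => @decide_eq_true _ (_) hζ)
      (h lam g hg)
  indistinguishable := by
    intro D hDfree hD
    have hne : ∀ lam, ∀ h ∈ (St.sample lam).support, h ≠ 0 := fun lam h hh => by
      obtain ⟨s, -, rfl⟩ := (PMF.mem_support_map_iff _ _ _).1 hh
      exact St.ne_zero lam s
    obtain ⟨q, hq⟩ := F.exists_steps_le (F.simTuple_polyTime hSim.polyTime hD)
    have hzk := hSim.zeroKnowledge (F.tagTuple D).sampleNu
      (F.tagTuple_programFree hDfree |>.sampleNu) (F.tagTuple_polyTime hD |>.sampleNu)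
    have hdd := hDDLEQ (USV.adversary Φ D Sim) (Prog.internalized_oracleFree _ _)
      ((F.simTuple_polyTime hSim.polyTime hD).sampleNu.internalized _)
    -- The five steps of the chain, in order.
    have hsum := (((Φ.negligible_error.add hzk).add (hdd.const_mul 2)).add
      (F.negligible_poly_div_p q)).add Φ.negligible_error
    refine hsum.trans_abs_le fun lam => ?_
    -- On a true statement, the second exponent of the DDLEQ game is not used.
    have hworld : (Φ.zkSim St Sim (F.tagTuple D).sampleNu lam).run' (emptyTable lam) =
        USV.ddleqWorld Φ St D Sim lam true := by
      rw [USV.zkSim_run']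
      refine bind_congr fun h => bind_congr fun w => ?_
      exact (PMF.bind_const (F.sampleUnit lam) _).symm
    have herr : Φ.error lam ≠ ⊤ := Φ.error_ne_top lam
    have h1 := (USV.near_realGame Φ St D (hne lam)).abs_sub_le herr
    have h2 := USV.ddleqGame_prob Φ St D Sim (lam := lam)
    have h3 := (USV.near_afterProof Φ St D Sim (hq lam)).abs_sub_le (F.poly_div_p_ne_top q lam)
    have h4 := (USV.near_simGame Φ St D Sim (hne lam)).abs_sub_le herr
    rw [← hworld] at h2
    rw [abs_abs]
    refine le_trans ?_ (le_abs_self _)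
    simp only [Pi.add_apply, ← h2]
    simp only [OracleComp.prob]
    rw [abs_sub_comm] at h3 h4
    refine (abs_sub_le _ _ _).trans (add_le_add ((abs_sub_le _ _ _).trans (add_le_add
      ((abs_sub_le _ _ _).trans (add_le_add ((abs_sub_le _ _ _).trans (add_le_add h1 le_rfl))
        le_rfl)) h3)) h4)
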